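/- **Theorem (termination of CUTSAT++).** Let $C_0$ be a finite set of linear integer constraints, i.e. inequalities $p\le 0$ and divisibility constraints $d\mid p$ with $d>0$, where $p$ is a linear polynomial with integer coefficients, and let the slack variable $x_S$ not occur in $C_0$. Then there is no infinite derivation $S_0\Rightarrow S_1\Rightarrow\cdots$ of CUTSAT++ from the initial state $S_0=\langle[\![\,]\!],C_0\rangle$ that follows a strictly-two-layered strategy. The notions are the following. *States.* $\langle M,C\rangle$ (search), $\langle M,C\rangle\vdash I$ (conflict, $I$ an inequality), and the final states $\langle\upsilon,\mathrm{sat}\rangle$ and unsat. $C$ is a problem (a set of constraints), $M$ a finite sequence of bounds $x\ge b$, $x\le b$, each decided, or propagated with an inequality as justification. $\mathrm{lower}(x,M)$ and $\mathrm{upper}(x,M)$ are the best bounds in $M$ ($\mp\infty$ if there is none), $\mathrm{lower}(p,M)$ is the resulting lower bound of a polynomial; $x$ is fixed if $\mathrm{lower}(x,M)=\mathrm{upper}(x,M)\in\mathbb Z$, and the value of a fixed $p$ is $\mathrm{lower}(p,M)$. An inequality $p\le0$ is a conflict if $\mathrm{lower}(p,M)>0$; $d\mid ax+p$ is a conflict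 if $p$ is fixed and $d\nmid ab+\mathrm{lower}(p,M)$ for all integers $b\in[\mathrm{lower}(x,M),\mathrm{upper}(x,M)]$. A variable $x$ is guarded in $C$ if $C$ contains constraints $x-u\le0$ and $-x+l\le0$; a constraint is guarded if all its variables are. A constraint $\pm x-b\le0$ is simple. A divisibility constraint may be negated to make a given coefficient positive. *Order.* $\prec$ is a strict total order of the variables with all guarded variables below all unguarded ones and $x_S$ the smallest unguarded variable, in every state; during a derivation only the order among guarded variables (and of variables that do not occur) may change. $\mathrm{top}(I)$ is the $\prec$-maximal variable of $I$; for a constraint without variables it counts as smaller than every variable. $\mathrm{prefix}(M,y)$ is the largest prefix of $M$ whose decided bounds are for variables $\prec y$. *Bounds and justifications.* $J=(ax+p\le0)$ propagates $x\le b$ with $b=-\lceil \mathrm{lower}(p,M)/a\rceil$ if $a>0$, and $x\ge b$ with $b=-\lfloor \mathrm{lower}(p,M)/a\rfloor$ if $a<0$; it improves $M$ if $b$ is strictly better than the current bound of this kind and does not contradict the opposite one. $D=(d\mid ax+p)$, $a>0$, $p$ fixed with value $k$, propagates from the current bound $b=\mathrm{lower}(x,M)$ (resp. $\mathrm{upper}(x,M)$),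 if $d\nmid ab+k$, the bound $\lceil(d\lceil(ab+k)/d\rceil-k)/a\rceil$ (resp. the same with $\lfloor\cdot\rfloor$). For $\gamma$ with justification $cx+q\le0$, $\mathrm{resolve}(\gamma,ax+p\le0)$ is $|a|q+|c|p\le0$ if $ac<0$, and $ax+p\le0$ otherwise. $\mathrm{tight}(\pm ax+p\le0,x,M)$, $a>0$, is any inequality derivable from $\langle M,\pm ax\oplus p\rangle$ by: Consume, $\langle M,\pm ax+as\oplus aky+r\rangle\to\langle M,\pm ax+as+aky\oplus r\rangle$ ($y\ne x$); Resolve-Implied, $\langle[\![M,\gamma]\!],\pm ax+as\oplus p\rangle\to\langle M,\pm ax+as\oplus q\rangle$ for propagated $\gamma$ and $(q\le 0)=\mathrm{resolve}(\gamma,p\le 0)$; for a last bound $\gamma$ decided $y\ge b$ and $y\le b$ in $M$ with justification $y+q\le0$, $\langle[\![M,\gamma]\!],\pm ax+as\oplus cy+r\rangle\to\langle M,\pm ax+as+aky\oplus r+(ak-c)q\rangle$ with $k=\lceil c/a\rceil$, or, if $c<0$ and the justification is $y-q\le0$, $\to\langle M,\pm ax+as\oplus cq+r\rangle$; for a last bound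 decided $y\le b$ and $y\ge b$ in $M$ with justification $-y+q\le0$, $\to\langle M,\pm ax+as+aky\oplus r+(c-ak)q\rangle$ with $k=\lfloor c/a\rfloor$, or, if $c>0$, $\to\langle M,\pm ax+as\oplus cq+r\rangle$; Round, $\langle M,\pm ax+as\oplus b\rangle\to\ \pm x+s+\lceil b/a\rceil\le0$. For a lower bound, $\text{div-derive}(D,x,M)=\mathrm{tight}(-ax+dr-p\le0,x,M)$, where $-z+r\le0$ is obtained by tight from $-dz+ax+p\le0$ for a new variable $z$ (as the distinguished variable) without applying Consume to $x$ or $z$; for an upper bound it is $\mathrm{tight}(ax+dr+p\le0,x,M)$, with $z+r\le0$ obtained from $dz-ax-p\le0$. *Rules.* - Decide: add decided $x\ge b$ if $\mathrm{lower}(x,M)<b=\mathrm{upper}(x,M)<\infty$, or decided $x\le b$ if $-\infty<\mathrm{lower}(x,M)=b<\mathrm{upper}(x,M)$. - Propagate: add an improving bound of an inequality $J\in C$, justified by $\mathrm{tight}(J,x,M)$. - Propagate-Div: add the bound of a divisibility constraint in $C$, justified by div-derive, if it does not contradict the opposite bound. Conflict-Div: if it contradicts it, go to $\langle M,C\rangle\vdash\text{div-derive}(D,x,M)$.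 - Conflict: from $p\le0\in C$ with $\mathrm{lower}(p,M)>0$ to $\langle M,C\rangle\vdash p\le0$. - Unsat-Div: to unsat if some $d\mid\sum a_ix_i+c\in C$ has $\gcd(d,a_1,\dots,a_n)\nmid c$. Sat: to the final state if all variables of $C$ are fixed and their values satisfy $C$. - Forget: remove $J\in C$ if $C\setminus\{J\}$ implies $J$ over $\mathbb Z$. - Slack-Intro: add $-x_S\le0$, $x-x_S\le0$, $-x-x_S\le0$ for a stuck $x$ in a stuck state. Here $x$ is stuck if $M$ has no bound for $x$ and no inequality of $C$ propagates one that the strategy allows; a state is stuck if all unfixed variables of $C$ are stuck and Sat, Unsat-Div, Conflict, Conflict-Div are not applicable under the strategy. - Resolve: $\langle[\![M,\gamma]\!],C\rangle\vdash I$ to $\langle M,C\rangle\vdash\mathrm{resolve}(\gamma,I)$ for propagated $\gamma$. Skip-Decision: drop a last decided bound if $I$ remains a conflict. Unsat: from $\langle M,C\rangle\vdash b\le0$ with $b>0$ to unsat. Learn: add $I\notin C$ to $C$. Backjump: $\langle[\![M,\gamma,M']\!],C\rangle\vdash J$, $\gamma$ decided, to $\langle[\![M,\gamma']\!],C\rangle$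 where $\gamma'$ is the improving bound that $J$ propagates under $M$, justified by tight. - Solve-Div: for distinct divisibility constraints $I_1=(d_1\mid a_1x+p_1)$, $I_2=(d_2\mid a_2x+p_2)$ in $C$, $a_1,a_2>0$, with unguarded top variable $x$ and all other variables fixed, replace them by $I_1'=(d_1d_2\mid dx+c_1d_2p_1+c_2d_1p_2)$ and $I_2'=(d\mid -a_1p_2+a_2p_1)$, where $d=\gcd(a_1d_2,a_2d_1)=c_1a_1d_2+c_2a_2d_1$. $M$ is kept if $I_2'$ is not a conflict (Left) and becomes $\mathrm{prefix}(M,\mathrm{top}(I_2'))$ if it is (Right). - Resolve-Cooper: if $(x,C')$ is a conflicting core, $C'\subseteq C$, $x$ is unguarded, all variables $z\prec x$ of $C$ are fixed, and no conflict $J\in C$ has $\mathrm{top}(J)\prec x$, add its strong resolvent $R_k\cup R_c$ to $C$ and replace $M$ by $\mathrm{prefix}(M,\min_{I\in R_c}\mathrm{top}(I))$. Conflicting cores ($x$ is the top variable of all constraints of $C'$, the other variables are fixed, $a,b,c>0$, $k$ is a fresh variable smaller than all unguarded variables): (1) $\{-ax+p\le0,\ bx-q\le0\}$ with propagated lower bound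 greater than the propagated upper bound; $R_k=\{-k\le0,k-a+1\le0\}$, $R_c=\{bp-aq+bk\le0,\ a\mid k+p\}$. (2) $\{-ax+p\le0,\ bx-q\le0,\ d\mid cx+s\}$ with propagated bounds $b_l\le b_u$ and no $e\in[b_l,b_u]$ with $d\mid ce+\mathrm{lower}(s,M)$; $R_k=\{-k\le0,k-m\le0\}$ with $m=\mathrm{lcm}(a,\frac{ad}{\gcd(ad,c)})-1$, $R_c=\{bp-aq+bk\le0,\ a\mid k+p,\ ad\mid cp+as+ck\}$. (3) $\{d\mid cx+s\}$ with $d\nmid ce+\mathrm{lower}(s,M)$ for all $e\in\mathbb Z$; $R_k=\emptyset$, $R_c=\{\gcd(c,d)\mid s\}$. *Strategy.* A strategy is strictly-two-layered if: 1. it is reasonable: Propagate applied to simple constraints has the highest priority; as long as some guarded variable lacks a lower or an upper bound in $M$, Decide, Propagate-Div, and Propagate with constraints that are not simple are not applied; and Forget is applied only finitely often; 2. it is eager top-level propagating: for unguarded $x$, a bound of $x$ is propagated only from a constraint with top variable $x$, and from $d\mid ax+p$ only if $x$ has finite lower and upper bounds, or if $\gcd(a,d)\mid\mathrm{lower}(p,M)$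 and it is the only divisibility constraint in $C$ with top variable $x$; a decision $\gamma$ for unguarded $x$ is made only if in all $I\in C$ with top variable $x$ all other variables are fixed, no such $I$ is a conflict in $[\![M,\gamma]\!]$, and $x$ has finite lower and upper bounds or is the top variable of at most one divisibility constraint in $C$; 3. Forget, Conflict and Conflict-Div are applied only to guarded constraints; 4. Forget is applied neither to divisibility constraints nor to constraints of strong resolvents added before; 5. only guarded constraints are used to propagate guarded variables. -/

import Mathlib

/-! The calculus CUTSAT++ for linear integer constraints and its strictly-two-layered strategies. -/

namespace CutSat

noncomputable section

/-! ### Linear polynomials and constraints -/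

/-- A linear polynomial `∑ aₓ x + c`: its coefficients and its constant. -/
abbrev Poly (V : Type*) := (V →₀ ℤ) × ℤ

/-- The polynomial `x`. -/
def X {V : Type*} (x : V) : Poly V := (Finsupp.single x 1, 0)

/-- A constant polynomial. -/
def const {V : Type*} (b : ℤ) : Poly V := (0, b)

def coeff {V : Type*} (p : Poly V) (x : V) : ℤ := p.1 x

/-- `p` without its `x`-term. -/
def rest {V : Type*} (p : Poly V) (x : V) : Poly V := p - coeff p x • X x

def eval {V : Type*} (ν : V → ℤ) (p : Poly V) : ℤ := p.1.sum (fun x a => a * ν x) + p.2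

/-- `le p` is the inequality `p ≤ 0`, and `dvd d p` the divisibility constraint `d ∣ p`. -/
inductive Constraint (V : Type*) where
  | le (p : Poly V)
  | dvd (d : ℤ) (p : Poly V)

def Constraint.poly {V : Type*} : Constraint V → Poly V
  | .le p => p
  | .dvd _ p => p

/-- The variables that occur in a constraint. -/
def Constraint.vars {V : Type*} (J : Constraint V) : Finset V := J.poly.1.support

def Constraint.Sat {V : Type*} (ν : V → ℤ) : Constraint V → Prop
  | .le p => eval ν p ≤ 0
  | .dvd d p => d ∣ eval ν p

def Constraint.IsDvd {V : Type*} : Constraint V → Prop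
  | .le _ => False
  | .dvd _ _ => True

/-- A set of constraints, read as a conjunction. -/
abbrev Problem (V : Type*) := Set (Constraint V)

def problemVars {V : Type*} (C : Problem V) : Set V := {x | ∃ J ∈ C, x ∈ J.vars}

/-- Entailment over the integers. -/
def Entails {V : Type*} (C : Problem V) (J : Constraint V) : Prop :=
  ∀ ν : V → ℤ, (∀ I ∈ C, I.Sat ν) → J.Sat ν

/-- `x` is guarded in `C`: `C` contains constraints `x - u ≤ 0` and `-x + l ≤ 0`. -/
def Guarded {V : Type*} (C : Problem V) (x : V) : Prop :=
  (∃ u : ℤ, Constraint.le (X x - const u) ∈ C) ∧ ∃ l : ℤ, Constraint.le (-X x + const l) ∈ C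

/-- A constraint is guarded if all its variables are. -/
def GuardedConstraint {V : Type*} (C : Problem V) (J : Constraint V) : Prop :=
  ∀ x ∈ J.vars, Guarded C x

/-- A simple constraint `x - b ≤ 0` or `-x - b ≤ 0`. -/
def IsSimple {V : Type*} (J : Constraint V) : Prop :=
  ∃ (x : V) (b : ℤ), J = .le (X x - const b) ∨ J = .le (-X x - const b)

/-- `J` is `d ∣ a x + p` with `a > 0` and `x` not in `p`, up to the sign of the polynomial. -/
def DvdForm {V : Type*} (J : Constraint V) (d a : ℤ) (x : V) (p : Poly V) : Prop :=
  0 < a ∧ coeff p x = 0 ∧ (J = .dvd d (a • X x + p) ∨ J = .dvd d (-(a • X x + p)))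

/-! ### Bounds and bound sequences -/

inductive BoundKind where
  | ge
  | le

/-- A bound `var ≥ val` or `var ≤ val`. It is decided if `just = none`, and it is propagated
with the justification `I ≤ 0` if `just = some I`. -/
structure Bound (V : Type*) where
  var : V
  kind : BoundKind
  val : ℤ
  just : Option (Poly V)

/-- A bound sequence; new bounds are added at the end of the list. -/
abbrev Trail (V : Type*) := List (Bound V)

open Classical in
/-- The greatest lower bound for `x` in `M`, or `-∞`. -/
def lower {V : Type*} (M : Trail V) (x : V) : WithBot ℤ :=
  (M.filterMap fun γ => if γ.var = x ∧ γ.kind = .ge then some γ.val else none).maximum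

open Classical in
/-- The least upper bound for `x` in `M`, or `∞`. -/
def upper {V : Type*} (M : Trail V) (x : V) : WithTop ℤ :=
  (M.filterMap fun γ => if γ.var = x ∧ γ.kind = .le then some γ.val else none).minimum

/-- The lower bound of the term `a x`, for `a ≠ 0`. -/
def lowerTerm {V : Type*} (M : Trail V) (a : ℤ) (x : V) : WithBot ℤ :=
  if 0 < a then WithBot.map (fun l => a * l) (lower M x)
  else WithTop.recTopCoe (C := fun _ => WithBot ℤ) ⊥ (fun u => ((a * u : ℤ) : WithBot ℤ))
    (upper M x)

/-- The lower bound of a polynomial. -/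
def lowerPoly {V : Type*} (M : Trail V) (p : Poly V) : WithBot ℤ :=
  (∑ x ∈ p.1.support, lowerTerm M (p.1 x) x) + (p.2 : WithBot ℤ)

def Fixed {V : Type*} (M : Trail V) (x : V) : Prop :=
  ∃ b : ℤ, lower M x = b ∧ upper M x = b

/-- `p` is fixed in `M` with value `k`. -/
def IsVal {V : Type*} (M : Trail V) (p : Poly V) (k : ℤ) : Prop :=
  (∀ x ∈ p.1.support, Fixed M x) ∧ lowerPoly M p = k

/-- The value that a complete `M` assigns to a variable. -/
def value {V : Type*} (M : Trail V) (x : V) : ℤ := (lower M x).unbotD 0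

/-- `J` is a conflict under `M`. -/
def IsConflict {V : Type*} (M : Trail V) : Constraint V → Prop
  | .le p => 0 < lowerPoly M p
  | .dvd d p => ∃ (x : V) (k : ℤ), IsVal M (rest p x) k ∧
      ∀ b : ℤ, lower M x ≤ b → (b : WithTop ℤ) ≤ upper M x → ¬ d ∣ coeff p x * b + k

/-- `b` is the (finite) bound for `x` that `p ≤ 0` propagates under `M`. -/
def IsBound {V : Type*} (M : Trail V) (p : Poly V) (x : V) (b : ℤ) : Prop :=
  ∃ l : ℤ, lowerPoly M (rest p x) = l ∧
    ((0 < coeff p x ∧ b = -⌈(l : ℚ) / (coeff p x : ℚ)⌉) ∨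
      (coeff p x < 0 ∧ b = -⌊(l : ℚ) / (coeff p x : ℚ)⌋))

/-- `p ≤ 0` propagates for `x` the bound value `b`, and this improves the bounds in `M`. -/
def Improves {V : Type*} (M : Trail V) (p : Poly V) (x : V) (b : ℤ) : Prop :=
  IsBound M p x b ∧
    ((coeff p x < 0 ∧ lower M x < b ∧ (b : WithTop ℤ) ≤ upper M x) ∨
      (0 < coeff p x ∧ lower M x ≤ b ∧ (b : WithTop ℤ) < upper M x))

/-- `z` is new with respect to `C` and `M`. -/
def Fresh {V : Type*} (C : Problem V) (M : Trail V) (z : V) : Prop :=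
  z ∉ problemVars C ∧ ∀ γ ∈ M, γ.var ≠ z ∧ ∀ I ∈ γ.just, z ∉ I.1.support

/-! ### Justifications -/

/-- For the propagated bound `γ` with justification `c x + q ≤ 0`, and for `p = a x + r`:
`|a| q + |c| r` if `a c < 0`, and `p` otherwise. -/
def resolve {V : Type*} (γ : Bound V) (p : Poly V) : Poly V :=
  match γ.just with
  | none => p
  | some I =>
    if coeff p γ.var * coeff I γ.var < 0 then |coeff p γ.var| • I + |coeff I γ.var| • p else p

/-- `TightDeriv x a σ noConsume M s r I`: the rules for tightly propagating inequalities lead from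
`⟨M, σ a x + a s ⊕ r⟩`, where `σ = ±1`, to the inequality `I ≤ 0`. The rule Consume is not applied
to the variables in `noConsume`. -/
inductive TightDeriv {V : Type*} (x : V) (a σ : ℤ) (noConsume : V → Prop) :
    Trail V → Poly V → Poly V → Poly V → Prop where
  | round (M : Trail V) (s : Poly V) (b : ℤ) :
      TightDeriv x a σ noConsume M s (const b) (σ • X x + s + const ⌈(b : ℚ) / (a : ℚ)⌉)
  | consume (M : Trail V) (s r : Poly V) (y : V) (k : ℤ) (I : Poly V)
      (hy : ¬ noConsume y) (hk : coeff r y = a * k)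
      (h : TightDeriv x a σ noConsume M (s + k • X y) (rest r y) I) :
      TightDeriv x a σ noConsume M s r I
  | resolveImplied (M : Trail V) (γ : Bound V) (s p I : Poly V) (hγ : γ.just ≠ none)
      (h : TightDeriv x a σ noConsume M s (resolve γ p) I) :
      TightDeriv x a σ noConsume (M ++ [γ]) s p I
  | decideLower (M : Trail V) (y : V) (b k : ℤ) (s r q I : Poly V)
      (hI : (⟨y, .le, b, some (X y + q)⟩ : Bound V) ∈ M)
      (hk : k = ⌈(coeff r y : ℚ) / (a : ℚ)⌉)
      (h : TightDeriv x a σ noConsume M (s + k • X y) (rest r y + (a * k - coeff r y) • q) I) :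
      TightDeriv x a σ noConsume (M ++ [⟨y, .ge, b, none⟩]) s r I
  | decideLowerNeg (M : Trail V) (y : V) (b : ℤ) (s r q I : Poly V)
      (hI : (⟨y, .le, b, some (X y - q)⟩ : Bound V) ∈ M) (hc : coeff r y < 0)
      (h : TightDeriv x a σ noConsume M s (rest r y + coeff r y • q) I) :
      TightDeriv x a σ noConsume (M ++ [⟨y, .ge, b, none⟩]) s r I
  | decideUpper (M : Trail V) (y : V) (b k : ℤ) (s r q I : Poly V)
      (hI : (⟨y, .ge, b, some (-X y + q)⟩ : Bound V) ∈ M)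
      (hk : k = ⌊(coeff r y : ℚ) / (a : ℚ)⌋)
      (h : TightDeriv x a σ noConsume M (s + k • X y) (rest r y + (coeff r y - a * k) • q) I) :
      TightDeriv x a σ noConsume (M ++ [⟨y, .le, b, none⟩]) s r I
  | decideUpperPos (M : Trail V) (y : V) (b : ℤ) (s r q I : Poly V)
      (hI : (⟨y, .ge, b, some (-X y + q)⟩ : Bound V) ∈ M) (hc : 0 < coeff r y)
      (h : TightDeriv x a σ noConsume M s (rest r y + coeff r y • q) I) :
      TightDeriv x a σ noConsume (M ++ [⟨y, .le, b, none⟩]) s r I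

/-- `I ≤ 0` is a result of `tight (p ≤ 0, x, M)`. -/
def Tight {V : Type*} (M : Trail V) (p : Poly V) (x : V) (I : Poly V) : Prop :=
  coeff p x ≠ 0 ∧
    TightDeriv x |coeff p x| (coeff p x).sign (fun y => y = x) M 0 (rest p x) I

/-- `b` is the current lower (upper) bound of `x`. -/
def IsCurrent {V : Type*} (M : Trail V) (x : V) (b : ℤ) : BoundKind → Prop
  | .ge => lower M x = b
  | .le => upper M x = b

/-- The bound that `d ∣ a x + p` propagates for `x` from the current lower (upper) bound `b`,
where `k` is the value of `p`. -/
def dvdBound (d a k b : ℤ) : BoundKind → ℤ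
  | .ge => ⌈((d * ⌈((a * b + k : ℤ) : ℚ) / (d : ℚ)⌉ - k : ℤ) : ℚ) / (a : ℚ)⌉
  | .le => ⌊((d * ⌊((a * b + k : ℤ) : ℚ) / (d : ℚ)⌋ - k : ℤ) : ℚ) / (a : ℚ)⌋

/-- `I ≤ 0` is a result of `div-derive` for `d ∣ a x + p`. First a tight bound `-z + r ≤ 0`
(`z + r ≤ 0`) is derived from `-d z + a x + p ≤ 0` (`d z - a x - p ≤ 0`) for a new variable `z`,
without consuming `x` or `z`; then `z` is eliminated with `d z = a x + p`. -/
def DivDerive {V : Type*} (C : Problem V) (M : Trail V) (d a : ℤ) (x : V) (p I : Poly V) :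
    BoundKind → Prop
  | .ge => ∃ (z : V) (r : Poly V), Fresh C M z ∧ z ≠ x ∧
      TightDeriv z d (-1) (fun y => y = x ∨ y = z) M 0 (a • X x + p) (-X z + r) ∧
      Tight M (-(a • X x) + d • r - p) x I
  | .le => ∃ (z : V) (r : Poly V), Fresh C M z ∧ z ≠ x ∧
      TightDeriv z d 1 (fun y => y = x ∨ y = z) M 0 (-(a • X x) - p) (X z + r) ∧
      Tight M (a • X x + d • r + p) x I

/-! ### Premises of rules -/

/-- The bound `γ` for `x = γ.var` is the one propagated by `p ≤ 0`, and it improves `M`. -/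
def PropagatedBy {V : Type*} (M : Trail V) (p : Poly V) (γ : Bound V) : Prop :=
  ∃ (x : V) (b : ℤ) (I : Poly V), Improves M p x b ∧ Tight M p x I ∧
    ((coeff p x < 0 ∧ γ = ⟨x, .ge, b, some I⟩) ∨ (0 < coeff p x ∧ γ = ⟨x, .le, b, some I⟩))

/-- The divisibility constraint `J` is violated by the current lower (upper) bound of `x`, and `c`
is the next bound of this kind, with justification `I ≤ 0`. -/
def DvdNext {V : Type*} (C : Problem V) (M : Trail V) (J : Constraint V) (x : V)
    (kind : BoundKind) (c : ℤ) (I : Poly V) : Prop :=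
  ∃ (d a k b : ℤ) (p : Poly V), DvdForm J d a x p ∧ IsVal M p k ∧ IsCurrent M x b kind ∧
    ¬ d ∣ a * b + k ∧ c = dvdBound d a k b kind ∧ DivDerive C M d a x p I kind

/-- A new lower (upper) bound `c` for `x` does not contradict the bounds in `M`. -/
def Compatible {V : Type*} (M : Trail V) (x : V) (c : ℤ) : BoundKind → Prop
  | .ge => (c : WithTop ℤ) ≤ upper M x
  | .le => lower M x ≤ c

/-- The premise of Conflict-Div. -/
def ConflictDiv {V : Type*} (C : Problem V) (M : Trail V) (J : Constraint V) (I : Poly V) : Prop :=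
  ∃ (x : V) (kind : BoundKind) (c : ℤ), DvdNext C M J x kind c I ∧ ¬ Compatible M x c kind

/-- The premise of Unsat-Div. -/
def UnsatDiv {V : Type*} (C : Problem V) : Prop :=
  ∃ (d : ℤ) (p : Poly V), Constraint.dvd d p ∈ C ∧
    ¬ (Int.gcd d (p.1.support.gcd p.1) : ℤ) ∣ p.2

/-- `M` is complete, and its assignment satisfies `C`. -/
def Satisfies {V : Type*} (M : Trail V) (C : Problem V) : Prop :=
  (∀ x ∈ problemVars C, Fixed M x) ∧ ∀ J ∈ C, J.Sat (value M)

/-- `x` is the top variable of `J` with respect to the order `lt`. -/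
def IsTop {V : Type*} (lt : V → V → Prop) (J : Constraint V) (x : V) : Prop :=
  x ∈ J.vars ∧ ∀ y ∈ J.vars, y ≠ x → lt y x

/-- The top variable of `J` is smaller than `x`. A constraint without variables counts as smaller
than every variable. -/
def TopLt {V : Type*} (lt : V → V → Prop) (J : Constraint V) (x : V) : Prop :=
  ∀ y ∈ J.vars, lt y x

/-- `x` is smaller than the top variable of `J`. -/
def LtTop {V : Type*} (lt : V → V → Prop) (x : V) (J : Constraint V) : Prop :=
  ∃ y ∈ J.vars, lt x y

/-- A strictly-two-layered strategy may use `J` to propagate a bound of `x`: `x` is the top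
variable of `J` if `x` is unguarded, and `J` is guarded if `x` is. -/
def MayPropagate {V : Type*} (lt : V → V → Prop) (C : Problem V) (J : Constraint V) (x : V) :
    Prop :=
  (¬ Guarded C x → IsTop lt J x) ∧ (Guarded C x → GuardedConstraint C J)

/-- `x` is stuck: `M` has no bounds for `x`, and no inequality propagates one. -/
def StuckVar {V : Type*} (lt : V → V → Prop) (M : Trail V) (C : Problem V) (x : V) : Prop :=
  (∀ γ ∈ M, γ.var ≠ x) ∧
    ¬ ∃ (p : Poly V) (b : ℤ), Constraint.le p ∈ C ∧ Improves M p x b ∧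
      MayPropagate lt C (.le p) x

/-- All unfixed variables are stuck, and Sat, Unsat-Div, Conflict and Conflict-Div (the last two on
guarded constraints) are not applicable. -/
def StuckState {V : Type*} (lt : V → V → Prop) (M : Trail V) (C : Problem V) : Prop :=
  (∀ x ∈ problemVars C, ¬ Fixed M x → StuckVar lt M C x) ∧
    ¬ Satisfies M C ∧ ¬ UnsatDiv C ∧
    (∀ p, Constraint.le p ∈ C → GuardedConstraint C (.le p) → ¬ 0 < lowerPoly M p) ∧
    (∀ J ∈ C, GuardedConstraint C J → ∀ I, ¬ ConflictDiv C M J I)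

open Classical in
/-- The largest prefix of `M` all of whose decided bounds are for variables with property `P`. -/
def decPrefix {V : Type*} (P : V → Prop) (M : Trail V) : Trail V :=
  M.takeWhile fun γ => decide (γ.just = none → P γ.var)

/-- `(J₁', J₂')` is a result of `div-solve (x, J₁, J₂)`. -/
def DivSolve {V : Type*} (x : V) (J₁ J₂ J₁' J₂' : Constraint V) : Prop :=
  ∃ (d₁ a₁ d₂ a₂ c₁ c₂ d : ℤ) (p₁ p₂ : Poly V),
    DvdForm J₁ d₁ a₁ x p₁ ∧ DvdForm J₂ d₂ a₂ x p₂ ∧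
    d = Int.gcd (a₁ * d₂) (a₂ * d₁) ∧ c₁ * a₁ * d₂ + c₂ * a₂ * d₁ = d ∧
    J₁' = .dvd (d₁ * d₂) (d • X x + (c₁ * d₂) • p₁ + (c₂ * d₁) • p₂) ∧
    J₂' = .dvd d (-(a₁ • p₂) + a₂ • p₁)

/-- The common premises of Solve-Div-Left and Solve-Div-Right. -/
def SolveDiv {V : Type*} (lt : V → V → Prop) (M : Trail V) (C : Problem V)
    (J₁ J₂ J₁' J₂' : Constraint V) : Prop :=
  J₁ ∈ C ∧ J₂ ∈ C ∧ J₁ ≠ J₂ ∧ ∃ x : V, IsTop lt J₁ x ∧ IsTop lt J₂ x ∧ ¬ Guarded C x ∧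
    (∀ J ∈ ({J₁, J₂} : Set (Constraint V)), ∀ y ∈ J.vars, y ≠ x → Fixed M y) ∧
    DivSolve x J₁ J₂ J₁' J₂'

/-- `k` is a new variable. As it will be guarded, it is smaller than all unguarded variables. -/
def FreshGuarded {V : Type*} (lt : V → V → Prop) (xS : V) (C : Problem V) (M : Trail V) (k : V) :
    Prop :=
  Fresh C M k ∧ k ≠ xS ∧ lt k xS ∧ ∀ x ∈ problemVars C, ¬ Guarded C x → lt k x

/-- `x` is the top variable of the constraints in `C'`, and all their other variables are fixed. -/
def CoreTop {V : Type*} (lt : V → V → Prop) (M : Trail V) (x : V) (C' : Problem V) : Prop :=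
  ∀ J ∈ C', IsTop lt J x ∧ ∀ y ∈ J.vars, y ≠ x → Fixed M y

/-- `(x, C')` is a conflicting core, and `cooper (x, C') = (Rk, Rc)` is its strong resolvent.
The three constructors are the interval, divisibility and diophantine conflicting cores. -/
inductive Cooper {V : Type*} (lt : V → V → Prop) (xS : V) (C : Problem V) (M : Trail V) (x : V) :
    Problem V → Problem V → Problem V → Prop where
  | interval (a b bl bu : ℤ) (p q : Poly V) (k : V)
      (ha : 0 < a) (hb : 0 < b) (hp : coeff p x = 0) (hq : coeff q x = 0)
      (htop : CoreTop lt M x {.le (-(a • X x) + p), .le (b • X x - q)})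
      (hbl : IsBound M (-(a • X x) + p) x bl) (hbu : IsBound M (b • X x - q) x bu)
      (hlt : bu < bl) (hk : FreshGuarded lt xS C M k) :
      Cooper lt xS C M x
        {.le (-(a • X x) + p), .le (b • X x - q)}
        {.le (-X k), .le (X k - const a + const 1)}
        {.le (b • p - a • q + b • X k), .dvd a (X k + p)}
  | divisibility (a b c d m bl bu v : ℤ) (p q s : Poly V) (J : Constraint V) (k : V)
      (ha : 0 < a) (hb : 0 < b) (hp : coeff p x = 0) (hq : coeff q x = 0)
      (hJ : DvdForm J d c x s)
      (htop : CoreTop lt M x {.le (-(a • X x) + p), .le (b • X x - q), J})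
      (hbl : IsBound M (-(a • X x) + p) x bl) (hbu : IsBound M (b • X x - q) x bu)
      (hle : bl ≤ bu) (hs : IsVal M s v)
      (hno : ∀ e : ℤ, bl ≤ e → e ≤ bu → ¬ d ∣ c * e + v)
      (hm : m = (Int.lcm a (a * d / (Int.gcd (a * d) c : ℤ)) : ℤ) - 1)
      (hk : FreshGuarded lt xS C M k) :
      Cooper lt xS C M x
        {.le (-(a • X x) + p), .le (b • X x - q), J}
        {.le (-X k), .le (X k - const m)}
        {.le (b • p - a • q + b • X k), .dvd a (X k + p),
          .dvd (a * d) (c • p + a • s + c • X k)}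
  | diophantine (c d v : ℤ) (s : Poly V) (J : Constraint V)
      (hJ : DvdForm J d c x s) (htop : CoreTop lt M x {J}) (hs : IsVal M s v)
      (hno : ∀ e : ℤ, ¬ d ∣ c * e + v) :
      Cooper lt xS C M x {J} ∅ {.dvd (Int.gcd c d) s}

/-! ### The transition system -/

inductive State (V : Type*) where
  | search (M : Trail V) (C : Problem V)
  | conflict (M : Trail V) (C : Problem V) (p : Poly V)
  | sat (ν : V → ℤ)
  | unsat

/-- The problem of a state (empty for the final states). -/
def State.problem {V : Type*} : State V → Problem V
  | .search _ C => C
  | .conflict _ C _ => C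
  | .sat _ => ∅
  | .unsat => ∅

/-- The applied rule, with the data on which a strategy depends. -/
inductive Rule (V : Type*) where
  | decide (γ : Bound V)
  | propagate (J : Constraint V) (γ : Bound V)
  | propagateDiv (J : Constraint V) (γ : Bound V)
  | conflict (J : Constraint V)
  | conflictDiv (J : Constraint V)
  | unsatDiv
  | sat
  | forget (J : Constraint V)
  | slackIntro (x : V)
  | resolve
  | skipDecision
  | unsat
  | backjump
  | learn
  | solveDivLeft
  | solveDivRight
  | resolveCooper (R : Problem V)

/-- The transitions of CUTSAT++ for the variable order `lt` and the slack variable `xS`. -/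
inductive Step {V : Type*} (lt : V → V → Prop) (xS : V) :
    Rule V → State V → State V → Prop where
  | decideGe (M : Trail V) (C : Problem V) (x : V) (b : ℤ)
      (hu : upper M x = b) (hl : lower M x < b) :
      Step lt xS (.decide ⟨x, .ge, b, none⟩)
        (.search M C) (.search (M ++ [⟨x, .ge, b, none⟩]) C)
  | decideLe (M : Trail V) (C : Problem V) (x : V) (b : ℤ)
      (hl : lower M x = b) (hu : (b : WithTop ℤ) < upper M x) :
      Step lt xS (.decide ⟨x, .le, b, none⟩)
        (.search M C) (.search (M ++ [⟨x, .le, b, none⟩]) C)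
  | propagate (M : Trail V) (C : Problem V) (p : Poly V) (γ : Bound V)
      (hp : Constraint.le p ∈ C) (hγ : PropagatedBy M p γ) :
      Step lt xS (.propagate (.le p) γ) (.search M C) (.search (M ++ [γ]) C)
  | propagateDiv (M : Trail V) (C : Problem V) (J : Constraint V) (x : V) (kind : BoundKind)
      (c : ℤ) (I : Poly V) (hJ : J ∈ C) (hc : DvdNext C M J x kind c I)
      (hcomp : Compatible M x c kind) :
      Step lt xS (.propagateDiv J ⟨x, kind, c, some I⟩)
        (.search M C) (.search (M ++ [⟨x, kind, c, some I⟩]) C)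
  | conflict (M : Trail V) (C : Problem V) (p : Poly V)
      (hp : Constraint.le p ∈ C) (hl : 0 < lowerPoly M p) :
      Step lt xS (.conflict (.le p)) (.search M C) (.conflict M C p)
  | conflictDiv (M : Trail V) (C : Problem V) (J : Constraint V) (I : Poly V)
      (hJ : J ∈ C) (hI : ConflictDiv C M J I) :
      Step lt xS (.conflictDiv J) (.search M C) (.conflict M C I)
  | unsatDiv (M : Trail V) (C : Problem V) (h : UnsatDiv C) :
      Step lt xS .unsatDiv (.search M C) .unsat
  | sat (M : Trail V) (C : Problem V) (h : Satisfies M C) :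
      Step lt xS .sat (.search M C) (.sat (value M))
  | forget (M : Trail V) (C : Problem V) (J : Constraint V) (hJ : J ∈ C) (h : Entails (C \ {J}) J) :
      Step lt xS (.forget J) (.search M C) (.search M (C \ {J}))
  | slackIntro (M : Trail V) (C : Problem V) (x : V) (hx : x ∈ problemVars C)
      (hS : StuckState lt M C) (hstuck : StuckVar lt M C x) :
      Step lt xS (.slackIntro x) (.search M C)
        (.search M (C ∪ {.le (-X xS), .le (X x - X xS), .le (-X x - X xS)}))
  | resolve (M : Trail V) (C : Problem V) (γ : Bound V) (p : Poly V) (hγ : γ.just ≠ none) :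
      Step lt xS .resolve (.conflict (M ++ [γ]) C p) (.conflict M C (CutSat.resolve γ p))
  | skipDecision (M : Trail V) (C : Problem V) (γ : Bound V) (p : Poly V) (hγ : γ.just = none)
      (hl : 0 < lowerPoly M p) :
      Step lt xS .skipDecision (.conflict (M ++ [γ]) C p) (.conflict M C p)
  | unsat (M : Trail V) (C : Problem V) (b : ℤ) (hb : 0 < b) :
      Step lt xS .unsat (.conflict M C (const b)) .unsat
  | backjump (M M' : Trail V) (C : Problem V) (γ γ' : Bound V) (p : Poly V)
      (hγ : γ.just = none) (hγ' : PropagatedBy M p γ') :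
      Step lt xS .backjump (.conflict (M ++ [γ] ++ M') C p) (.search (M ++ [γ']) C)
  | learn (M : Trail V) (C : Problem V) (p : Poly V) (hp : Constraint.le p ∉ C) :
      Step lt xS .learn (.conflict M C p) (.conflict M (C ∪ {.le p}) p)
  | solveDivLeft (M : Trail V) (C : Problem V) (J₁ J₂ J₁' J₂' : Constraint V)
      (h : SolveDiv lt M C J₁ J₂ J₁' J₂') (hc : ¬ IsConflict M J₂') :
      Step lt xS .solveDivLeft (.search M C) (.search M (C \ {J₁, J₂} ∪ {J₁', J₂'}))
  | solveDivRight (M : Trail V) (C : Problem V) (J₁ J₂ J₁' J₂' : Constraint V)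
      (h : SolveDiv lt M C J₁ J₂ J₁' J₂') (hc : IsConflict M J₂') :
      Step lt xS .solveDivRight (.search M C)
        (.search (decPrefix (fun y => LtTop lt y J₂') M) (C \ {J₁, J₂} ∪ {J₁', J₂'}))
  | resolveCooper (M : Trail V) (C : Problem V) (x : V) (C' Rk Rc : Problem V)
      (hcore : Cooper lt xS C M x C' Rk Rc) (hsub : C' ⊆ C) (hx : ¬ Guarded C x)
      (hfix : ∀ z ∈ problemVars C, lt z x → Fixed M z)
      (hconf : ∀ J ∈ C, IsConflict M J → ¬ TopLt lt J x) :
      Step lt xS (.resolveCooper (Rk ∪ Rc)) (.search M C)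
        (.search (decPrefix (fun y => ∀ I ∈ Rc, LtTop lt y I) M) (C ∪ Rk ∪ Rc))

/-! ### Variable orders and infinite derivations -/

/-- `lt` is a strict total order of the variables in which the guarded variables of `C` are smaller
than the unguarded ones and the slack variable is the smallest unguarded variable. -/
structure OrderFor {V : Type*} (xS : V) (C : Problem V) (lt : V → V → Prop) : Prop where
  total : IsStrictTotalOrder V lt
  guarded_lt : ∀ y, Guarded C y → lt y xS ∧ ∀ x ∈ problemVars C, ¬ Guarded C x → lt y x
  slack_lt : ∀ x ∈ problemVars C, ¬ Guarded C x → x ≠ xS → lt xS x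

/-- From a state with problem `C` on, the order changes only among guarded variables
and variables that do not occur. -/
def OrderKept {V : Type*} (xS : V) (C : Problem V) (lt lt' : V → V → Prop) : Prop :=
  ∀ x ∈ insert xS (problemVars C), ∀ y ∈ insert xS (problemVars C),
    ¬ (Guarded C x ∧ Guarded C y) → (lt' x y ↔ lt x y)

/-- `S 0, S 1, …` is an infinite derivation from the initial state for `C₀`. Step `n` applies the
rule `L n` with the variable order `lt n`. -/
structure InfiniteDerivation {V : Type*} (xS : V) (C₀ : Problem V) (S : ℕ → State V)
    (L : ℕ → Rule V) (lt : ℕ → V → V → Prop) : Prop where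
  init : S 0 = .search [] C₀
  step : ∀ n, Step (lt n) xS (L n) (S n) (S (n + 1))
  order : ∀ n, OrderFor xS (S n).problem (lt n)
  order_kept : ∀ n, OrderKept xS (S n).problem (lt n) (lt (n + 1))

/-! ### Strategies -/

/-- The rule is Propagate applied to a simple constraint. -/
def Rule.IsSimplePropagate {V : Type*} : Rule V → Prop
  | .propagate J _ => IsSimple J
  | _ => False

/-- The rule adds a propagated or a decided bound in a search state. -/
def Rule.AddsBound {V : Type*} : Rule V → Prop
  | .decide _ => True
  | .propagate _ _ => True
  | .propagateDiv _ _ => True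
  | _ => False

/-- Simple constraints come first, and Forget is applied only finitely often. -/
structure Reasonable {V : Type*} (xS : V) (S : ℕ → State V) (L : ℕ → Rule V)
    (lt : ℕ → V → V → Prop) : Prop where
  /-- Propagate applied to simple constraints has the highest priority. -/
  priority : ∀ n, (∃ R S', R.IsSimplePropagate ∧ Step (lt n) xS R (S n) S') →
    (L n).IsSimplePropagate
  /-- As long as a guarded variable lacks a lower or an upper bound, bounds are only added
  by Propagate applied to simple constraints. -/
  bounded : ∀ n M C, S n = .search M C → (L n).AddsBound → ¬ (L n).IsSimplePropagate →
    ∀ x, Guarded C x → lower M x ≠ ⊥ ∧ upper M x ≠ ⊤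
  forget : {n | ∃ J, L n = .forget J}.Finite

/-- In the state `⟨M, C⟩` an eager top-level propagating strategy allows the rule. -/
def EagerTopAllows {V : Type*} (lt : V → V → Prop) (M : Trail V) (C : Problem V) : Rule V → Prop
  | .propagate J γ => ¬ Guarded C γ.var → IsTop lt J γ.var
  | .propagateDiv J γ => ¬ Guarded C γ.var → IsTop lt J γ.var ∧
      ((lower M γ.var ≠ ⊥ ∧ upper M γ.var ≠ ⊤) ∨
        ((∃ (d a k : ℤ) (p : Poly V), DvdForm J d a γ.var p ∧ lowerPoly M p = k ∧
            (Int.gcd a d : ℤ) ∣ k) ∧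
          ∀ J' ∈ C, J'.IsDvd → IsTop lt J' γ.var → J' = J))
  | .decide γ => ¬ Guarded C γ.var →
      (∀ J ∈ C, IsTop lt J γ.var → ∀ y ∈ J.vars, y ≠ γ.var → Fixed M y) ∧
      (¬ ∃ J ∈ C, IsTop lt J γ.var ∧ IsConflict (M ++ [γ]) J) ∧
      ((lower M γ.var ≠ ⊥ ∧ upper M γ.var ≠ ⊤) ∨
        ∀ J ∈ C, ∀ J' ∈ C, J.IsDvd → J'.IsDvd → IsTop lt J γ.var → IsTop lt J' γ.var → J = J')
  | _ => True

/-- Forget, Conflict and Conflict-Div are applied only to guarded constraints, and only guarded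
constraints are used to propagate guarded variables. -/
def LayeredAllows {V : Type*} (C : Problem V) : Rule V → Prop
  | .forget J => GuardedConstraint C J
  | .conflict J => GuardedConstraint C J
  | .conflictDiv J => GuardedConstraint C J
  | .propagate J γ => Guarded C γ.var → GuardedConstraint C J
  | .propagateDiv J γ => Guarded C γ.var → GuardedConstraint C J
  | _ => True

/-- The derivation follows a strictly-two-layered strategy. -/
structure StrictlyTwoLayered {V : Type*} (xS : V) (S : ℕ → State V) (L : ℕ → Rule V)
    (lt : ℕ → V → V → Prop) : Prop where
  reasonable : Reasonable xS S L lt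
  eager : ∀ n M C, S n = .search M C → EagerTopAllows (lt n) M C (L n)
  layered : ∀ n, LayeredAllows (S n).problem (L n)
  /-- Forget is not applied to divisibility constraints. -/
  forget_dvd : ∀ n J, L n = .forget J → ¬ J.IsDvd
  /-- Forget is not applied to constraints of a strong resolvent that was added before. -/
  forget_resolvent : ∀ n J, L n = .forget J → ∀ m < n, ∀ R, L m = .resolveCooper R → J ∉ R

end

end CutSat

namespace CutSat

variable {V : Type*}

/-! ### Linear polynomials -/

/-! Suppose there is an infinite run. The order relative to `xS` is kept in every step, guarded
variables lie below `xS` and the other unguarded ones above it. So an occurring variable never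
changes its status (`guarded_succ_iff`), and the unguarded variables that ever occur belong to the
fixed finite set `initUnguarded`, with a fixed order. Guarded variables get rank 0, unguarded ones
their position, and a constraint the maximal rank of its variables; "top variable" thereby becomes a
notion independent of time.

The problem settles. Slack-Intro serves a variable at most once (`slackIntro_injective`). A
conflicting core for `x` is never resolved twice (`cooperAt_injective`): at the second time
everything below `x` is fixed without conflict, so the values satisfy the old strong resolvent,
hence the core has a solution for `x`, although it is conflicting. Solve-Div diminishes the number
of constraints of its rank, and Resolve-Cooper for `x` adds only constraints of smaller rank. By
downward induction on the rank `r` (`QuietAbove.step`): if all higher ranks are quiet, Solve-Div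
stops at rank `r`, the constraints of rank `r` become constant, and only finitely many cores can be
formed from them. Forget is finite by assumption, so from some step on the problem only grows by
learned inequalities over guarded variables (`exists_late`).

The bound sequences converge. A fixed position can then change only from decided to propagated, by
Backjump, and a stable prefix is always properly extended afterwards (`exists_stable`). The limit is
an infinite sequence of bounds, and all but the early ones strictly improve their predecessors.

The limit would have to be finite. A variable with both bounds admits finitely many further
improvements. The guarded variables get both bounds (`exists_twoSided`). For an unguarded variable
one inducts on the rank (`finite_of_rank`): once the smaller variables have received their last
bounds, inequalities propagate only finitely many values, and if both bounds never exist, the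
remaining bounds come from one solvable divisibility constraint and cannot pass one of its
solutions. As only finitely many variables occur, `Run.false` follows. -/

@[simp] theorem coeff_add (p q : Poly V) (x : V) : coeff (p + q) x = coeff p x + coeff q x := by
  simp [coeff]

@[simp] theorem coeff_sub (p q : Poly V) (x : V) : coeff (p - q) x = coeff p x - coeff q x := by
  simp [coeff]

@[simp] theorem coeff_neg (p : Poly V) (x : V) : coeff (-p) x = -coeff p x := by
  simp [coeff]

@[simp] theorem coeff_smul (a : ℤ) (p : Poly V) (x : V) : coeff (a • p) x = a * coeff p x := by
  simp [coeff]

@[simp] theorem coeff_const (b : ℤ) (x : V) : coeff (const b) x = 0 := by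
  simp [coeff, const]

@[simp] theorem coeff_zero (x : V) : coeff (0 : Poly V) x = 0 := by
  simp [coeff]

@[simp] theorem coeff_X_self (x : V) : coeff (X x) x = 1 := by
  simp [coeff, X]

theorem coeff_X_of_ne {x y : V} (h : x ≠ y) : coeff (X x) y = 0 := by
  simp [coeff, X, h]

@[simp] theorem coeff_rest_self (p : Poly V) (x : V) : coeff (rest p x) x = 0 := by
  simp [rest]

theorem coeff_rest_of_ne (p : Poly V) {x y : V} (h : y ≠ x) : coeff (rest p x) y = coeff p y := by
  simp [rest, coeff_X_of_ne h.symm]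

theorem mem_support {p : Poly V} {x : V} : x ∈ p.1.support ↔ coeff p x ≠ 0 := by
  simp [coeff]

theorem mem_vars {J : Constraint V} {x : V} : x ∈ J.vars ↔ coeff J.poly x ≠ 0 := by
  simp [coeff, Constraint.vars]

theorem mem_vars_le {p : Poly V} {x : V} : x ∈ (Constraint.le p).vars ↔ coeff p x ≠ 0 :=
  mem_vars

theorem mem_vars_dvd {d : ℤ} {p : Poly V} {x : V} :
    x ∈ (Constraint.dvd d p).vars ↔ coeff p x ≠ 0 :=
  mem_vars

@[simp] theorem eval_add (ν : V → ℤ) (p q : Poly V) : eval ν (p + q) = eval ν p + eval ν q := by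
  classical
  simp only [eval, Prod.fst_add, Prod.snd_add]
  rw [Finsupp.sum_add_index' (by simp) (by intros; ring)]
  ring

@[simp] theorem eval_smul (ν : V → ℤ) (a : ℤ) (p : Poly V) : eval ν (a • p) = a * eval ν p := by
  simp only [eval, Prod.smul_fst, Prod.smul_snd]
  rw [Finsupp.sum_smul_index' (by simp), mul_add, Finsupp.mul_sum]
  simp [mul_assoc]

@[simp] theorem eval_neg (ν : V → ℤ) (p : Poly V) : eval ν (-p) = -eval ν p := by
  rw [← neg_one_smul ℤ p, eval_smul]; ring

@[simp] theorem eval_sub (ν : V → ℤ) (p q : Poly V) : eval ν (p - q) = eval ν p - eval ν q := by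
  rw [sub_eq_add_neg, eval_add, eval_neg]; ring

@[simp] theorem eval_X (ν : V → ℤ) (x : V) : eval ν (X x) = ν x := by
  simp [eval, X]

theorem eval_congr {ν μ : V → ℤ} {p : Poly V} (h : ∀ x, coeff p x ≠ 0 → ν x = μ x) :
    eval ν p = eval μ p := by
  simp only [eval]
  congr 1
  exact Finsupp.sum_congr fun x hx => by rw [h x (mem_support.1 hx)]

theorem eval_eq_rest (ν : V → ℤ) (p : Poly V) (x : V) :
    eval ν p = coeff p x * ν x + eval ν (rest p x) := by
  simp [rest]

/-! ### Bounds of a trail -/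

theorem lower_concat_of_ge (M : Trail V) {γ : Bound V} (h : γ.kind = .ge) :
    lower (M ++ [γ]) γ.var = max (lower M γ.var) γ.val := by
  simp [lower, List.filterMap_append, h, List.maximum_concat]

theorem lower_concat_of_not (M : Trail V) {γ : Bound V} {x : V}
    (h : ¬ (γ.var = x ∧ γ.kind = .ge)) : lower (M ++ [γ]) x = lower M x := by
  simp only [lower, List.filterMap_append]
  simp [h]

theorem upper_concat_of_le (M : Trail V) {γ : Bound V} (h : γ.kind = .le) :
    upper (M ++ [γ]) γ.var = min (upper M γ.var) γ.val := by
  simp [upper, List.filterMap_append, h, List.minimum_concat]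

theorem upper_concat_of_not (M : Trail V) {γ : Bound V} {x : V}
    (h : ¬ (γ.var = x ∧ γ.kind = .le)) : upper (M ++ [γ]) x = upper M x := by
  simp only [upper, List.filterMap_append]
  simp [h]

theorem lower_le_concat (M : Trail V) (γ : Bound V) (x : V) : lower M x ≤ lower (M ++ [γ]) x := by
  by_cases h : γ.var = x ∧ γ.kind = .ge
  · obtain ⟨rfl, h⟩ := h
    rw [lower_concat_of_ge M h]; exact le_max_left _ _
  · rw [lower_concat_of_not M h]

theorem upper_concat_le (M : Trail V) (γ : Bound V) (x : V) : upper (M ++ [γ]) x ≤ upper M x := by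
  by_cases h : γ.var = x ∧ γ.kind = .le
  · obtain ⟨rfl, h⟩ := h
    rw [upper_concat_of_le M h]; exact min_le_left _ _
  · rw [upper_concat_of_not M h]

theorem lower_mono {M M' : Trail V} (h : M <+: M') (x : V) : lower M x ≤ lower M' x := by
  obtain ⟨R, rfl⟩ := h
  induction R using List.reverseRecOn with
  | nil => simp
  | append_singleton R γ ih =>
    rw [← List.append_assoc]
    exact ih.trans (lower_le_concat _ _ _)

theorem upper_anti {M M' : Trail V} (h : M <+: M') (x : V) : upper M' x ≤ upper M x := by
  obtain ⟨R, rfl⟩ := h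
  induction R using List.reverseRecOn with
  | nil => simp
  | append_singleton R γ ih =>
    rw [← List.append_assoc]
    exact (upper_concat_le _ _ _).trans ih

theorem lower_eq_bot {M : Trail V} {x : V} (h : ∀ γ ∈ M, γ.var ≠ x) : lower M x = ⊥ := by
  rw [lower, List.maximum_eq_bot, List.filterMap_eq_nil_iff]
  intro γ hγ
  simp [h γ hγ]

theorem upper_eq_top {M : Trail V} {x : V} (h : ∀ γ ∈ M, γ.var ≠ x) : upper M x = ⊤ := by
  rw [upper, List.minimum_eq_top, List.filterMap_eq_nil_iff]
  intro γ hγ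
  simp [h γ hγ]

/-! ### Lower bounds of polynomials -/

theorem lowerTerm_congr {M M' : Trail V} {x : V} (hl : lower M x = lower M' x)
    (hu : upper M x = upper M' x) (a : ℤ) : lowerTerm M a x = lowerTerm M' a x := by
  simp only [lowerTerm, hl, hu]

theorem lowerPoly_congr {M M' : Trail V} {p : Poly V}
    (h : ∀ x, coeff p x ≠ 0 → lower M x = lower M' x ∧ upper M x = upper M' x) :
    lowerPoly M p = lowerPoly M' p := by
  simp only [lowerPoly]
  congr 1
  refine Finset.sum_congr rfl fun x hx => ?_
  obtain ⟨h1, h2⟩ := h x (mem_support.1 hx)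
  exact lowerTerm_congr h1 h2 _

theorem Fixed.lower_eq {M : Trail V} {x : V} (h : Fixed M x) : lower M x = value M x := by
  obtain ⟨b, hl, -⟩ := h
  simp [value, hl]

theorem Fixed.upper_eq {M : Trail V} {x : V} (h : Fixed M x) : upper M x = value M x := by
  obtain ⟨b, hl, hu⟩ := h
  simp [value, hl, hu]

theorem lowerTerm_of_fixed {M : Trail V} {x : V} (h : Fixed M x) (a : ℤ) :
    lowerTerm M a x = ((a * value M x : ℤ) : WithBot ℤ) := by
  unfold lowerTerm
  split_ifs
  · rw [h.lower_eq]; rfl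
  · rw [h.upper_eq]; rfl

theorem lowerPoly_of_fixed {M : Trail V} {p : Poly V} (h : ∀ x, coeff p x ≠ 0 → Fixed M x) :
    lowerPoly M p = eval (value M) p := by
  have : ∑ x ∈ p.1.support, lowerTerm M (p.1 x) x
      = ((∑ x ∈ p.1.support, p.1 x * value M x : ℤ) : WithBot ℤ) := by
    rw [WithBot.coe_sum]
    exact Finset.sum_congr rfl fun x hx => lowerTerm_of_fixed (h x (mem_support.1 hx)) _
  simp only [lowerPoly, this, eval, Finsupp.sum]
  norm_cast

theorem isVal_of_fixed {M : Trail V} {p : Poly V} (h : ∀ x, coeff p x ≠ 0 → Fixed M x) :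
    IsVal M p (eval (value M) p) :=
  ⟨fun x hx => h x (mem_support.1 hx), lowerPoly_of_fixed h⟩

theorem IsVal.eval_eq {M : Trail V} {p : Poly V} {k : ℤ} (h : IsVal M p k) :
    eval (value M) p = k := by
  have := lowerPoly_of_fixed (M := M) (p := p) fun x hx => h.1 x (mem_support.2 hx)
  rw [h.2] at this
  exact_mod_cast this.symm

/-- A constraint without `x` whose variables are all fixed and that is no conflict is satisfied. -/
theorem sat_of_not_isConflict {M : Trail V} {J : Constraint V} {x : V} (hx : x ∉ J.vars)
    (hf : ∀ y ∈ J.vars, Fixed M y) (hc : ¬ IsConflict M J) : J.Sat (value M) := by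
  cases J with
  | le p =>
    have hf' : ∀ y, coeff p y ≠ 0 → Fixed M y := fun y hy => hf y (mem_vars_le.2 hy)
    simp only [IsConflict, lowerPoly_of_fixed hf', not_lt] at hc
    exact_mod_cast hc
  | dvd d p =>
    have hx0 : coeff p x = 0 := by simpa [mem_vars_dvd] using hx
    have hf' : ∀ y, coeff p y ≠ 0 → Fixed M y := fun y hy => hf y (mem_vars_dvd.2 hy)
    by_contra hs
    -- `IsConflict` wants a distinguished variable; `x` has coefficient `0`, so the test is the same
    -- for every `b`.
    refine hc ⟨x, eval (value M) p, ?_, fun b _ _ => ?_⟩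
    · have : rest p x = p := by simp [rest, hx0]
      rw [this]
      exact isVal_of_fixed hf'
    · rw [hx0]
      simpa [Constraint.Sat] using hs

/-! ### Polynomials over a set of variables -/

/-- All variables of `p` have property `G`. -/
def VarsIn (G : V → Prop) (p : Poly V) : Prop := ∀ y, coeff p y ≠ 0 → G y

theorem VarsIn.add {G : V → Prop} {p q : Poly V} (hp : VarsIn G p) (hq : VarsIn G q) :
    VarsIn G (p + q) := by
  intro y hy
  by_contra h
  exact hy (by rw [coeff_add, not_not.1 (mt (hp y) h), not_not.1 (mt (hq y) h), add_zero])

theorem VarsIn.smul {G : V → Prop} {p : Poly V} (a : ℤ) (hp : VarsIn G p) : VarsIn G (a • p) := by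
  intro y hy
  refine hp y fun h => hy (by rw [coeff_smul, h, mul_zero])

theorem VarsIn.neg {G : V → Prop} {p : Poly V} (hp : VarsIn G p) : VarsIn G (-p) := by
  rw [← neg_one_smul ℤ p]
  exact hp.smul _

theorem VarsIn.sub {G : V → Prop} {p q : Poly V} (hp : VarsIn G p) (hq : VarsIn G q) :
    VarsIn G (p - q) := by
  rw [sub_eq_add_neg]
  exact hp.add hq.neg

theorem varsIn_const (G : V → Prop) (b : ℤ) : VarsIn G (const b) := by
  intro y hy
  simp at hy

theorem varsIn_zero (G : V → Prop) : VarsIn G (0 : Poly V) := by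
  intro y hy
  simp at hy

theorem varsIn_X {G : V → Prop} {x : V} (h : G x) : VarsIn G (X x) := by
  intro y hy
  by_cases hxy : x = y
  · exact hxy ▸ h
  · exact absurd (coeff_X_of_ne hxy) hy

theorem VarsIn.rest {G : V → Prop} {p : Poly V} (hp : VarsIn G p) (x : V) :
    VarsIn G (rest p x) := by
  intro y hy
  by_cases hxy : y = x
  · subst hxy; simp at hy
  · rw [coeff_rest_of_ne p hxy] at hy
    exact hp y hy

theorem VarsIn.smul_X {G : V → Prop} {x : V} {a : ℤ} (h : a ≠ 0 → G x) : VarsIn G (a • X x) := by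
  by_cases ha : a = 0
  · subst ha; simpa using varsIn_zero G
  · exact (varsIn_X (h ha)).smul a

theorem VarsIn.smul_of_ne {G : V → Prop} {p : Poly V} {a : ℤ} (h : a ≠ 0 → VarsIn G p) :
    VarsIn G (a • p) := by
  by_cases ha : a = 0
  · subst ha; simpa using varsIn_zero G
  · exact (h ha).smul a

/-- The justifications in `M` of bounds for variables with property `G` have only such variables. -/
def JustClosed (G : V → Prop) (M : Trail V) : Prop :=
  ∀ γ ∈ M, G γ.var → ∀ I ∈ γ.just, VarsIn G I

theorem VarsIn.resolve {G : V → Prop} {M : Trail V} (hM : JustClosed G M) {γ : Bound V}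
    (hγ : γ ∈ M) {p : Poly V} (hp : VarsIn G p) : VarsIn G (resolve γ p) := by
  unfold CutSat.resolve
  split
  · exact hp
  · rename_i I hI
    split_ifs with h
    · have hc : coeff p γ.var ≠ 0 := by
        intro h0; simp [h0] at h
      exact ((hM γ hγ (hp _ hc) I hI).smul _).add (hp.smul _)
    · exact hp

theorem JustClosed.left {G : V → Prop} {M M' : Trail V} (h : JustClosed G (M ++ M')) :
    JustClosed G M :=
  fun γ hγ => h γ (List.mem_append_left _ hγ)

/-- The rules bring in only justifications of bounds for variables that occur in the current
polynomial, and `JustClosed` keeps these inside `G`. The distinguished variable is split off because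
in `DivDerive` it is the new `z`, which need not have property `G`. -/
theorem TightDeriv.exists_varsIn {G : V → Prop} {x : V} {a σ : ℤ} {N : V → Prop} {M : Trail V}
    {s r I : Poly V} (h : TightDeriv x a σ N M s r I) (ha : a ≠ 0) (hM : JustClosed G M)
    (hs : VarsIn G s) (hr : VarsIn G r) : ∃ s' : Poly V, VarsIn G s' ∧ I = σ • X x + s' := by
  induction h with
  | round M s b => exact ⟨_, hs.add (varsIn_const G _), add_assoc _ _ _⟩
  | consume M s r y k I hy hk h ih =>
    have hk0 : k ≠ 0 → coeff r y ≠ 0 := fun h0 => by rw [hk]; exact mul_ne_zero ha h0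
    exact ih hM (hs.add (VarsIn.smul_X fun h0 => hr y (hk0 h0))) (hr.rest y)
  | resolveImplied M γ s p I hγ h ih =>
    exact ih hM.left hs (hr.resolve hM (by simp))
  | decideLower M y b k s r q I hI hk h ih =>
    -- If `y` does not occur in `r`, nothing is known about `q`; but then `k = 0` and `q` gets the
    -- factor `0`.
    have hq : coeff r y ≠ 0 → VarsIn G q := fun hy => by
      have := (hM _ (List.mem_append_left _ hI) (hr y hy) _ rfl).sub (varsIn_X (hr y hy))
      simpa using this
    have h0 : coeff r y = 0 → k = 0 := fun hy => by simp [hk, hy]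
    refine ih hM.left (hs.add (VarsIn.smul_X fun h1 => hr y (mt h0 h1)))
      ((hr.rest y).add (VarsIn.smul_of_ne fun h1 => hq fun hy => h1 ?_))
    simp [hy, h0 hy]
  | decideLowerNeg M y b s r q I hI hc h ih =>
    have hq : VarsIn G q := by
      have := (varsIn_X (hr y hc.ne)).sub
        (hM _ (List.mem_append_left _ hI) (hr y hc.ne) _ rfl)
      simpa using this
    exact ih hM.left hs ((hr.rest y).add (hq.smul _))
  | decideUpper M y b k s r q I hI hk h ih =>
    have hq : coeff r y ≠ 0 → VarsIn G q := fun hy => by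
      have := (hM _ (List.mem_append_left _ hI) (hr y hy) _ rfl).add (varsIn_X (hr y hy))
      simpa using this
    have h0 : coeff r y = 0 → k = 0 := fun hy => by simp [hk, hy]
    refine ih hM.left (hs.add (VarsIn.smul_X fun h1 => hr y (mt h0 h1)))
      ((hr.rest y).add (VarsIn.smul_of_ne fun h1 => hq fun hy => h1 ?_))
    simp [hy, h0 hy]
  | decideUpperPos M y b s r q I hI hc h ih =>
    have hq : VarsIn G q := by
      have := (hM _ (List.mem_append_left _ hI) (hr y hc.ne') _ rfl).add (varsIn_X (hr y hc.ne'))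
      simpa using this
    exact ih hM.left hs ((hr.rest y).add (hq.smul _))

theorem Tight.varsIn {G : V → Prop} {M : Trail V} {p I : Poly V} {x : V} (h : Tight M p x I)
    (hM : JustClosed G M) (hp : VarsIn G p) : VarsIn G I := by
  obtain ⟨s, hs, rfl⟩ := h.2.exists_varsIn (abs_ne_zero.2 h.1) hM (varsIn_zero G) (hp.rest x)
  exact ((varsIn_X (hp x h.1)).smul _).add hs

theorem DivDerive.varsIn {G : V → Prop} {C : Problem V} {M : Trail V} {d a : ℤ} {x : V}
    {p I : Poly V} {kind : BoundKind} (h : DivDerive C M d a x p I kind) (hd : d ≠ 0)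
    (hM : JustClosed G M) (hx : G x) (hp : VarsIn G p) : VarsIn G I := by
  have hax : VarsIn G (a • X x) := (varsIn_X hx).smul a
  cases kind with
  | ge =>
    obtain ⟨z, r, -, -, ht, hI⟩ := h
    obtain ⟨s, hs, hr⟩ := ht.exists_varsIn hd hM (varsIn_zero G) (hax.add hp)
    have hrs : r = s := by simpa using hr
    exact hI.varsIn hM ((hax.neg.add ((hrs ▸ hs).smul d)).sub hp)
  | le =>
    obtain ⟨z, r, -, -, ht, hI⟩ := h
    obtain ⟨s, hs, hr⟩ := ht.exists_varsIn hd hM (varsIn_zero G) (hax.neg.sub hp)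
    have hrs : r = s := by simpa using hr
    exact hI.varsIn hM ((hax.add ((hrs ▸ hs).smul d)).add hp)

/-! ### Divisibility constraints -/

theorem DvdForm.sat_iff {J : Constraint V} {d a : ℤ} {x : V} {p : Poly V} (h : DvdForm J d a x p)
    (ν : V → ℤ) : J.Sat ν ↔ d ∣ a * ν x + eval ν p := by
  obtain ⟨-, -, rfl | rfl⟩ := h <;> simp only [Constraint.Sat, eval_neg, dvd_neg] <;> simp

theorem DvdForm.mem_vars_iff {J : Constraint V} {d a : ℤ} {x : V} {p : Poly V}
    (h : DvdForm J d a x p) (y : V) : y ∈ J.vars ↔ y = x ∨ coeff p y ≠ 0 := by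
  obtain ⟨ha, hp, h⟩ := h
  have : y ∈ J.vars ↔ coeff (a • X x + p) y ≠ 0 := by
    rcases h with rfl | rfl <;> simp [mem_vars_dvd, -neg_add_rev]
  rw [this]
  by_cases hy : y = x
  · subst hy; simp [hp, ha.ne']
  · simp [hy, coeff_X_of_ne (Ne.symm hy)]

theorem DvdForm.varsIn {G : V → Prop} {J : Constraint V} {d a : ℤ} {x : V} {p : Poly V}
    (h : DvdForm J d a x p) (hG : ∀ y ∈ J.vars, G y) : G x ∧ VarsIn G p :=
  ⟨hG x ((h.mem_vars_iff x).2 (Or.inl rfl)), fun y hy => hG y ((h.mem_vars_iff y).2 (Or.inr hy))⟩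

theorem DvdForm.isDvd {J : Constraint V} {d a : ℤ} {x : V} {p : Poly V} (h : DvdForm J d a x p) :
    J.IsDvd := by
  obtain ⟨-, -, rfl | rfl⟩ := h <;> trivial

/-- The sign left open by `DvdForm` is determined by `a > 0`. This identifies the data that a rule
and the strategy extract separately from one constraint. -/
theorem DvdForm.unique {J : Constraint V} {d a d' a' : ℤ} {x : V} {p p' : Poly V}
    (h : DvdForm J d a x p) (h' : DvdForm J d' a' x p') : d = d' ∧ a = a' ∧ p = p' := by
  obtain ⟨ha, hp, h⟩ := h
  obtain ⟨ha', hp', h'⟩ := h'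
  have key : ∀ q q' : Poly V, q = q' → coeff q x = coeff q' x := fun _ _ h => h ▸ rfl
  rcases h with rfl | rfl <;> rcases h' with h' | h' <;> injection h' with h1 h2 <;>
    have h3 := key _ _ h2 <;> simp [hp, hp'] at h3
  · subst h3; exact ⟨h1, rfl, add_left_cancel h2⟩
  · omega
  · omega
  · subst h3; exact ⟨h1, rfl, add_left_cancel (neg_injective h2)⟩

/-- Positivity of the moduli. -/
def PosModulus : Constraint V → Prop
  | .le _ => True
  | .dvd d _ => 0 < d

theorem DvdForm.pos {J : Constraint V} {d a : ℤ} {x : V} {p : Poly V} (h : DvdForm J d a x p)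
    (hJ : PosModulus J) : 0 < d := by
  obtain ⟨-, -, rfl | rfl⟩ := h <;> exact hJ

/-! ### Solving divisibility constraints -/

/-- By `hc`, `d u = a₁ (c₁ d₂ u + c₂ d₁ v) + c₂ d₁ (a₂ u - a₁ v)` and `d v = a₂ (c₁ d₂ u + c₂ d₁ v)
- c₁ d₂ (a₂ u - a₁ v)`. The right-hand sides are multiples of `d d₁` and `d d₂`, and `d` cancels. -/
theorem dvd_of_solve {a₁ a₂ d₁ d₂ c₁ c₂ d u v : ℤ} (hd : d ≠ 0) (h₁ : d ∣ a₁ * d₂)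
    (h₂ : d ∣ a₂ * d₁) (hc : c₁ * a₁ * d₂ + c₂ * a₂ * d₁ = d)
    (hA : d₁ * d₂ ∣ c₁ * d₂ * u + c₂ * d₁ * v) (hB : d ∣ a₂ * u - a₁ * v) : d₁ ∣ u ∧ d₂ ∣ v := by
  obtain ⟨A, hA⟩ := hA
  obtain ⟨B, hB⟩ := hB
  obtain ⟨e₁, he₁⟩ := h₁
  obtain ⟨e₂, he₂⟩ := h₂
  constructor
  · refine ⟨e₁ * A + c₂ * B, mul_left_cancel₀ hd ?_⟩
    linear_combination a₁ * hA - c₂ * d₁ * hB * (-1) + d₁ * A * he₁ - u * hc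
  · refine ⟨e₂ * A - c₁ * B, mul_left_cancel₀ hd ?_⟩
    linear_combination a₂ * hA - c₁ * d₂ * hB + d₂ * A * he₂ - v * hc

theorem DvdForm.gcd_pos {x : V} {J₁ J₂ : Constraint V} {d₁ a₁ d₂ a₂ : ℤ} {p₁ p₂ : Poly V}
    (h₁ : DvdForm J₁ d₁ a₁ x p₁) (hJ₂ : PosModulus J₂)
    (h₂ : DvdForm J₂ d₂ a₂ x p₂) : 0 < (Int.gcd (a₁ * d₂) (a₂ * d₁) : ℤ) := by
  have : 0 < a₁ * d₂ := mul_pos h₁.1 (h₂.pos hJ₂)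
  exact_mod_cast Int.gcd_pos_of_ne_zero_left _ this.ne'

theorem DivSolve.sat {x : V} {J₁ J₂ J₁' J₂' : Constraint V} (h : DivSolve x J₁ J₂ J₁' J₂')
    (hJ₂ : PosModulus J₂) {ν : V → ℤ} (h₁ : J₁'.Sat ν) (h₂ : J₂'.Sat ν) :
    J₁.Sat ν ∧ J₂.Sat ν := by
  obtain ⟨d₁, a₁, d₂, a₂, c₁, c₂, d, p₁, p₂, hf₁, hf₂, hd, hc, rfl, rfl⟩ := h
  have hpos : 0 < d := hd ▸ hf₁.gcd_pos hJ₂ hf₂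
  rw [hf₁.sat_iff, hf₂.sat_iff]
  simp only [Constraint.Sat, eval_add, eval_smul, eval_X, eval_neg] at h₁ h₂
  refine dvd_of_solve hpos.ne' (hd ▸ Int.gcd_dvd_left ..) (hd ▸ Int.gcd_dvd_right ..) hc ?_ ?_
  · convert h₁ using 1
    rw [← hc]; ring
  · convert h₂ using 1
    ring

theorem DivSolve.posModulus {x : V} {J₁ J₂ J₁' J₂' : Constraint V} (h : DivSolve x J₁ J₂ J₁' J₂')
    (hJ₁ : PosModulus J₁) (hJ₂ : PosModulus J₂) : PosModulus J₁' ∧ PosModulus J₂' := by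
  obtain ⟨d₁, a₁, d₂, a₂, c₁, c₂, d, p₁, p₂, hf₁, hf₂, hd, hc, rfl, rfl⟩ := h
  exact ⟨mul_pos (hf₁.pos hJ₁) (hf₂.pos hJ₂), hd ▸ hf₁.gcd_pos hJ₂ hf₂⟩

theorem DivSolve.isDvd {x : V} {J₁ J₂ J₁' J₂' : Constraint V} (h : DivSolve x J₁ J₂ J₁' J₂') :
    J₁.IsDvd ∧ J₂.IsDvd ∧ J₁'.IsDvd ∧ J₂'.IsDvd := by
  obtain ⟨d₁, a₁, d₂, a₂, c₁, c₂, d, p₁, p₂, hf₁, hf₂, hd, hc, rfl, rfl⟩ := h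
  exact ⟨hf₁.isDvd, hf₂.isDvd, trivial, trivial⟩

/-- Solving keeps the variables. -/
theorem DivSolve.mem_vars {x : V} {J₁ J₂ J₁' J₂' : Constraint V} (h : DivSolve x J₁ J₂ J₁' J₂')
    (hJ₂ : PosModulus J₂) {y : V} (hy : y ∈ J₁.vars ∨ y ∈ J₂.vars) :
    y ∈ J₁'.vars ∨ y ∈ J₂'.vars := by
  obtain ⟨d₁, a₁, d₂, a₂, c₁, c₂, d, p₁, p₂, hf₁, hf₂, hd, hc, rfl, rfl⟩ := h
  have hpos : 0 < d := hd ▸ hf₁.gcd_pos hJ₂ hf₂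
  simp only [mem_vars_dvd, coeff_add, coeff_smul, coeff_neg]
  by_cases hyx : y = x
  · subst hyx
    left
    simp [hf₁.2.1, hf₂.2.1, hpos.ne']
  · rw [hf₁.mem_vars_iff, hf₂.mem_vars_iff] at hy
    by_contra! h
    obtain ⟨hA, hB⟩ := h
    rw [coeff_X_of_ne (Ne.symm hyx)] at hA
    -- The two combinations of `dvd_of_solve`, now read for the coefficients of `y`.
    have hu : d * coeff p₁ y = 0 := by
      linear_combination a₁ * hA + c₂ * d₁ * hB - coeff p₁ y * hc
    have hv : d * coeff p₂ y = 0 := by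
      linear_combination a₂ * hA - c₁ * d₂ * hB - coeff p₂ y * hc
    have hu' := (mul_eq_zero.1 hu).resolve_left hpos.ne'
    have hv' := (mul_eq_zero.1 hv).resolve_left hpos.ne'
    simp [hyx, hu', hv'] at hy

theorem DivSolve.vars_left {x : V} {J₁ J₂ J₁' J₂' : Constraint V} (h : DivSolve x J₁ J₂ J₁' J₂')
    {y : V} (hy : y ∈ J₁'.vars) : y ∈ J₁.vars ∨ y ∈ J₂.vars := by
  obtain ⟨d₁, a₁, d₂, a₂, c₁, c₂, d, p₁, p₂, hf₁, hf₂, hd, hc, rfl, rfl⟩ := h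
  rw [hf₁.mem_vars_iff, hf₂.mem_vars_iff]
  by_contra! h
  obtain ⟨⟨hyx, h1⟩, -, h2⟩ := h
  simp [mem_vars_dvd, h1, h2, coeff_X_of_ne (Ne.symm hyx)] at hy

theorem DivSolve.vars_right {x : V} {J₁ J₂ J₁' J₂' : Constraint V} (h : DivSolve x J₁ J₂ J₁' J₂')
    {y : V} (hy : y ∈ J₂'.vars) : (y ∈ J₁.vars ∨ y ∈ J₂.vars) ∧ y ≠ x := by
  obtain ⟨d₁, a₁, d₂, a₂, c₁, c₂, d, p₁, p₂, hf₁, hf₂, hd, hc, rfl, rfl⟩ := h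
  rw [hf₁.mem_vars_iff, hf₂.mem_vars_iff]
  constructor
  · by_contra! h
    obtain ⟨⟨hyx, h1⟩, -, h2⟩ := h
    simp [mem_vars_dvd, h1, h2] at hy
  · rintro rfl
    simp [mem_vars_dvd, hf₁.2.1, hf₂.2.1] at hy

/-! ### Propagated bounds -/

theorem le_neg_ceil_iff {c l e : ℤ} (hc : 0 < c) :
    e ≤ -⌈(l : ℚ) / (c : ℚ)⌉ ↔ c * e + l ≤ 0 := by
  have hc' : (0 : ℚ) < c := by exact_mod_cast hc
  rw [le_neg, Int.ceil_le, div_le_iff₀ hc']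
  constructor <;> intro h
  · have : l ≤ -e * c := by exact_mod_cast h
    linarith
  · have : l ≤ -e * c := by linarith
    exact_mod_cast this

theorem neg_floor_le_iff {c l e : ℤ} (hc : c < 0) :
    -⌊(l : ℚ) / (c : ℚ)⌋ ≤ e ↔ c * e + l ≤ 0 := by
  have hc' : (c : ℚ) < 0 := by exact_mod_cast hc
  rw [neg_le, Int.le_floor, le_div_iff_of_neg hc']
  constructor <;> intro h
  · have : l ≤ -e * c := by exact_mod_cast h
    linarith
  · have : l ≤ -e * c := by linarith
    exact_mod_cast this

theorem IsBound.unique {M : Trail V} {p : Poly V} {x : V} {b b' : ℤ} (h : IsBound M p x b)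
    (h' : IsBound M p x b') : b = b' := by
  obtain ⟨l, hl, h⟩ := h
  obtain ⟨l', hl', h'⟩ := h'
  have : l = l' := by rw [hl] at hl'; exact_mod_cast hl'
  subst this
  rcases h with ⟨h1, rfl⟩ | ⟨h1, rfl⟩ <;> rcases h' with ⟨h2, rfl⟩ | ⟨h2, rfl⟩ <;>
    first | rfl | omega

theorem IsBound.congr {M M' : Trail V} {p : Poly V} {x : V} {b : ℤ} (h : IsBound M p x b)
    (hM : ∀ y, coeff p y ≠ 0 → y ≠ x → lower M y = lower M' y ∧ upper M y = upper M' y) :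
    IsBound M' p x b := by
  obtain ⟨l, hl, h⟩ := h
  refine ⟨l, hl ▸ (lowerPoly_congr fun y hy => ?_).symm, h⟩
  by_cases hyx : y = x
  · subst hyx; simp at hy
  · rw [coeff_rest_of_ne p hyx] at hy
    exact hM y hy hyx

/-- If all variables but `x` are fixed, then the propagated bound is equivalent to the
inequality. -/
theorem IsBound.eval_nonpos_iff {M : Trail V} {p : Poly V} {x : V} {b : ℤ} (h : IsBound M p x b)
    {ν : V → ℤ} (hν : ∀ y, coeff p y ≠ 0 → y ≠ x → Fixed M y ∧ ν y = value M y) :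
    (coeff p x < 0 → (eval ν p ≤ 0 ↔ b ≤ ν x)) ∧ (0 < coeff p x → (eval ν p ≤ 0 ↔ ν x ≤ b)) := by
  have hr : ∀ y, coeff (rest p x) y ≠ 0 → Fixed M y ∧ ν y = value M y := by
    intro y hy
    by_cases hyx : y = x
    · subst hyx; simp at hy
    · rw [coeff_rest_of_ne p hyx] at hy
      exact hν y hy hyx
  obtain ⟨l, hl, h⟩ := h
  have hl' : eval ν (rest p x) = l := by
    rw [eval_congr fun y hy => (hr y hy).2]
    rw [lowerPoly_of_fixed fun y hy => (hr y hy).1] at hl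
    exact_mod_cast hl
  rw [eval_eq_rest ν p x, hl']
  rcases h with ⟨hc, rfl⟩ | ⟨hc, rfl⟩
  · exact ⟨fun h => absurd h (by omega), fun _ => (le_neg_ceil_iff hc).symm⟩
  · exact ⟨fun _ => (neg_floor_le_iff hc).symm, fun h => absurd h (by omega)⟩

/-! ### Conflicting cores and strong resolvents -/

section Cooper

variable {lt : V → V → Prop} {xS : V} {C : Problem V} {M : Trail V} {x : V} {C' Rk Rc : Problem V}

theorem Cooper.coreTop (h : Cooper lt xS C M x C' Rk Rc) : CoreTop lt M x C' := by
  cases h <;> assumption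

theorem Cooper.nonempty (h : Cooper lt xS C M x C' Rk Rc) : C'.Nonempty := by
  cases h <;> simp

theorem Cooper.finite (h : Cooper lt xS C M x C' Rk Rc) : (Rk ∪ Rc).Finite := by
  cases h <;> exact Set.toFinite _

/-- A conflicting core excludes all values of `x`. -/
theorem Cooper.not_sat (h : Cooper lt xS C M x C' Rk Rc) {ν : V → ℤ}
    (hν : ∀ J ∈ C', ∀ y ∈ J.vars, y ≠ x → ν y = value M y) : ¬ ∀ J ∈ C', J.Sat ν := by
  intro hsat
  have hle : ∀ p b, Constraint.le p ∈ C' → IsBound M p x b → eval ν p ≤ 0 ∧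
      (coeff p x < 0 → b ≤ ν x) ∧ (0 < coeff p x → ν x ≤ b) := fun p b hp hb => by
    have hs : eval ν p ≤ 0 := hsat _ hp
    have := hb.eval_nonpos_iff (ν := ν) fun y hy hyx =>
      ⟨(h.coreTop _ hp).2 y (mem_vars_le.2 hy) hyx, hν _ hp y (mem_vars_le.2 hy) hyx⟩
    exact ⟨hs, fun h1 => (this.1 h1).1 hs, fun h1 => (this.2 h1).1 hs⟩
  have hdvd : ∀ J d c s v, J ∈ C' → DvdForm J d c x s → IsVal M s v → d ∣ c * ν x + v :=
      fun J d c s v hJ hf hs => by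
    have := (hf.sat_iff ν).1 (hsat J hJ)
    rwa [eval_congr (μ := value M), hs.eval_eq] at this
    intro y hy
    refine hν J hJ y ((hf.mem_vars_iff y).2 (Or.inr hy)) ?_
    rintro rfl
    exact hy hf.2.1
  cases h with
  | interval a b bl bu p q k ha hb hp hq htop hbl hbu hlt hk =>
    have h1 := (hle _ _ (by simp) hbl).2.1 (by simp [hp, ha])
    have h2 := (hle _ _ (by simp) hbu).2.2 (by simp [hq, hb])
    omega
  | divisibility a b c d m bl bu v p q s J k ha hb hp hq hJ htop hbl hbu hle' hs hno hm hk =>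
    have h1 := (hle _ _ (by simp) hbl).2.1 (by simp [hp, ha])
    have h2 := (hle _ _ (by simp) hbu).2.2 (by simp [hq, hb])
    exact hno _ h1 h2 (hdvd J d c s v (by simp) hJ hs)
  | diophantine c d v s J hJ htop hs hno =>
    exact hno _ (hdvd J d c s v (by simp) hJ hs)

theorem eval_update_of_coeff [DecidableEq V] {ν : V → ℤ} {p : Poly V} {x : V} (e : ℤ)
    (h : coeff p x = 0) : eval (Function.update ν x e) p = eval ν p := by
  refine eval_congr fun y hy => Function.update_of_ne ?_ _ _
  rintro rfl
  exact hy h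

theorem exists_dvd_mul_add {c d s : ℤ} (h : (Int.gcd c d : ℤ) ∣ s) : ∃ e, d ∣ c * e + s := by
  obtain ⟨t, rfl⟩ := h
  refine ⟨-(Int.gcdA c d * t), Int.gcdB c d * t, ?_⟩
  rw [Int.gcd_eq_gcd_ab]
  ring

/-- A solution of the strong resolvent extends to a solution of the core. -/
theorem Cooper.exists_sat [DecidableEq V] (h : Cooper lt xS C M x C' Rk Rc) {ν : V → ℤ}
    (hν : ∀ I ∈ Rk ∪ Rc, I.Sat ν) : ∃ e, ∀ J ∈ C', J.Sat (Function.update ν x e) := by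
  cases h with
  | interval a b bl bu p q k ha hb hp hq htop hbl hbu hlt hk =>
    simp only [Set.mem_union, Set.mem_insert_iff, Set.mem_singleton_iff, or_assoc, forall_eq_or_imp,
      forall_eq, Constraint.Sat, eval_add, eval_sub, eval_smul, eval_neg, eval_X] at hν
    -- The quotient of `k + p` by `a` is the value for `x`: `a e = p + k ≥ p` is the lower bound,
    -- and `a (b e - q) = b p - a q + b k ≤ 0` gives the upper one.
    obtain ⟨hk0, -, h1, e, he⟩ := hν
    refine ⟨e, ?_⟩
    simp only [Set.mem_insert_iff, Set.mem_singleton_iff, forall_eq_or_imp,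
      forall_eq, Constraint.Sat, eval_add, eval_sub, eval_smul, eval_neg, eval_X,
      Function.update_self, eval_update_of_coeff e hp, eval_update_of_coeff e hq]
    constructor
    · linarith
    · have : a * (b * e - eval ν q) ≤ 0 := by linear_combination h1 - b * he
      exact nonpos_of_mul_nonpos_right this ha
  | divisibility a b c d m bl bu v p q s J k ha hb hp hq hJ htop hbl hbu hle' hs hno hm hk =>
    have hs0 := hJ.2.1
    simp only [Set.mem_union, Set.mem_insert_iff, Set.mem_singleton_iff, or_assoc, forall_eq_or_imp,
      forall_eq, Constraint.Sat, eval_add, eval_sub, eval_smul, eval_neg, eval_X] at hν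
    obtain ⟨hk0, -, h1, ⟨e, he⟩, h2⟩ := hν
    refine ⟨e, ?_⟩
    rw [Set.forall_mem_insert, Set.forall_mem_insert]
    simp only [Set.mem_singleton_iff, forall_eq, hJ.sat_iff]
    simp only [Constraint.Sat, eval_add, eval_sub, eval_smul, eval_neg, eval_X,
      Function.update_self, eval_update_of_coeff e hp, eval_update_of_coeff e hq,
      eval_update_of_coeff e hs0]
    refine ⟨by linarith, ?_, ?_⟩
    · have : a * (b * e - eval ν q) ≤ 0 := by linear_combination h1 - b * he
      exact nonpos_of_mul_nonpos_right this ha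
    -- Scaled by `a`, and with `a e = k + p` inserted, this is the third constraint of the
    -- resolvent.
    · rw [← mul_dvd_mul_iff_left ha.ne']
      have : a * (c * e + eval ν s) = c * eval ν p + a * eval ν s + c * ν k := by
        linear_combination -c * he
      rwa [this]
  | diophantine c d v s J hJ htop hs hno =>
    have hs0 := hJ.2.1
    simp only [Set.empty_union, Set.mem_singleton_iff, forall_eq, Constraint.Sat] at hν
    obtain ⟨e, he⟩ := exists_dvd_mul_add hν
    refine ⟨e, ?_⟩
    simpa [hJ.sat_iff, eval_update_of_coeff e hs0] using he

theorem guarded_of_mem {C : Problem V} {k : V} {m : ℤ} (h1 : Constraint.le (-X k) ∈ C)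
    (h2 : Constraint.le (X k - const m) ∈ C) : Guarded C k :=
  ⟨⟨m, h2⟩, 0, by have : (const 0 : Poly V) = 0 := rfl
                  rwa [this, add_zero]⟩

/-- A variable of a strong resolvent is new and guarded, or it is a smaller variable of the
core. -/
theorem Cooper.mem_vars (h : Cooper lt xS C M x C' Rk Rc) {I : Constraint V} (hI : I ∈ Rk ∪ Rc)
    {y : V} (hy : y ∈ I.vars) :
    Guarded (C ∪ Rk ∪ Rc) y ∨ y ≠ x ∧ ∃ J ∈ C', y ∈ J.vars := by
  cases h with
  | interval a b bl bu p q k ha hb hp hq htop hbl hbu hlt hk =>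
    by_cases hyk : y = k
    · subst hyk
      left
      refine guarded_of_mem (m := a - 1) (by simp) ?_
      have : X y - const (a - 1) = X y - const a + const 1 := by
        ext <;> simp [const, X]; ring
      rw [this]; simp
    · right
      have hyk' := coeff_X_of_ne (Ne.symm hyk)
      simp only [Set.mem_union, Set.mem_insert_iff, Set.mem_singleton_iff] at hI
      have key : coeff p y ≠ 0 ∨ coeff q y ≠ 0 := by
        by_contra! h0
        rcases hI with (rfl | rfl) | rfl | rfl <;> simp [mem_vars, Constraint.poly, hyk', h0] at hy
      have hyx : y ≠ x := by
        rintro rfl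
        exact key.elim (· hp) (· hq)
      have hyx' := coeff_X_of_ne hyx.symm
      refine ⟨hyx, ?_⟩
      rcases key with h0 | h0
      · exact ⟨_, Set.mem_insert _ _, by simp [mem_vars_le, hyx', h0]⟩
      · exact ⟨_, Set.mem_insert_of_mem _ rfl, by simp [mem_vars_le, hyx', h0]⟩
  | divisibility a b c d m bl bu v p q s J k ha hb hp hq hJ htop hbl hbu hle' hs hno hm hk =>
    by_cases hyk : y = k
    · subst hyk
      left
      exact guarded_of_mem (m := m) (by simp) (by simp)
    · right
      have hyk' := coeff_X_of_ne (Ne.symm hyk)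
      simp only [Set.mem_union, Set.mem_insert_iff, Set.mem_singleton_iff] at hI
      have key : coeff p y ≠ 0 ∨ coeff q y ≠ 0 ∨ coeff s y ≠ 0 := by
        by_contra! h0
        rcases hI with (rfl | rfl) | rfl | rfl | rfl <;>
          simp [mem_vars, Constraint.poly, hyk', h0] at hy
      have hyx : y ≠ x := by
        rintro rfl
        exact key.elim (· hp) (·.elim (· hq) (· hJ.2.1))
      have hyx' := coeff_X_of_ne hyx.symm
      refine ⟨hyx, ?_⟩
      rcases key with h0 | h0 | h0
      · exact ⟨_, Set.mem_insert _ _, by simp [mem_vars_le, hyx', h0]⟩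
      · exact ⟨_, Set.mem_insert_of_mem _ (Set.mem_insert _ _), by simp [mem_vars_le, hyx', h0]⟩
      · exact ⟨J, by simp, (hJ.mem_vars_iff y).2 (Or.inr h0)⟩
  | diophantine c d v s J hJ htop hs hno =>
    right
    simp only [Set.empty_union, Set.mem_singleton_iff] at hI
    subst hI
    rw [mem_vars_dvd] at hy
    refine ⟨?_, J, rfl, (hJ.mem_vars_iff y).2 (Or.inr hy)⟩
    rintro rfl
    exact hy hJ.2.1

theorem Cooper.posModulus (h : Cooper lt xS C M x C' Rk Rc) (hC' : ∀ J ∈ C', PosModulus J)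
    {I : Constraint V} (hI : I ∈ Rk ∪ Rc) : PosModulus I := by
  cases h with
  | interval a b bl bu p q k ha hb hp hq htop hbl hbu hlt hk =>
    simp only [Set.mem_union, Set.mem_insert_iff, Set.mem_singleton_iff] at hI
    rcases hI with (rfl | rfl) | rfl | rfl <;> trivial
  | divisibility a b c d m bl bu v p q s J k ha hb hp hq hJ htop hbl hbu hle' hs hno hm hk =>
    have hd := hJ.pos (hC' J (by simp))
    simp only [Set.mem_union, Set.mem_insert_iff, Set.mem_singleton_iff] at hI
    rcases hI with (rfl | rfl) | rfl | rfl | rfl <;>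
      first | trivial | exact ha | exact mul_pos ha hd
  | diophantine c d v s J hJ htop hs hno =>
    simp only [Set.empty_union, Set.mem_singleton_iff] at hI
    subst hI
    have : 0 < (Int.gcd c d : ℤ) := by exact_mod_cast Int.gcd_pos_of_ne_zero_left d hJ.1.ne'
    exact this

end Cooper

/-! ### One transition -/

/-- The bound sequence of a state (empty for the final states). -/
def State.trail : State V → Trail V
  | .search M _ => M
  | .conflict M _ _ => M
  | .sat _ => []
  | .unsat => []

/-- The inequality under analysis in a conflict state. -/
def State.conflictPoly : State V → Option (Poly V)
  | .conflict _ _ p => some p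
  | _ => none

def State.IsFinal : State V → Prop
  | .sat _ => True
  | .unsat => True
  | _ => False

theorem not_isFinal_of_step {lt : V → V → Prop} {xS : V} {R : Rule V} {s s' : State V}
    (h : Step lt xS R s s') : ¬ s.IsFinal := by
  cases h <;> exact id

/-- The effect of a transition between non-final states on the problem; `conf` is the inequality
under analysis. -/
inductive ProblemStep (lt : V → V → Prop) (xS : V) (M : Trail V) (conf : Option (Poly V))
    (R : Rule V) (C : Problem V) : Problem V → Prop where
  | keep : ProblemStep lt xS M conf R C C
  | learn (p : Poly V) (hp : conf = some p) : ProblemStep lt xS M conf R C (C ∪ {.le p})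
  | forget (J : Constraint V) (hJ : J ∈ C) (hR : R = .forget J) :
      ProblemStep lt xS M conf R C (C \ {J})
  | slackIntro (x : V) (hx : x ∈ problemVars C) (hS : StuckState lt M C)
      (hstuck : StuckVar lt M C x) (hR : R = .slackIntro x) :
      ProblemStep lt xS M conf R C
        (C ∪ {.le (-X xS), .le (X x - X xS), .le (-X x - X xS)})
  | solveDiv (J₁ J₂ J₁' J₂' : Constraint V) (h : SolveDiv lt M C J₁ J₂ J₁' J₂')
      (hR : R = .solveDivLeft ∨ R = .solveDivRight) :
      ProblemStep lt xS M conf R C (C \ {J₁, J₂} ∪ {J₁', J₂'})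
  | resolveCooper (x : V) (C' Rk Rc : Problem V)
      (hcore : Cooper lt xS C M x C' Rk Rc) (hsub : C' ⊆ C) (hx : ¬ Guarded C x)
      (hfix : ∀ z ∈ problemVars C, lt z x → Fixed M z)
      (hconf : ∀ J ∈ C, IsConflict M J → ¬ TopLt lt J x) (hR : R = .resolveCooper (Rk ∪ Rc)) :
      ProblemStep lt xS M conf R C (C ∪ Rk ∪ Rc)

theorem Step.problemStep {lt : V → V → Prop} {xS : V} {R : Rule V} {s s' : State V}
    (h : Step lt xS R s s') (hs' : ¬ s'.IsFinal) :
    ProblemStep lt xS s.trail s.conflictPoly R s.problem s'.problem := by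
  cases h with
  | unsatDiv => exact absurd trivial hs'
  | sat => exact absurd trivial hs'
  | unsat => exact absurd trivial hs'
  | forget M C J hJ h => exact .forget J hJ rfl
  | slackIntro M C x hx hS hstuck => exact .slackIntro x hx hS hstuck rfl
  | learn M C p hp => exact .learn p rfl
  | solveDivLeft M C J₁ J₂ J₁' J₂' h hc => exact .solveDiv _ _ _ _ h (Or.inl rfl)
  | solveDivRight M C J₁ J₂ J₁' J₂' h hc => exact .solveDiv _ _ _ _ h (Or.inr rfl)
  | resolveCooper M C x C' Rk Rc hcore hsub hx hfix hconf =>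
    exact .resolveCooper x C' Rk Rc hcore hsub hx hfix hconf rfl
  | _ => exact .keep

theorem ProblemStep.finite {lt : V → V → Prop} {xS : V} {M : Trail V} {conf : Option (Poly V)}
    {R : Rule V} {C C' : Problem V} (h : ProblemStep lt xS M conf R C C') (hC : C.Finite) :
    C'.Finite := by
  cases h with
  | keep => exact hC
  | learn p hp => exact hC.union (Set.toFinite _)
  | forget J hJ hR' => exact hC.subset Set.sdiff_subset
  | slackIntro x hx hS hstuck hR' => exact hC.union (Set.toFinite _)
  | solveDiv J₁ J₂ J₁' J₂' h hR' => exact (hC.subset Set.sdiff_subset).union (Set.toFinite _)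
  | resolveCooper x C' Rk Rc hcore hsub hx hfix hconf' hR' =>
    rw [Set.union_assoc]
    exact hC.union hcore.finite

theorem SolveDiv.exists_divSolve {lt : V → V → Prop} {M : Trail V} {C : Problem V}
    {J₁ J₂ J₁' J₂' : Constraint V} (h : SolveDiv lt M C J₁ J₂ J₁' J₂') :
    ∃ x, DivSolve x J₁ J₂ J₁' J₂' := by
  obtain ⟨-, -, -, x, -, -, -, -, h⟩ := h
  exact ⟨x, h⟩

theorem ProblemStep.posModulus {lt : V → V → Prop} {xS : V} {M : Trail V}
    {conf : Option (Poly V)} {R : Rule V} {C C' : Problem V}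
    (h : ProblemStep lt xS M conf R C C') (hC : ∀ J ∈ C, PosModulus J) :
    ∀ J ∈ C', PosModulus J := by
  intro J hJ
  cases h with
  | keep => exact hC J hJ
  | learn p hp =>
    rcases hJ with hJ | rfl
    · exact hC J hJ
    · trivial
  | forget J' hJ' hR' => exact hC J hJ.1
  | slackIntro x hx hS hstuck hR' =>
    rcases hJ with hJ | rfl | rfl | rfl
    · exact hC J hJ
    all_goals trivial
  | solveDiv J₁ J₂ J₁' J₂' h hR' =>
    obtain ⟨x, hx⟩ := h.exists_divSolve
    have := hx.posModulus (hC _ h.1) (hC _ h.2.1)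
    rcases hJ with hJ | rfl | rfl
    · exact hC J hJ.1
    · exact this.1
    · exact this.2
  | resolveCooper x C' Rk Rc hcore hsub hx hfix hconf' hR' =>
    rw [Set.union_assoc] at hJ
    rcases hJ with hJ | hJ
    · exact hC J hJ
    · exact hcore.posModulus (fun J hJ => hC J (hsub hJ)) hJ

theorem problemVars_mono {C C' : Problem V} (h : C ⊆ C') : problemVars C ⊆ problemVars C' :=
  fun _ ⟨J, hJ, hx⟩ => ⟨J, h hJ, hx⟩

theorem Guarded.mem_problemVars {C : Problem V} {x : V} (h : Guarded C x) : x ∈ problemVars C := by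
  obtain ⟨⟨u, hu⟩, -⟩ := h
  exact ⟨_, hu, by simp [mem_vars_le]⟩

/-- A forgotten constraint is guarded, so each of its variables has two simple bounds in the
problem, at most one of which is the forgotten constraint; Solve-Div keeps variables because it is
invertible on coefficients. Since `OrderKept` speaks only of `xS` and occurring variables, variables
must not disappear. -/
theorem ProblemStep.problemVars_subset {lt : V → V → Prop} {xS : V} {M : Trail V}
    {conf : Option (Poly V)} {R : Rule V} {C C' : Problem V}
    (h : ProblemStep lt xS M conf R C C') (hC : ∀ J ∈ C, PosModulus J) (hR : LayeredAllows C R) :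
    problemVars C ⊆ problemVars C' := by
  cases h with
  | keep => exact subset_rfl
  | learn p hp => exact problemVars_mono Set.subset_union_left
  | forget J hJ hR' =>
    subst hR'
    rintro x ⟨I, hI, hx⟩
    by_cases hIJ : I = J
    · subst hIJ
      obtain ⟨⟨u, hu⟩, l, hl⟩ := hR x hx
      by_cases h1 : Constraint.le (X x - const u) = I
      · refine ⟨_, ⟨hl, ?_⟩, by simp [mem_vars_le]⟩
        rintro h2
        rw [← h2] at h1
        injection h1 with h1
        have := congrArg (coeff · x) h1
        simp at this
      · exact ⟨_, ⟨hu, h1⟩, by simp [mem_vars_le]⟩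
    · exact ⟨I, ⟨hI, hIJ⟩, hx⟩
  | slackIntro x hx hS hstuck hR' => exact problemVars_mono Set.subset_union_left
  | solveDiv J₁ J₂ J₁' J₂' h hR' =>
    obtain ⟨x, hx⟩ := h.exists_divSolve
    rintro y ⟨I, hI, hy⟩
    have key : y ∈ J₁.vars ∨ y ∈ J₂.vars → y ∈ problemVars (C \ {J₁, J₂} ∪ {J₁', J₂'}) := by
      intro h0
      rcases hx.mem_vars (hC _ h.2.1) h0 with h1 | h1
      · exact ⟨J₁', by simp, h1⟩
      · exact ⟨J₂', by simp, h1⟩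
    by_cases h1 : I = J₁
    · exact key (Or.inl (h1 ▸ hy))
    by_cases h2 : I = J₂
    · exact key (Or.inr (h2 ▸ hy))
    exact ⟨I, Or.inl ⟨hI, by simp [h1, h2]⟩, hy⟩
  | resolveCooper x C' Rk Rc hcore hsub hx hfix hconf' hR' =>
    rw [Set.union_assoc]
    exact problemVars_mono Set.subset_union_left

/-- New variables are guarded, or they are the slack variable. -/
theorem ProblemStep.mem_problemVars {lt : V → V → Prop} {xS : V} {M : Trail V}
    {conf : Option (Poly V)} {R : Rule V} {C C' : Problem V}
    (h : ProblemStep lt xS M conf R C C') (hconf : ∀ p ∈ conf, VarsIn (Guarded C) p) {x : V}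
    (hx : x ∈ problemVars C') : x ∈ problemVars C ∨ Guarded C' x ∨ x = xS := by
  obtain ⟨J, hJ, hxJ⟩ := hx
  cases h with
  | keep => exact Or.inl ⟨J, hJ, hxJ⟩
  | learn p hp =>
    rcases hJ with hJ | rfl
    · exact Or.inl ⟨J, hJ, hxJ⟩
    · exact Or.inl (hconf p hp x (mem_vars_le.1 hxJ)).mem_problemVars
  | forget J' hJ' hR' => exact Or.inl ⟨J, hJ.1, hxJ⟩
  | slackIntro z hz hS hstuck hR' =>
    by_cases h1 : x = xS
    · exact Or.inr (Or.inr h1)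
    by_cases h2 : x = z
    · exact Or.inl (h2 ▸ hz)
    have h1' := coeff_X_of_ne (Ne.symm h1)
    have h2' := coeff_X_of_ne (Ne.symm h2)
    rcases hJ with hJ | rfl | rfl | rfl
    · exact Or.inl ⟨J, hJ, hxJ⟩
    all_goals simp [mem_vars_le, h1', h2'] at hxJ
  | solveDiv J₁ J₂ J₁' J₂' h hR' =>
    obtain ⟨z, hz⟩ := h.exists_divSolve
    have key : x ∈ J₁.vars ∨ x ∈ J₂.vars → x ∈ problemVars C :=
      Or.rec (fun h1 => ⟨_, h.1, h1⟩) fun h1 => ⟨_, h.2.1, h1⟩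
    rcases hJ with hJ | rfl | rfl
    · exact Or.inl ⟨J, hJ.1, hxJ⟩
    · exact Or.inl (key (hz.vars_left hxJ))
    · exact Or.inl (key (hz.vars_right hxJ).1)
  | resolveCooper z C' Rk Rc hcore hsub hz hfix hconf' hR' =>
    rw [Set.union_assoc] at hJ
    rcases hJ with hJ | hJ
    · exact Or.inl ⟨J, hJ, hxJ⟩
    · rcases hcore.mem_vars hJ hxJ with h1 | ⟨-, I, hI, h1⟩
      · exact Or.inr (Or.inl h1)
      · exact Or.inl ⟨I, hsub hI, h1⟩

/-- Invariant of the bound sequence: its variables occur in the problem, and guarded variables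
are justified by, and conflicts consist of, guarded variables only. -/
structure TrailOk (C : Problem V) (s : State V) : Prop where
  mem_vars : ∀ γ ∈ s.trail, γ.var ∈ problemVars C
  justClosed : JustClosed (Guarded C) s.trail
  conflict : ∀ p ∈ s.conflictPoly, VarsIn (Guarded C) p

theorem guardedConstraint_le {C : Problem V} {p : Poly V} :
    GuardedConstraint C (.le p) ↔ VarsIn (Guarded C) p := by
  simp [GuardedConstraint, VarsIn, mem_vars_le]

theorem exists_of_upper_eq {M : Trail V} {x : V} {b : ℤ} (h : upper M x = b) :
    ∃ γ ∈ M, γ.var = x := by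
  by_contra! h0
  rw [upper_eq_top h0] at h
  exact absurd h (by simp)

theorem exists_of_lower_eq {M : Trail V} {x : V} {b : ℤ} (h : lower M x = b) :
    ∃ γ ∈ M, γ.var = x := by
  by_contra! h0
  rw [lower_eq_bot h0] at h
  exact absurd h (by simp)

theorem TrailOk.search {C C' : Problem V} {M : Trail V} (h1 : ∀ γ ∈ M, γ.var ∈ problemVars C)
    (h2 : JustClosed (Guarded C) M) : TrailOk C (.search M C') :=
  ⟨h1, h2, fun p hp => by simp [State.conflictPoly] at hp⟩

theorem TrailOk.search_concat {C C' : Problem V} {M : Trail V} {γ : Bound V}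
    (h1 : ∀ γ ∈ M, γ.var ∈ problemVars C) (h2 : JustClosed (Guarded C) M)
    (hγ1 : γ.var ∈ problemVars C) (hγ2 : Guarded C γ.var → ∀ I ∈ γ.just, VarsIn (Guarded C) I) :
    TrailOk C (.search (M ++ [γ]) C') := by
  refine TrailOk.search (fun γ' h => ?_) fun γ' h => ?_
  · rcases List.mem_append.1 h with h | h
    · exact h1 γ' h
    · exact List.mem_singleton.1 h ▸ hγ1
  · rcases List.mem_append.1 h with h | h
    · exact h2 γ' h
    · exact List.mem_singleton.1 h ▸ hγ2

theorem PropagatedBy.coeff_ne {M : Trail V} {p : Poly V} {γ : Bound V} (h : PropagatedBy M p γ) :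
    coeff p γ.var ≠ 0 := by
  obtain ⟨x, b, I, -, ht, ⟨-, rfl⟩ | ⟨-, rfl⟩⟩ := h <;> exact ht.1

theorem PropagatedBy.varsIn {G : V → Prop} {M : Trail V} {p : Poly V} {γ : Bound V}
    (h : PropagatedBy M p γ) (hM : JustClosed G M) (hp : VarsIn G p) :
    ∀ I ∈ γ.just, VarsIn G I := by
  obtain ⟨x, b, I, -, ht, ⟨-, rfl⟩ | ⟨-, rfl⟩⟩ := h <;>
  · rintro _ ⟨⟩
    exact ht.varsIn hM hp

theorem DvdNext.mem_vars {C : Problem V} {M : Trail V} {J : Constraint V} {x : V}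
    {kind : BoundKind} {c : ℤ} {I : Poly V} (h : DvdNext C M J x kind c I) : x ∈ J.vars := by
  obtain ⟨d, a, k, b, p, hf, -⟩ := h
  exact (hf.mem_vars_iff x).2 (Or.inl rfl)

theorem DvdNext.varsIn {G : V → Prop} {C : Problem V} {M : Trail V} {J : Constraint V} {x : V}
    {kind : BoundKind} {c : ℤ} {I : Poly V} (h : DvdNext C M J x kind c I) (hJ : PosModulus J)
    (hM : JustClosed G M) (hG : ∀ y ∈ J.vars, G y) : VarsIn G I := by
  obtain ⟨d, a, k, b, p, hf, -, -, -, -, hd⟩ := h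
  exact hd.varsIn (hf.pos hJ).ne' hM (hf.varsIn hG).1 (hf.varsIn hG).2

/-- Conflicts start from guarded constraints, and guarded variables are propagated from guarded
constraints. Resolving with justifications of guarded bounds stays among guarded variables, and so
does the bound that Backjump adds. Guardedness refers here to the problem before the step. -/
theorem Step.trailOk {lt : V → V → Prop} {xS : V} {R : Rule V} {s s' : State V}
    (h : Step lt xS R s s') (hR : LayeredAllows s.problem R)
    (hpos : ∀ J ∈ s.problem, PosModulus J) (hs : TrailOk s.problem s) :
    TrailOk s.problem s' := by
  obtain ⟨h1, h2, h3⟩ := hs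
  have hpre : ∀ {M : Trail V} {P : V → Prop}, ∀ γ ∈ decPrefix P M, γ ∈ M :=
    fun γ h => (List.takeWhile_prefix _).subset h
  cases h with
  | decideGe M C x b hu hl =>
    obtain ⟨γ, hγ, hx⟩ := exists_of_upper_eq hu
    exact .search_concat h1 h2 (hx ▸ h1 γ hγ) fun _ I hI => by simp at hI
  | decideLe M C x b hl hu =>
    obtain ⟨γ, hγ, hx⟩ := exists_of_lower_eq hl
    exact .search_concat h1 h2 (hx ▸ h1 γ hγ) fun _ I hI => by simp at hI
  | propagate M C p γ hp hγ =>
    exact .search_concat h1 h2 ⟨_, hp, mem_vars_le.2 hγ.coeff_ne⟩ fun hg =>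
      hγ.varsIn h2 (guardedConstraint_le.1 (hR hg))
  | propagateDiv M C J x kind c I hJ hc hcomp =>
    refine .search_concat h1 h2 ⟨J, hJ, hc.mem_vars⟩ fun hg => ?_
    rintro _ ⟨⟩
    exact hc.varsIn (hpos J hJ) h2 (hR hg)
  | conflict M C p hp hl =>
    refine ⟨h1, h2, ?_⟩
    rintro _ ⟨⟩
    exact guardedConstraint_le.1 hR
  | conflictDiv M C J I hJ hI =>
    refine ⟨h1, h2, ?_⟩
    rintro _ ⟨⟩
    obtain ⟨x, kind, c, hc, -⟩ := hI
    exact hc.varsIn (hpos J hJ) h2 hR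
  | unsatDiv => exact ⟨by simp [State.trail], by simp [State.trail, JustClosed],
      by simp [State.conflictPoly]⟩
  | sat => exact ⟨by simp [State.trail], by simp [State.trail, JustClosed],
      by simp [State.conflictPoly]⟩
  | forget M C J hJ h => exact .search h1 h2
  | slackIntro M C x hx hS hstuck => exact .search h1 h2
  | resolve M C γ p hγ =>
    refine ⟨fun γ h => h1 γ (List.mem_append_left _ h), h2.left, ?_⟩
    rintro _ ⟨⟩
    exact (h3 p rfl).resolve h2 (List.mem_append_right _ (by simp))
  | skipDecision M C γ p hγ hl =>
    exact ⟨fun γ h => h1 γ (List.mem_append_left _ h), h2.left, h3⟩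
  | unsat => exact ⟨by simp [State.trail], by simp [State.trail, JustClosed],
      by simp [State.conflictPoly]⟩
  | backjump M M' C γ γ' p hγ hγ' =>
    have hsub : ∀ β ∈ M, β ∈ M ++ [γ] ++ M' := fun β hβ =>
      List.mem_append_left _ (List.mem_append_left _ hβ)
    exact .search_concat (fun β hβ => h1 β (hsub β hβ)) (fun β hβ => h2 β (hsub β hβ))
      (h3 p rfl _ hγ'.coeff_ne).mem_problemVars
      fun _ => hγ'.varsIn (fun β hβ => h2 β (hsub β hβ)) (h3 p rfl)
  | learn M C p hp => exact ⟨h1, h2, h3⟩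
  | solveDivLeft M C J₁ J₂ J₁' J₂' h hc => exact .search h1 h2
  | solveDivRight M C J₁ J₂ J₁' J₂' h hc =>
    exact .search (fun β hβ => h1 β (hpre β hβ)) (fun β hβ => h2 β (hpre β hβ))
  | resolveCooper M C x C' Rk Rc hcore hsub hx hfix hconf =>
    exact .search (fun β hβ => h1 β (hpre β hβ)) (fun β hβ => h2 β (hpre β hβ))

/-! ### Invariants of an infinite derivation -/

/-- An infinite derivation that follows a strictly-two-layered strategy and starts from a finite
problem with positive moduli. -/
structure Run (xS : V) (C₀ : Problem V) (S : ℕ → State V) (L : ℕ → Rule V)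
    (lt : ℕ → V → V → Prop) : Prop where
  derivation : InfiniteDerivation xS C₀ S L lt
  strategy : StrictlyTwoLayered xS S L lt
  finite : C₀.Finite
  pos : ∀ J ∈ C₀, PosModulus J

variable {xS : V} {C₀ : Problem V} {S : ℕ → State V} {L : ℕ → Rule V} {lt : ℕ → V → V → Prop}

namespace Run

theorem problem_zero (h : Run xS C₀ S L lt) : (S 0).problem = C₀ := by
  rw [h.derivation.init]; rfl

theorem not_isFinal (h : Run xS C₀ S L lt) (n : ℕ) : ¬ (S n).IsFinal :=
  not_isFinal_of_step (h.derivation.step n)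

theorem problemStep (h : Run xS C₀ S L lt) (n : ℕ) :
    ProblemStep (lt n) xS (S n).trail (S n).conflictPoly (L n) (S n).problem (S (n + 1)).problem :=
  (h.derivation.step n).problemStep (h.not_isFinal _)

theorem problem_finite (h : Run xS C₀ S L lt) (n : ℕ) : (S n).problem.Finite := by
  induction n with
  | zero => rw [h.problem_zero]; exact h.finite
  | succ n ih => exact (h.problemStep n).finite ih

theorem posModulus (h : Run xS C₀ S L lt) (n : ℕ) : ∀ J ∈ (S n).problem, PosModulus J := by
  induction n with
  | zero => rw [h.problem_zero]; exact h.pos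
  | succ n ih => exact (h.problemStep n).posModulus ih

theorem problemVars_succ (h : Run xS C₀ S L lt) (n : ℕ) :
    problemVars (S n).problem ⊆ problemVars (S (n + 1)).problem :=
  (h.problemStep n).problemVars_subset (h.posModulus n) (h.strategy.layered n)

theorem problemVars_mono (h : Run xS C₀ S L lt) {m n : ℕ} (hmn : m ≤ n) :
    problemVars (S m).problem ⊆ problemVars (S n).problem :=
  monotone_nat_of_le_succ (f := fun n => problemVars (S n).problem) h.problemVars_succ hmn

theorem lt_irrefl (h : Run xS C₀ S L lt) {n : ℕ} {x : V} : ¬ lt n x x := by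
  have := (h.derivation.order n).total
  exact irrefl_of (lt n) x

theorem lt_asymm (h : Run xS C₀ S L lt) {n : ℕ} {x y : V} (hxy : lt n x y) : ¬ lt n y x := by
  have := (h.derivation.order n).total
  exact asymm_of (lt n) hxy

theorem lt_trans (h : Run xS C₀ S L lt) {n : ℕ} {x y z : V} (hxy : lt n x y) (hyz : lt n y z) :
    lt n x z := by
  have := (h.derivation.order n).total
  exact trans_of (lt n) hxy hyz

theorem lt_or_lt (h : Run xS C₀ S L lt) (n : ℕ) {x y : V} (hxy : x ≠ y) :
    lt n x y ∨ lt n y x := by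
  have := (h.derivation.order n).total
  rcases trichotomous_of (lt n) x y with h1 | h1 | h1
  · exact Or.inl h1
  · exact absurd h1 hxy
  · exact Or.inr h1

theorem not_guarded_slack (h : Run xS C₀ S L lt) (n : ℕ) : ¬ Guarded (S n).problem xS :=
  fun hg => h.lt_irrefl ((h.derivation.order n).guarded_lt xS hg).1

/-- The status of a variable that occurs does not change. -/
theorem guarded_succ_iff (h : Run xS C₀ S L lt) {n : ℕ} {x : V}
    (hx : x ∈ problemVars (S n).problem) :
    Guarded (S (n + 1)).problem x ↔ Guarded (S n).problem x := by
  by_cases hxS : x = xS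
  · subst hxS
    exact iff_of_false (h.not_guarded_slack _) (h.not_guarded_slack _)
  -- `xS` is never guarded, so its comparison with `x` is frozen, and this comparison decides
  -- whether `x` is guarded.
  have hkept := h.derivation.order_kept n xS (Set.mem_insert _ _) x (Set.mem_insert_of_mem _ hx)
    fun h0 => h.not_guarded_slack n h0.1
  have hkept' := h.derivation.order_kept n x (Set.mem_insert_of_mem _ hx) xS (Set.mem_insert _ _)
    fun h0 => h.not_guarded_slack n h0.2
  constructor
  · intro hg
    by_contra hng
    exact h.lt_asymm ((h.derivation.order (n + 1)).guarded_lt x hg).1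
      (hkept.2 ((h.derivation.order n).slack_lt x hx hng hxS))
  · intro hg
    by_contra hng
    exact h.lt_asymm (hkept'.2 ((h.derivation.order n).guarded_lt x hg).1)
      ((h.derivation.order (n + 1)).slack_lt x (h.problemVars_succ n hx) hng hxS)

theorem guarded_mono (h : Run xS C₀ S L lt) {m n : ℕ} (hmn : m ≤ n) {x : V}
    (hx : Guarded (S m).problem x) : Guarded (S n).problem x :=
  monotone_nat_of_le_succ (f := fun n => {x | Guarded (S n).problem x})
    (fun _ _ hx => (h.guarded_succ_iff hx.mem_problemVars).2 hx) hmn hx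

theorem trailOk (h : Run xS C₀ S L lt) (n : ℕ) : TrailOk (S n).problem (S n) := by
  induction n with
  | zero =>
    rw [h.derivation.init]
    exact .search (by simp) (by simp [JustClosed])
  | succ n ih =>
    obtain ⟨h1, h2, h3⟩ := (h.derivation.step n).trailOk (h.strategy.layered n) (h.posModulus n) ih
    have hg : ∀ {p : Poly V}, VarsIn (Guarded (S n).problem) p →
        VarsIn (Guarded (S (n + 1)).problem) p :=
      fun hp y hy => h.guarded_mono n.le_succ (hp y hy)
    exact ⟨fun γ hγ => h.problemVars_succ n (h1 γ hγ),
      fun γ hγ hgγ I hI => hg (h2 γ hγ ((h.guarded_succ_iff (h1 γ hγ)).1 hgγ) I hI),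
      fun p hp => hg (h3 p hp)⟩

end Run

/-- The unguarded variables of the initial problem, and the slack variable. -/
def initUnguarded (xS : V) (C₀ : Problem V) : Set V :=
  {x | x ∈ insert xS (problemVars C₀) ∧ ¬ Guarded C₀ x}

theorem problemVars_finite {C : Problem V} (hC : C.Finite) : (problemVars C).Finite := by
  have : problemVars C = ⋃ J ∈ C, (J.vars : Set V) := by
    ext x; simp [problemVars]
  rw [this]
  exact hC.biUnion fun J _ => J.vars.finite_toSet

namespace Run

theorem initUnguarded_finite (h : Run xS C₀ S L lt) : (initUnguarded xS C₀).Finite :=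
  ((problemVars_finite h.finite).insert xS).subset fun _ hx => hx.1

theorem mem_of_initUnguarded (h : Run xS C₀ S L lt) {x : V} (hx : x ∈ initUnguarded xS C₀)
    (n : ℕ) : x ∈ insert xS (problemVars (S n).problem) := by
  rcases hx.1 with h1 | h1
  · exact Or.inl h1
  · exact Or.inr (h.problemVars_mono (Nat.zero_le n) (by rwa [h.problem_zero]))

theorem not_guarded_of_initUnguarded (h : Run xS C₀ S L lt) {x : V}
    (hx : x ∈ initUnguarded xS C₀) (n : ℕ) : ¬ Guarded (S n).problem x := by
  induction n with
  | zero => rw [h.problem_zero]; exact hx.2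
  | succ n ih =>
    rcases h.mem_of_initUnguarded hx n with rfl | h1
    · exact h.not_guarded_slack _
    · rwa [h.guarded_succ_iff h1]

theorem slack_mem_initUnguarded (h : Run xS C₀ S L lt) : xS ∈ initUnguarded xS C₀ :=
  ⟨Set.mem_insert _ _, by
    have := h.not_guarded_slack 0
    rwa [h.problem_zero] at this⟩

/-- New variables come only from strong resolvents, where they are guarded at once, or from
Slack-Intro, where only `xS` is new. -/
theorem mem_initUnguarded_or (h : Run xS C₀ S L lt) (n : ℕ) {x : V}
    (hx : x ∈ problemVars (S n).problem) : x ∈ initUnguarded xS C₀ ∨ Guarded (S n).problem x := by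
  induction n with
  | zero =>
    rw [h.problem_zero] at hx ⊢
    by_cases hg : Guarded C₀ x
    · exact Or.inr hg
    · exact Or.inl ⟨Or.inr hx, hg⟩
  | succ n ih =>
    rcases (h.problemStep n).mem_problemVars (h.trailOk n).conflict hx with h1 | h1 | rfl
    · exact (ih h1).imp_right (h.guarded_mono n.le_succ)
    · exact Or.inr h1
    · exact Or.inl h.slack_mem_initUnguarded

theorem mem_initUnguarded_iff (h : Run xS C₀ S L lt) {n : ℕ} {x : V}
    (hx : x ∈ problemVars (S n).problem) :
    x ∈ initUnguarded xS C₀ ↔ ¬ Guarded (S n).problem x :=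
  ⟨fun h1 => h.not_guarded_of_initUnguarded h1 n,
    fun h1 => (h.mem_initUnguarded_or n hx).resolve_right h1⟩

theorem lt_iff (h : Run xS C₀ S L lt) {x y : V} (hx : x ∈ initUnguarded xS C₀)
    (hy : y ∈ initUnguarded xS C₀) (n : ℕ) : lt n x y ↔ lt 0 x y := by
  induction n with
  | zero => rfl
  | succ n ih =>
    rw [← ih]
    exact h.derivation.order_kept n x (h.mem_of_initUnguarded hx n) y (h.mem_of_initUnguarded hy n)
      fun h0 => h.not_guarded_of_initUnguarded hx n h0.1

end Run

/-! ### The rank of variables and constraints -/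

open Classical in
/-- The position of an unguarded variable in the order; guarded variables have rank `0`. -/
noncomputable def rank (U : Set V) (lt : V → V → Prop) (x : V) : ℕ :=
  if x ∈ U then {u ∈ U | lt u x}.ncard + 1 else 0

/-- The largest rank of a variable of `J`. -/
noncomputable def Constraint.rank (U : Set V) (lt : V → V → Prop) (J : Constraint V) : ℕ :=
  J.vars.sup (CutSat.rank U lt)

namespace Run

theorem rank_lt_rank_iff (h : Run xS C₀ S L lt) {x y : V} (hx : x ∈ initUnguarded xS C₀)
    (hy : y ∈ initUnguarded xS C₀) :
    rank (initUnguarded xS C₀) (lt 0) x < rank (initUnguarded xS C₀) (lt 0) y ↔ lt 0 x y := by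
  have mono : ∀ {x y : V}, x ∈ initUnguarded xS C₀ → y ∈ initUnguarded xS C₀ → lt 0 x y →
      rank (initUnguarded xS C₀) (lt 0) x < rank (initUnguarded xS C₀) (lt 0) y := by
    intro x y hx hy hxy
    simp only [rank, hx, hy, if_true, add_lt_add_iff_right]
    refine Set.ncard_lt_ncard ⟨fun u hu => ⟨hu.1, h.lt_trans hu.2 hxy⟩, fun hsub => ?_⟩
      (h.initUnguarded_finite.subset fun u hu => hu.1)
    exact h.lt_irrefl (hsub ⟨hx, hxy⟩ : x ∈ {u ∈ initUnguarded xS C₀ | lt 0 u x}).2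
  refine ⟨fun hr => ?_, mono hx hy⟩
  by_contra hn
  by_cases hxy : x = y
  · subst hxy; exact absurd hr (Nat.lt_irrefl _)
  · exact absurd hr (Nat.lt_asymm (mono hy hx ((h.lt_or_lt 0 hxy).resolve_left hn)))

theorem rank_injOn (h : Run xS C₀ S L lt) :
    Set.InjOn (rank (initUnguarded xS C₀) (lt 0)) (initUnguarded xS C₀) := by
  intro x hx y hy hxy
  by_contra hne
  rcases h.lt_or_lt 0 hne with h1 | h1
  · exact absurd ((h.rank_lt_rank_iff hx hy).2 h1) (by omega)
  · exact absurd ((h.rank_lt_rank_iff hy hx).2 h1) (by omega)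

theorem rank_pos {U : Set V} {r : V → V → Prop} {x : V} : 0 < rank U r x ↔ x ∈ U := by
  unfold rank
  split_ifs with hx <;> simp [hx]

/-- The rank describes the order of the variables. -/
theorem lt_iff_rank (h : Run xS C₀ S L lt) {n : ℕ} {x y : V}
    (hy : y ∈ problemVars (S n).problem) (hx : x ∈ problemVars (S n).problem)
    (hxU : x ∈ initUnguarded xS C₀) :
    lt n y x ↔ rank (initUnguarded xS C₀) (lt 0) y < rank (initUnguarded xS C₀) (lt 0) x := by
  by_cases hyU : y ∈ initUnguarded xS C₀
  · rw [h.rank_lt_rank_iff hyU hxU, h.lt_iff hyU hxU]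
  · have h0 : rank (initUnguarded xS C₀) (lt 0) y = 0 := by simp [rank, hyU]
    have h1 := rank_pos (r := lt 0).2 hxU
    refine iff_of_true ?_ (by omega)
    have hyg := (h.mem_initUnguarded_or n hy).resolve_left hyU
    exact ((h.derivation.order n).guarded_lt y hyg).2 x hx (h.not_guarded_of_initUnguarded hxU n)

/-- Ranks are injective on unguarded variables, so the maximal rank is attained only at `x`. The
rank condition refers neither to `n` nor to its order, which allows comparisons between different
steps. -/
theorem isTop_iff (h : Run xS C₀ S L lt) {n : ℕ} {x : V} {J : Constraint V}
    (hJ : J ∈ (S n).problem) (hxU : x ∈ initUnguarded xS C₀) :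
    IsTop (lt n) J x ↔ x ∈ J.vars ∧
      J.rank (initUnguarded xS C₀) (lt 0) = rank (initUnguarded xS C₀) (lt 0) x := by
  refine and_congr_right fun hx => ?_
  have hpv : ∀ y ∈ J.vars, y ∈ problemVars (S n).problem := fun y hy => ⟨J, hJ, hy⟩
  constructor
  · intro ht
    refine le_antisymm (Finset.sup_le fun y hy => ?_) (Finset.le_sup hx)
    by_cases hyx : y = x
    · rw [hyx]
    · exact ((h.lt_iff_rank (hpv y hy) (hpv x hx) hxU).1 (ht y hy hyx)).le
  · intro hr y hy hyx
    rw [h.lt_iff_rank (hpv y hy) (hpv x hx) hxU, ← hr]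
    have hle : rank (initUnguarded xS C₀) (lt 0) y ≤ J.rank (initUnguarded xS C₀) (lt 0) :=
      Finset.le_sup hy
    refine lt_of_le_of_ne hle fun heq => hyx (h.rank_injOn ?_ hxU (heq.trans hr))
    rw [← rank_pos (r := lt 0), heq, hr]
    exact rank_pos.2 hxU

/-- A crude bound that only has to start the downward induction in `quietAbove_one`. -/
theorem rank_le (h : Run xS C₀ S L lt) (J : Constraint V) :
    J.rank (initUnguarded xS C₀) (lt 0) ≤ (initUnguarded xS C₀).ncard + 1 := by
  refine Finset.sup_le fun y _ => ?_
  unfold rank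
  split_ifs
  · exact Nat.add_le_add_right
      (Set.ncard_le_ncard (fun u hu => hu.1) h.initUnguarded_finite) 1
  · exact Nat.zero_le _

theorem rank_eq_zero_iff {U : Set V} {r : V → V → Prop} {J : Constraint V} :
    J.rank U r = 0 ↔ ∀ x ∈ J.vars, x ∉ U := by
  rw [← not_iff_not]
  simp only [Constraint.rank, ← Nat.pos_iff_ne_zero, Finset.lt_sup_iff, rank_pos]
  push Not
  rfl

theorem guardedConstraint_iff (h : Run xS C₀ S L lt) {n : ℕ} {J : Constraint V}
    (hJ : J ∈ (S n).problem) :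
    GuardedConstraint (S n).problem J ↔ J.rank (initUnguarded xS C₀) (lt 0) = 0 := by
  rw [rank_eq_zero_iff]
  refine forall₂_congr fun x hx => ?_
  rw [h.mem_initUnguarded_iff (n := n) ⟨J, hJ, hx⟩, not_not]

end Run

namespace Run

/-! ### Persistence of constraints -/

/-- Only Forget and Solve-Div remove constraints, and Solve-Div removes only divisibility
constraints. -/
theorem mem_problem_succ (h : Run xS C₀ S L lt) {n : ℕ} {J : Constraint V}
    (hJ : J ∈ (S n).problem) (hd : ¬ J.IsDvd) (hf : L n ≠ .forget J) :
    J ∈ (S (n + 1)).problem := by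
  have key := h.problemStep n
  generalize (S (n + 1)).problem = C' at key ⊢
  cases key with
  | keep => exact hJ
  | learn p hp => exact Or.inl hJ
  | forget J' hJ' hR =>
    refine ⟨hJ, ?_⟩
    rintro rfl
    exact hf hR
  | slackIntro x hx hS hstuck hR => exact Or.inl hJ
  | solveDiv J₁ J₂ J₁' J₂' h hR =>
    obtain ⟨x, hx⟩ := h.exists_divSolve
    left
    refine ⟨hJ, ?_⟩
    rintro (rfl | rfl)
    · exact hd hx.isDvd.1
    · exact hd hx.isDvd.2.1
  | resolveCooper x C' Rk Rc hcore hsub hx hfix hconf hR => exact Or.inl (Or.inl hJ)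

theorem mem_problem_of_rank (h : Run xS C₀ S L lt) {m n : ℕ} (hmn : m ≤ n) {J : Constraint V}
    (hJ : J ∈ (S m).problem) (hd : ¬ J.IsDvd) (hr : J.rank (initUnguarded xS C₀) (lt 0) ≠ 0) :
    J ∈ (S n).problem := by
  induction n, hmn using Nat.le_induction with
  | base => exact hJ
  | succ n hmn ih =>
    refine h.mem_problem_succ ih hd fun hf => hr ?_
    have := h.strategy.layered n
    rw [hf] at this
    exact (h.guardedConstraint_iff ih).1 this

/-- Resolvents may contain guarded inequalities, which the rank argument of `mem_problem_of_rank`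
does not protect; here the strategy itself forbids Forget. -/
theorem mem_problem_of_resolvent (h : Run xS C₀ S L lt) {m n : ℕ} (hmn : m < n)
    {J : Constraint V} {R : Problem V} (hL : L m = .resolveCooper R) (hJR : J ∈ R)
    (hJ : J ∈ (S (m + 1)).problem) (hd : ¬ J.IsDvd) : J ∈ (S n).problem := by
  induction n, hmn using Nat.le_induction with
  | base => exact hJ
  | succ n hmn ih =>
    exact h.mem_problem_succ ih hd fun hf => h.strategy.forget_resolvent n J hf m hmn R hL hJR

/-! ### Slack-Intro -/

/-- While there is no bound for `x`, its guarding constraint `x - u ≤ 0` propagates `x ≤ u`. -/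
theorem not_stuckVar_of_guarded {r : V → V → Prop} {M : Trail V} {C : Problem V} {x : V}
    (hg : Guarded C x) : ¬ StuckVar r M C x := by
  rintro ⟨hM, hno⟩
  obtain ⟨⟨u, hu⟩, -⟩ := id hg
  refine hno ⟨_, u, hu, ⟨⟨-u, ?_, Or.inl ⟨by simp, by simp [Int.ceil_neg]⟩⟩, Or.inr ⟨by simp, ?_, ?_⟩⟩,
    fun h => absurd hg h, fun _ y hy => ?_⟩
  · have : rest (X x - const u) x = const (-u) := by
      ext <;> simp [rest, const, X, coeff]
    rw [this]
    simp [lowerPoly, const]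
  · rw [lower_eq_bot hM]; exact bot_le
  · rw [upper_eq_top hM]; exact WithTop.coe_lt_top _
  · by_cases hxy : x = y
    · exact hxy ▸ hg
    · simp [mem_vars_le, coeff_X_of_ne hxy] at hy

/-- The inequalities of the first application contain the unguarded `xS` and stay forever. At the
second one `-xS ≤ 0` could propagate if `xS` had no bounds, so `xS` is not stuck and hence is fixed;
but then `x - xS ≤ 0` propagates an upper bound for `x`, which therefore is not stuck. -/
theorem slackIntro_injective (h : Run xS C₀ S L lt) {m n : ℕ} (hmn : m < n) {x : V}
    (hm : L m = .slackIntro x) (hn : L n = .slackIntro x) : False := by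
  have hslack : ∀ n, L n = .slackIntro x → x ∈ problemVars (S n).problem ∧
      StuckState (lt n) (S n).trail (S n).problem ∧ StuckVar (lt n) (S n).trail (S n).problem x ∧
      (S (n + 1)).problem =
        (S n).problem ∪ {.le (-X xS), .le (X x - X xS), .le (-X x - X xS)} := by
    intro n hn
    have := h.derivation.step n
    rw [hn] at this
    generalize S n = s, S (n + 1) = s' at this
    cases this with
    | slackIntro M C x hx hS hstuck => exact ⟨hx, hS, hstuck, rfl⟩
  obtain ⟨-, -, -, hP⟩ := hslack m hm
  obtain ⟨hx, hS, hstuck, -⟩ := hslack n hn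
  have hSU := h.slack_mem_initUnguarded
  have hmem : ∀ p : Poly V, coeff p xS ≠ 0 →
      Constraint.le p ∈ ({.le (-X xS), .le (X x - X xS), .le (-X x - X xS)} : Problem V) →
      Constraint.le p ∈ (S n).problem := fun p hp hpm =>
    h.mem_problem_of_rank hmn (hP ▸ Or.inr hpm) id fun h0 =>
      rank_eq_zero_iff.1 h0 xS (mem_vars_le.2 hp) hSU
  have h1 := hmem (-X xS) (by simp) (by simp)
  have hSvars : xS ∈ problemVars (S n).problem := ⟨_, h1, by simp [mem_vars_le]⟩
  have hSstuck : ¬ StuckVar (lt n) (S n).trail (S n).problem xS := by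
    rintro ⟨hM, hno⟩
    refine hno ⟨_, 0, h1, ⟨⟨0, ?_, Or.inr ⟨by simp, by simp⟩⟩, Or.inl ⟨by simp, ?_, ?_⟩⟩,
      fun _ => ⟨by simp [mem_vars_le], fun y hy hyx => ?_⟩,
      fun h0 => absurd h0 (h.not_guarded_slack n)⟩
    · have : rest (-X xS) xS = 0 := by
        ext <;> simp [rest, X, coeff]
      rw [this]
      simp [lowerPoly]
    · rw [lower_eq_bot hM]; exact WithBot.bot_lt_coe _
    · rw [upper_eq_top hM]; exact le_top
    · simp [mem_vars_le, coeff_X_of_ne (Ne.symm hyx)] at hy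
  have hxS : x ≠ xS := fun h0 => hSstuck (h0 ▸ hstuck)
  have h2 := hmem (X x - X xS) (by simp [coeff_X_of_ne hxS]) (by simp)
  have hfix : Fixed (S n).trail xS := by
    by_contra h0
    exact hSstuck (hS.1 xS hSvars h0)
  have hxg : ¬ Guarded (S n).problem x := fun h0 => not_stuckVar_of_guarded h0 hstuck
  obtain ⟨hM, hno⟩ := hstuck
  obtain ⟨b, hl, hu⟩ := hfix
  refine hno ⟨_, b, h2, ⟨⟨-b, ?_, Or.inl ⟨?_, ?_⟩⟩, Or.inr ⟨?_, ?_, ?_⟩⟩,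
      fun _ => ⟨?_, fun y hy hyx => ?_⟩, fun h0 => absurd h0 hxg⟩
  · have : rest (X x - X xS) x = -X xS := by
      simp [rest, coeff_X_of_ne hxS.symm]
    rw [this, lowerPoly_of_fixed]
    · have : value (S n).trail xS = b := by simp [value, hl]
      simp [this]
    · intro y hy
      by_cases hyS : y = xS
      · exact hyS ▸ ⟨b, hl, hu⟩
      · simp [coeff_X_of_ne (Ne.symm hyS)] at hy
  · simp [coeff_X_of_ne hxS.symm]
  · simp [coeff_X_of_ne hxS.symm, Int.ceil_neg]
  · simp [coeff_X_of_ne hxS.symm]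
  · rw [lower_eq_bot hM]; exact bot_le
  · rw [upper_eq_top hM]; exact WithTop.coe_lt_top _
  · simp [mem_vars_le, coeff_X_of_ne hxS.symm]
  · have : y = xS := by
      by_contra hyS
      simp [mem_vars_le, coeff_X_of_ne (Ne.symm hyx), coeff_X_of_ne (Ne.symm hyS)] at hy
    rw [this]
    exact (h.derivation.order n).slack_lt x hx hxg hxS

theorem slackIntro_finite (h : Run xS C₀ S L lt) : {n | ∃ x, L n = .slackIntro x}.Finite := by
  by_contra hinf
  have hU : ∀ n ∈ {n | ∃ x, L n = .slackIntro x}, ∃ x ∈ initUnguarded xS C₀,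
      L n = .slackIntro x := by
    rintro n ⟨x, hx⟩
    refine ⟨x, ?_, hx⟩
    have := h.derivation.step n
    rw [hx] at this
    have hor := h.mem_initUnguarded_or n (x := x)
    generalize S n = s, S (n + 1) = s' at this hor
    cases this with
    | slackIntro M C x hx hS hstuck =>
      exact (hor hx).resolve_right fun hg => not_stuckVar_of_guarded hg hstuck
  have : Nonempty V := ⟨xS⟩
  choose! f hf using hU
  obtain ⟨m, hm, n, hn, hne, heq⟩ := Set.Infinite.exists_ne_map_eq_of_mapsTo hinf
    (fun n hn => (hf n hn).1) h.initUnguarded_finite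
  have hm' := (hf m hm).2
  have hn' := (hf n hn).2
  rw [heq] at hm'
  rcases lt_or_gt_of_ne hne with h1 | h1
  · exact h.slackIntro_injective h1 hm' hn'
  · exact h.slackIntro_injective h1 hn' hm'

/-! ### Solve-Div and Resolve-Cooper -/

/-- In step `n` two divisibility constraints of rank `r` are solved. -/
def SolveAt (_h : Run xS C₀ S L lt) (n r : ℕ) : Prop :=
  ∃ J₁ J₂ J₁' J₂' : Constraint V, J₁ ∈ (S n).problem ∧ J₂ ∈ (S n).problem ∧ J₁ ≠ J₂ ∧
    J₁.rank (initUnguarded xS C₀) (lt 0) = r ∧ J₂.rank (initUnguarded xS C₀) (lt 0) = r ∧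
    J₁'.rank (initUnguarded xS C₀) (lt 0) ≤ r ∧ J₂'.rank (initUnguarded xS C₀) (lt 0) < r ∧
    (S (n + 1)).problem = (S n).problem \ {J₁, J₂} ∪ {J₁', J₂'} ∧
    (∀ ν, J₁'.Sat ν → J₂'.Sat ν → J₁.Sat ν ∧ J₂.Sat ν) ∧ J₁'.IsDvd ∧ J₂'.IsDvd

/-- In step `n` the strong resolvent of a core for `x` is added. -/
def CooperAt (_h : Run xS C₀ S L lt) (n : ℕ) (x : V) (C' R : Problem V) : Prop :=
  ∃ Rk Rc, Cooper (lt n) xS (S n).problem (S n).trail x C' Rk Rc ∧ C' ⊆ (S n).problem ∧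
    ¬ Guarded (S n).problem x ∧
    (∀ z ∈ problemVars (S n).problem, lt n z x → Fixed (S n).trail z) ∧
    (∀ J ∈ (S n).problem, IsConflict (S n).trail J → ¬ TopLt (lt n) J x) ∧ R = Rk ∪ Rc ∧
    L n = .resolveCooper R ∧ (S (n + 1)).problem = (S n).problem ∪ R

theorem rank_le_of_mem {U : Set V} {r : V → V → Prop} {J : Constraint V} {y : V}
    (hy : y ∈ J.vars) : rank U r y ≤ J.rank U r :=
  Finset.le_sup hy

/-- The top variable `x` cancels in `J₂'`, so its rank drops strictly, while `J₁'` uses only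
variables of the two old constraints. -/
theorem solveAt_of_solveDiv (h : Run xS C₀ S L lt) {n : ℕ} {J₁ J₂ J₁' J₂' : Constraint V}
    (hs : SolveDiv (lt n) (S n).trail (S n).problem J₁ J₂ J₁' J₂')
    (hP : (S (n + 1)).problem = (S n).problem \ {J₁, J₂} ∪ {J₁', J₂'}) :
    ∃ r, 0 < r ∧ h.SolveAt n r := by
  obtain ⟨hJ₁, hJ₂, hne, x, ht₁, ht₂, hx, -, hd⟩ := hs
  have hpos := h.posModulus n
  have hxU : x ∈ initUnguarded xS C₀ :=
    (h.mem_initUnguarded_iff (n := n) ⟨J₁, hJ₁, ht₁.1⟩).2 hx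
  have hr₁ := ((h.isTop_iff hJ₁ hxU).1 ht₁).2
  have hr₂ := ((h.isTop_iff hJ₂ hxU).1 ht₂).2
  have hxv : x ∈ problemVars (S n).problem := ⟨J₁, hJ₁, ht₁.1⟩
  have h0 : 0 < rank (initUnguarded xS C₀) (lt 0) x := rank_pos.2 hxU
  refine ⟨_, h0, J₁, J₂, J₁', J₂', hJ₁, hJ₂, hne, hr₁, hr₂, Finset.sup_le fun y hy => ?_,
    (Finset.sup_lt_iff h0).2 fun y hy => ?_, hP, fun ν => hd.sat (hpos J₂ hJ₂), hd.isDvd.2.2⟩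
  · rcases hd.vars_left hy with h1 | h1
    · exact (rank_le_of_mem h1).trans hr₁.le
    · exact (rank_le_of_mem h1).trans hr₂.le
  · obtain ⟨h1 | h1, hyx⟩ := hd.vars_right hy
    · exact (h.lt_iff_rank ⟨J₁, hJ₁, h1⟩ hxv hxU).1 (ht₁.2 y h1 hyx)
    · exact (h.lt_iff_rank ⟨J₂, hJ₂, h1⟩ hxv hxU).1 (ht₂.2 y h1 hyx)

theorem CooperAt.mem_initUnguarded {h : Run xS C₀ S L lt} {n : ℕ} {x : V} {C' R : Problem V}
    (hc : h.CooperAt n x C' R) : x ∈ initUnguarded xS C₀ ∧ x ∈ problemVars (S n).problem ∧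
      ∀ J ∈ C', J.rank (initUnguarded xS C₀) (lt 0) = rank (initUnguarded xS C₀) (lt 0) x := by
  obtain ⟨Rk, Rc, hcore, hsub, hx, -⟩ := hc
  obtain ⟨J, hJ⟩ := hcore.nonempty
  have hxv : x ∈ problemVars (S n).problem := ⟨J, hsub hJ, (hcore.coreTop J hJ).1.1⟩
  have hxU := (h.mem_initUnguarded_iff hxv).2 hx
  exact ⟨hxU, hxv, fun J hJ => ((h.isTop_iff (hsub hJ) hxU).1 (hcore.coreTop J hJ).1).2⟩

/-- The auxiliary variable is guarded in the new problem and has rank 0; all other variables of the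
resolvent are variables of the core below `x`. -/
theorem CooperAt.rank_lt {h : Run xS C₀ S L lt} {n : ℕ} {x : V} {C' R : Problem V}
    (hc : h.CooperAt n x C' R) {I : Constraint V} (hI : I ∈ R) :
    I.rank (initUnguarded xS C₀) (lt 0) < rank (initUnguarded xS C₀) (lt 0) x := by
  obtain ⟨hxU, hxv, -⟩ := hc.mem_initUnguarded
  obtain ⟨Rk, Rc, hcore, hsub, hx, -, -, rfl, -, hP⟩ := hc
  refine (Finset.sup_lt_iff (rank_pos.2 hxU)).2 fun y hy => ?_
  rcases hcore.mem_vars hI hy with hg | ⟨hyx, J, hJ, hyJ⟩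
  · rw [Set.union_assoc, ← hP] at hg
    have hyU : y ∉ initUnguarded xS C₀ := fun h0 => h.not_guarded_of_initUnguarded h0 _ hg
    have h0 : rank (initUnguarded xS C₀) (lt 0) y = 0 := by simp [rank, hyU]
    rw [h0]
    exact rank_pos.2 hxU
  · exact (h.lt_iff_rank ⟨J, hsub hJ, hyJ⟩ hxv hxU).1 ((hcore.coreTop J hJ).1.2 y hyJ hyx)

/-- The possible effects of a step on the problem, in terms of ranks. -/
theorem problem_succ_cases (h : Run xS C₀ S L lt) (n : ℕ) :
    (S (n + 1)).problem = (S n).problem ∨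
    (∃ p, Constraint.rank (initUnguarded xS C₀) (lt 0) (.le p) = 0 ∧
      (S (n + 1)).problem = (S n).problem ∪ {.le p}) ∨
    (∃ J, L n = .forget J ∧ J.rank (initUnguarded xS C₀) (lt 0) = 0 ∧ ¬ J.IsDvd ∧
      (S (n + 1)).problem = (S n).problem \ {J}) ∨
    (∃ x, L n = .slackIntro x ∧ (S n).problem ⊆ (S (n + 1)).problem) ∨
    (∃ r, 0 < r ∧ h.SolveAt n r ∧ (L n = .solveDivLeft ∨ L n = .solveDivRight)) ∨
    (∃ x C' R, h.CooperAt n x C' R) := by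
  have key := h.problemStep n
  have hsolve := fun J₁ J₂ J₁' J₂' => h.solveAt_of_solveDiv (n := n) (J₁ := J₁) (J₂ := J₂)
    (J₁' := J₁') (J₂' := J₂')
  have hcoop : ∀ x C' Rk Rc, Cooper (lt n) xS (S n).problem (S n).trail x C' Rk Rc →
      C' ⊆ (S n).problem → ¬ Guarded (S n).problem x →
      (∀ z ∈ problemVars (S n).problem, lt n z x → Fixed (S n).trail z) →
      (∀ J ∈ (S n).problem, IsConflict (S n).trail J → ¬ TopLt (lt n) J x) →
      L n = .resolveCooper (Rk ∪ Rc) → (S (n + 1)).problem = (S n).problem ∪ (Rk ∪ Rc) →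
      h.CooperAt n x C' (Rk ∪ Rc) := fun x C' Rk Rc h1 h2 h3 h4 h5 h6 h7 =>
    ⟨Rk, Rc, h1, h2, h3, h4, h5, rfl, h6, h7⟩
  generalize hD : (S (n + 1)).problem = D at key hsolve hcoop ⊢
  cases key with
  | keep => exact Or.inl rfl
  | learn p hp =>
    refine Or.inr (Or.inl ⟨p, ?_, rfl⟩)
    rw [rank_eq_zero_iff]
    intro x hx hxU
    exact h.not_guarded_of_initUnguarded hxU n ((h.trailOk n).conflict p hp x (mem_vars_le.1 hx))
  | forget J hJ hR =>
    refine Or.inr (Or.inr (Or.inl ⟨J, hR, ?_, h.strategy.forget_dvd n J hR, rfl⟩))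
    have := h.strategy.layered n
    rw [hR] at this
    exact (h.guardedConstraint_iff hJ).1 this
  | slackIntro x hx hS hstuck hR =>
    exact Or.inr (Or.inr (Or.inr (Or.inl ⟨x, hR, Set.subset_union_left⟩)))
  | solveDiv J₁ J₂ J₁' J₂' hs hR =>
    obtain ⟨r, h0, hr⟩ := hsolve _ _ _ _ hs rfl
    exact Or.inr (Or.inr (Or.inr (Or.inr (Or.inl ⟨r, h0, hr, hR⟩))))
  | resolveCooper x C' Rk Rc hcore hsub hx hfix hconf hR =>
    exact Or.inr (Or.inr (Or.inr (Or.inr (Or.inr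
      ⟨x, C', _, hcoop x C' Rk Rc hcore hsub hx hfix hconf hR (Set.union_assoc _ _ _)⟩))))

/-- Divisibility constraints of small rank are entailed by later ones. -/
theorem dvd_sat_of_later (h : Run xS C₀ S L lt) {m n : ℕ} (hmn : m ≤ n) {r : ℕ} {ν : V → ℤ}
    (hν : ∀ J ∈ (S n).problem, J.IsDvd → J.rank (initUnguarded xS C₀) (lt 0) < r → J.Sat ν) :
    ∀ J ∈ (S m).problem, J.IsDvd → J.rank (initUnguarded xS C₀) (lt 0) < r → J.Sat ν := by
  induction n, hmn using Nat.le_induction with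
  | base => exact hν
  | succ n hmn ih =>
    refine ih fun J hJ hd hr => ?_
    rcases h.problem_succ_cases n with h1 | ⟨p, -, h1⟩ | ⟨J', -, -, hJ', h1⟩ | ⟨x, -, h1⟩ |
      ⟨r', -, ⟨J₁, J₂, J₁', J₂', hJ₁, hJ₂, -, hr₁, hr₂, hr₁', hr₂', h1, hsat, hd₁, hd₂⟩, -⟩ |
      ⟨x, C', R, Rk, Rc, -, -, -, -, -, -, -, h1⟩
    · exact hν J (h1 ▸ hJ) hd hr
    · exact hν J (h1 ▸ Or.inl hJ) hd hr
    · refine hν J (h1 ▸ ⟨hJ, ?_⟩) hd hr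
      rintro rfl
      exact hJ' hd
    · exact hν J (h1 hJ) hd hr
    -- Both replacements have rank at most `r'`, so they are among the constraints assumed
    -- satisfied, and Solve-Div can be undone.
    · have key : r' < r → J₁.Sat ν ∧ J₂.Sat ν := fun hrr => by
        refine hsat ν (hν J₁' ?_ hd₁ (by omega)) (hν J₂' ?_ hd₂ (by omega)) <;>
        · rw [h1]; simp
      by_cases h2 : J = J₁
      · subst h2; exact (key (by omega)).1
      by_cases h3 : J = J₂
      · subst h3; exact (key (by omega)).2
      exact hν J (h1 ▸ Or.inl ⟨hJ, by simp [h2, h3]⟩) hd hr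
    · exact hν J (h1 ▸ Or.inl hJ) hd hr

/-- At step `n` all variables below `x` are fixed and no constraint below `x` is a conflict, so the
current values satisfy every constraint of smaller rank. The resolvent of step `m` has smaller rank:
its inequalities are still present, and its divisibility constraints are entailed by present ones.
Hence `x` has a value that satisfies the core, contrary to its being conflicting at step `n`. -/
theorem cooperAt_injective (h : Run xS C₀ S L lt) {m n : ℕ} (hmn : m < n) {x x' : V}
    {C' R R' : Problem V} (hm : h.CooperAt m x C' R) (hn : h.CooperAt n x' C' R') : False := by
  classical
  have hrR := fun I (hI : I ∈ R) => hm.rank_lt hI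
  obtain ⟨hxU, -, hxr⟩ := hm.mem_initUnguarded
  obtain ⟨hxU', hxv, hxr'⟩ := hn.mem_initUnguarded
  obtain ⟨Rk, Rc, hcore, -, -, -, -, rfl, hL, hP⟩ := hm
  obtain ⟨Rk', Rc', hcore', hsub', -, hfix', hconf', -⟩ := hn
  -- The common rank of the constraints of a core determines its top variable.
  obtain rfl : x = x' := by
    obtain ⟨J, hJ⟩ := hcore.nonempty
    exact h.rank_injOn hxU hxU' ((hxr J hJ).symm.trans (hxr' J hJ))
  have hsat : ∀ J ∈ (S n).problem, J.rank (initUnguarded xS C₀) (lt 0) <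
      rank (initUnguarded xS C₀) (lt 0) x → J.Sat (value (S n).trail) := by
    intro J hJ hr
    have hlt : ∀ y ∈ J.vars, lt n y x := fun y hy =>
      (h.lt_iff_rank ⟨J, hJ, hy⟩ hxv hxU).2 ((rank_le_of_mem hy).trans_lt hr)
    refine sat_of_not_isConflict (x := x) (fun hxJ => h.lt_irrefl (hlt x hxJ))
      (fun y hy => hfix' y ⟨J, hJ, hy⟩ (hlt y hy)) fun hc => hconf' J hJ hc hlt
  obtain ⟨e, he⟩ := hcore.exists_sat (ν := value (S n).trail) fun I hI => by
    have hI' : I ∈ (S (m + 1)).problem := hP ▸ Or.inr hI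
    by_cases hd : I.IsDvd
    · exact h.dvd_sat_of_later hmn (fun J hJ _ hr => hsat J hJ hr) I hI' hd (hrR I hI)
    · exact hsat I (h.mem_problem_of_resolvent hmn hL hI hI' hd) (hrR I hI)
  exact hcore'.not_sat (fun J hJ y hy hyx => Function.update_of_ne hyx _ _) he

end Run

/-! ### Solve-Div and Resolve-Cooper stop: downward induction on the rank -/

namespace Run

/-- The constraints of rank `r` before step `n`. -/
def level (_h : Run xS C₀ S L lt) (n r : ℕ) : Problem V :=
  {J ∈ (S n).problem | J.rank (initUnguarded xS C₀) (lt 0) = r}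

theorem level_finite (h : Run xS C₀ S L lt) (n r : ℕ) : (h.level n r).Finite :=
  (h.problem_finite n).subset fun _ hJ => hJ.1

/-- Two distinct constraints leave the level and at most `J₁'` enters it, as `J₂'` has smaller rank.
-/
theorem SolveAt.ncard_lt {h : Run xS C₀ S L lt} {n r : ℕ} (hs : h.SolveAt n r) :
    (h.level (n + 1) r).ncard < (h.level n r).ncard := by
  obtain ⟨J₁, J₂, J₁', J₂', hJ₁, hJ₂, hne, hr₁, hr₂, hr₁', hr₂', h1, -⟩ := hs
  have hsub : h.level (n + 1) r ⊆ h.level n r \ {J₁, J₂} ∪ {J₁'} := by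
    rintro J ⟨hJ, hr⟩
    rw [h1] at hJ
    rcases hJ with hJ | rfl | rfl
    · exact Or.inl ⟨⟨hJ.1, hr⟩, hJ.2⟩
    · exact Or.inr rfl
    · exact absurd hr hr₂'.ne
  have hpair : ({J₁, J₂} : Problem V) ⊆ h.level n r := by
    rintro J (rfl | rfl)
    · exact ⟨hJ₁, hr₁⟩
    · exact ⟨hJ₂, hr₂⟩
  have hfin := h.level_finite n r
  have h2 := Set.ncard_sdiff_add_ncard_of_subset hpair hfin
  have h3 := Set.ncard_le_ncard hsub ((hfin.subset Set.sdiff_subset).union (Set.toFinite _))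
  have h4 := Set.ncard_union_le (h.level n r \ {J₁, J₂}) {J₁'}
  rw [Set.ncard_singleton] at h4
  rw [Set.ncard_pair hne] at h2
  omega

/-- Learn and Forget act at rank 0, Solve-Div at ranks below `r` stays below `r`, and a resolvent
for a variable of rank at most `r` has rank less than `r`. -/
theorem level_succ (h : Run xS C₀ S L lt) {n r : ℕ} (hr : 0 < r)
    (hslack : ∀ x, L n ≠ .slackIntro x) (hsolve : ∀ r', r ≤ r' → ¬ h.SolveAt n r')
    (hcoop : ∀ x C' R, h.CooperAt n x C' R → rank (initUnguarded xS C₀) (lt 0) x ≤ r) :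
    h.level (n + 1) r = h.level n r := by
  ext J
  refine and_congr_left fun hJr => ?_
  rcases h.problem_succ_cases n with h1 | ⟨p, hp, h1⟩ | ⟨J', -, hJ', -, h1⟩ | ⟨x, hx, -⟩ |
      ⟨r', -, hs, -⟩ | ⟨x, C', R, hc⟩
  · rw [h1]
  · rw [h1]
    refine or_iff_left ?_
    rintro rfl
    omega
  · rw [h1]
    refine and_iff_left ?_
    rintro rfl
    omega
  · exact absurd hx (hslack x)
  · have hr' : r' < r := by
      by_contra h0
      exact hsolve r' (by omega) hs
    obtain ⟨J₁, J₂, J₁', J₂', hJ₁, hJ₂, hne, hr₁, hr₂, hr₁', hr₂', h1, -⟩ := hs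
    rw [h1]
    constructor
    · rintro (hJ | rfl | rfl)
      · exact hJ.1
      · omega
      · omega
    · intro hJ
      refine Or.inl ⟨hJ, ?_⟩
      rintro (rfl | rfl) <;> omega
  · have hrR := fun I (hI : I ∈ R) => hc.rank_lt hI
    have hxr := hcoop x C' R hc
    obtain ⟨Rk, Rc, -, -, -, -, -, -, -, h1⟩ := hc
    rw [h1]
    refine or_iff_left fun hJ => ?_
    have := hrR J hJ
    omega

theorem exists_nat_min (f : ℕ → ℕ) (N : ℕ) : ∃ n₀, N ≤ n₀ ∧ ∀ n, N ≤ n → f n₀ ≤ f n := by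
  obtain ⟨n₀, h1, h2⟩ := Function.argminOn_mem f (Set.Ici N) Set.nonempty_Ici |> fun h =>
    (⟨_, h, fun n hn => Function.argminOn_le f (Set.Ici N) hn⟩ :
      ∃ n₀, n₀ ∈ Set.Ici N ∧ ∀ n ∈ Set.Ici N, f n₀ ≤ f n)
  exact ⟨n₀, h1, h2⟩

/-- From some step on, no constraints of rank at least `r` are solved or resolved. -/
def QuietAbove (h : Run xS C₀ S L lt) (r : ℕ) : Prop :=
  ∃ N, ∀ n, N ≤ n → (∀ x, L n ≠ .slackIntro x) ∧ (∀ r', r ≤ r' → ¬ h.SolveAt n r') ∧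
    ∀ x C' R, h.CooperAt n x C' R → rank (initUnguarded xS C₀) (lt 0) x < r

/-- With higher ranks quiet, nothing enlarges level `r` and each Solve-Div there shrinks it, so
after a minimum of its size the level is constant. Infinitely many cores at rank `r` would be
subsets of one finite set, so one core would be resolved twice. -/
theorem QuietAbove.step {h : Run xS C₀ S L lt} {r : ℕ} (hr : 0 < r) (hq : h.QuietAbove (r + 1)) :
    h.QuietAbove r := by
  obtain ⟨N, hN⟩ := hq
  obtain ⟨N₁, hN₁, hmin⟩ := exists_nat_min (fun n => (h.level n r).ncard) N
  have hcard : ∀ n, N ≤ n → (h.level (n + 1) r).ncard ≤ (h.level n r).ncard := by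
    intro n hn
    by_cases hs : h.SolveAt n r
    · exact hs.ncard_lt.le
    · rw [h.level_succ hr (hN n hn).1 (fun r' hr' => ?_)
        fun x C' R hc => Nat.lt_succ_iff.1 ((hN n hn).2.2 x C' R hc)]
      rcases hr'.eq_or_lt with rfl | h0
      · exact hs
      · exact (hN n hn).2.1 r' h0
  have hsolve : ∀ n, N₁ ≤ n → ¬ h.SolveAt n r := by
    intro n hn hs
    have h1 : (h.level n r).ncard ≤ (h.level N₁ r).ncard := by
      clear hs
      induction n, hn using Nat.le_induction with
      | base => exact le_rfl
      | succ n hn ih => exact (hcard n (hN₁.trans hn)).trans ih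
    have h2 := hs.ncard_lt
    have h3 := hmin (n + 1) (by omega)
    omega
  have hlevel : ∀ n, N₁ ≤ n → h.level n r = h.level N₁ r := by
    intro n hn
    induction n, hn using Nat.le_induction with
    | base => rfl
    | succ n hn ih =>
      have hn' := hN₁.trans hn
      rw [← ih]
      refine h.level_succ hr (hN n hn').1 (fun r' hr' => ?_)
        fun x C' R hc => Nat.lt_succ_iff.1 ((hN n hn').2.2 x C' R hc)
      rcases hr'.eq_or_lt with rfl | h0
      · exact hsolve n hn
      · exact (hN n hn').2.1 r' h0
  have hfin : {n | N₁ ≤ n ∧ ∃ x C' R, h.CooperAt n x C' R ∧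
      rank (initUnguarded xS C₀) (lt 0) x = r}.Finite := by
    by_contra hinf
    have hex : ∀ n ∈ {n | N₁ ≤ n ∧ ∃ x C' R, h.CooperAt n x C' R ∧
        rank (initUnguarded xS C₀) (lt 0) x = r}, ∃ C' ⊆ h.level N₁ r,
        ∃ x R, h.CooperAt n x C' R := by
      rintro n ⟨hn, x, C', R, hc, hx⟩
      refine ⟨C', ?_, x, R, hc⟩
      rw [← hlevel n hn]
      intro J hJ
      refine ⟨?_, (hc.mem_initUnguarded.2.2 J hJ).trans hx⟩
      obtain ⟨Rk, Rc, -, hsub, -⟩ := hc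
      exact hsub hJ
    choose! f hf hf' using hex
    obtain ⟨m, hm, n, hn, hne, heq⟩ := Set.Infinite.exists_ne_map_eq_of_mapsTo hinf
      (t := 𝒫 (h.level N₁ r)) (fun n hn => hf n hn) (h.level_finite _ _).finite_subsets
    obtain ⟨x, R, hc⟩ := hf' m hm
    obtain ⟨x', R', hc'⟩ := hf' n hn
    rw [heq] at hc
    rcases lt_or_gt_of_ne hne with h1 | h1
    · exact h.cooperAt_injective h1 hc hc'
    · exact h.cooperAt_injective h1 hc' hc
  obtain ⟨B, hB⟩ := hfin.bddAbove
  refine ⟨max N₁ (B + 1), fun n hn => ⟨(hN n (by omega)).1, fun r' hr' => ?_,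
    fun x C' R hc => ?_⟩⟩
  · rcases hr'.eq_or_lt with rfl | h0
    · exact hsolve n (by omega)
    · exact (hN n (by omega)).2.1 r' h0
  · have h1 := (hN n (by omega)).2.2 x C' R hc
    rcases (Nat.lt_succ_iff.1 h1).eq_or_lt with h2 | h2
    · have := mem_upperBounds.1 hB n ⟨by omega, x, C', R, hc, h2⟩
      omega
    · exact h2

/-- The induction starts at the size of `initUnguarded` plus 2, above all ranks, where only
Slack-Intro has to be outwaited. -/
theorem quietAbove_one (h : Run xS C₀ S L lt) : h.QuietAbove 1 := by
  have key : ∀ k, k ≤ (initUnguarded xS C₀).ncard + 1 →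
      h.QuietAbove ((initUnguarded xS C₀).ncard + 2 - k) := by
    intro k hk
    induction k with
    | zero =>
      obtain ⟨B, hB⟩ := h.slackIntro_finite.bddAbove
      refine ⟨B + 1, fun n hn => ⟨fun x hx => ?_, fun r' hr' => ?_, fun x C' R hc => ?_⟩⟩
      · have := mem_upperBounds.1 hB n ⟨x, hx⟩
        omega
      · rintro ⟨J₁, J₂, J₁', J₂', -, -, -, hr₁, -⟩
        have := h.rank_le J₁
        omega
      · have h1 := hc.mem_initUnguarded.2.2
        obtain ⟨Rk, Rc, hcore, -⟩ := hc
        obtain ⟨J, hJ⟩ := hcore.nonempty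
        have := h.rank_le J
        have := h1 J hJ
        omega
    | succ k ih =>
      refine QuietAbove.step (by omega) ?_
      have := ih (by omega)
      rwa [show (initUnguarded xS C₀).ncard + 2 - k =
        (initUnguarded xS C₀).ncard + 2 - (k + 1) + 1 by omega] at this
  have := key ((initUnguarded xS C₀).ncard + 1) le_rfl
  rwa [show (initUnguarded xS C₀).ncard + 2 - ((initUnguarded xS C₀).ncard + 1) = 1 by omega]
    at this

/-! ### The steps that remain in the long run -/

/-- From step `N` on, Forget, Slack-Intro, Solve-Div and Resolve-Cooper are not applied. -/
def Late (h : Run xS C₀ S L lt) (N : ℕ) : Prop :=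
  ∀ n, N ≤ n → (∀ J, L n ≠ .forget J) ∧ (∀ x, L n ≠ .slackIntro x) ∧
    (∀ r, 0 < r → ¬ h.SolveAt n r) ∧ ∀ x C' R, ¬ h.CooperAt n x C' R

theorem exists_late (h : Run xS C₀ S L lt) : ∃ N, h.Late N := by
  obtain ⟨N, hN⟩ := h.quietAbove_one
  obtain ⟨B, hB⟩ := h.strategy.reasonable.forget.bddAbove
  refine ⟨max N (B + 1), fun n hn => ?_⟩
  obtain ⟨h1, h2, h3⟩ := hN n (by omega)
  refine ⟨fun J hJ => ?_, h1, h2, fun x C' R hc => ?_⟩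
  · have := mem_upperBounds.1 hB n ⟨J, hJ⟩
    omega
  · have h4 := h3 x C' R hc
    have h5 := rank_pos (r := lt 0).2 hc.mem_initUnguarded.1
    omega

theorem Late.problem_succ {h : Run xS C₀ S L lt} {N : ℕ} (hN : h.Late N) {n : ℕ} (hn : N ≤ n) :
    (S (n + 1)).problem = (S n).problem ∨
    ∃ p, Constraint.rank (initUnguarded xS C₀) (lt 0) (.le p) = 0 ∧
      (S (n + 1)).problem = (S n).problem ∪ {.le p} := by
  obtain ⟨h1, h2, h3, h4⟩ := hN n hn
  rcases h.problem_succ_cases n with h5 | h5 | ⟨J', hJ', -⟩ | ⟨x, hx, -⟩ | ⟨r', hr', hs, -⟩ |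
    ⟨x, C', R, hc⟩
  · exact Or.inl h5
  · exact Or.inr h5
  · exact absurd hJ' (h1 J')
  · exact absurd hx (h2 x)
  · exact absurd hs (h3 r' hr')
  · exact absurd hc (h4 x C' R)

end Run

/-- The steps that remain possible in the long run. -/
inductive LateStep (lt : V → V → Prop) (xS : V) (R : Rule V) : State V → State V → Prop where
  | add (M : Trail V) (C : Problem V) (γ : Bound V) (hR : R.AddsBound)
      (hstep : Step lt xS R (.search M C) (.search (M ++ [γ]) C)) :
      LateStep lt xS R (.search M C) (.search (M ++ [γ]) C)
  | conflict (M : Trail V) (C : Problem V) (p : Poly V) :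
      LateStep lt xS R (.search M C) (.conflict M C p)
  | drop (M : Trail V) (C : Problem V) (γ : Bound V) (p p' : Poly V) :
      LateStep lt xS R (.conflict (M ++ [γ]) C p) (.conflict M C p')
  | learn (M : Trail V) (C : Problem V) (p : Poly V) (hp : Constraint.le p ∉ C) :
      LateStep lt xS R (.conflict M C p) (.conflict M (C ∪ {.le p}) p)
  | backjump (M M' : Trail V) (C : Problem V) (γ γ' : Bound V) (p : Poly V)
      (hγ : γ.just = none) (hγ' : PropagatedBy M p γ') :
      LateStep lt xS R (.conflict (M ++ [γ] ++ M') C p) (.search (M ++ [γ']) C)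

theorem Run.Late.lateStep {h : Run xS C₀ S L lt} {N : ℕ} (hN : h.Late N) {n : ℕ} (hn : N ≤ n) :
    LateStep (lt n) xS (L n) (S n) (S (n + 1)) := by
  have hstep := h.derivation.step n
  have hfin := h.not_isFinal (n + 1)
  obtain ⟨h1, h2, h3, h4⟩ := hN n hn
  have h5 := fun J₁ J₂ J₁' J₂' => h.solveAt_of_solveDiv (n := n) (J₁ := J₁) (J₂ := J₂)
    (J₁' := J₁') (J₂' := J₂')
  have h6 : ∀ x C' Rk Rc, Cooper (lt n) xS (S n).problem (S n).trail x C' Rk Rc →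
      C' ⊆ (S n).problem → ¬ Guarded (S n).problem x →
      (∀ z ∈ problemVars (S n).problem, lt n z x → Fixed (S n).trail z) →
      (∀ J ∈ (S n).problem, IsConflict (S n).trail J → ¬ TopLt (lt n) J x) →
      L n = .resolveCooper (Rk ∪ Rc) → (S (n + 1)).problem = (S n).problem ∪ (Rk ∪ Rc) →
      False := fun x C' Rk Rc h1 h2 h3 h5 h6 h7 h8 =>
    h4 x C' (Rk ∪ Rc) ⟨Rk, Rc, h1, h2, h3, h5, h6, rfl, h7, h8⟩
  have h7 : ∀ r, 0 < r → h.SolveAt n r → False := h3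
  clear h3 h4
  have h8 : ∀ J₁ J₂ J₁' J₂', SolveDiv (lt n) (S n).trail (S n).problem J₁ J₂ J₁' J₂' →
      (S (n + 1)).problem = (S n).problem \ {J₁, J₂} ∪ {J₁', J₂'} → False :=
    fun J₁ J₂ J₁' J₂' ha hb => by
      obtain ⟨r, hr, hs⟩ := h5 J₁ J₂ J₁' J₂' ha hb
      exact h7 r hr hs
  clear h5 h7
  generalize S n = s, S (n + 1) = s', L n = R at *
  have hstep' := hstep
  cases hstep with
  | decideGe M C x b hu hl => exact .add M C _ trivial hstep'
  | decideLe M C x b hl hu => exact .add M C _ trivial hstep'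
  | propagate M C p γ hp hγ => exact .add M C _ trivial hstep'
  | propagateDiv M C J x kind c I hJ hc hcomp => exact .add M C _ trivial hstep'
  | conflict M C p hp hl => exact .conflict M C p
  | conflictDiv M C J I hJ hI => exact .conflict M C I
  | unsatDiv => exact absurd trivial hfin
  | sat => exact absurd trivial hfin
  | forget M C J hJ h => exact absurd rfl (h1 J)
  | slackIntro M C x hx hS hstuck => exact absurd rfl (h2 x)
  | resolve M C γ p hγ => exact .drop M C γ p _
  | skipDecision M C γ p hγ hl => exact .drop M C γ p p
  | unsat => exact absurd trivial hfin
  | backjump M M' C γ γ' p hγ hγ' => exact .backjump M M' C γ γ' p hγ hγ'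
  | learn M C p hp => exact .learn M C p hp
  | solveDivLeft M C J₁ J₂ J₁' J₂' h hc => exact (h8 _ _ _ _ h rfl).elim
  | solveDivRight M C J₁ J₂ J₁' J₂' h hc => exact (h8 _ _ _ _ h rfl).elim
  | resolveCooper M C x C' Rk Rc hcore hsub hx hfix hconf =>
    exact (h6 _ _ _ _ hcore hsub hx hfix hconf rfl (Set.union_assoc _ _ _)).elim

/-! ### Stabilization of the bound sequence -/

theorem prefix_of_concat_prefix {α : Type*} {P Q : List α} {a b : α} (h : P ++ [a] <+: Q ++ [b]) :
    P ++ [a] <+: Q ∨ P = Q ∧ a = b := by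
  rcases Nat.lt_or_ge P.length Q.length with hl | hl
  · exact Or.inl (List.prefix_of_prefix_length_le h (List.prefix_append _ _) (by simpa using hl))
  · have hlen := h.length_le
    simp only [List.length_append, List.length_singleton, add_le_add_iff_right] at hlen
    have := h.eq_of_length (by simp; omega)
    right
    simpa using this

theorem eq_of_concat_prefix {α : Type*} {P Q : List α} {a b : α} (ha : P ++ [a] <+: Q)
    (hb : P ++ [b] <+: Q) : a = b := by
  have := (List.prefix_of_prefix_length_le ha hb (by simp)).eq_of_length (by simp)
  simpa using this

theorem PropagatedBy.just_ne {M : Trail V} {p : Poly V} {γ : Bound V} (h : PropagatedBy M p γ) :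
    γ.just ≠ none := by
  obtain ⟨x, b, I, -, -, ⟨-, rfl⟩ | ⟨-, rfl⟩⟩ := h <;> simp

/-- A bound at a fixed position can only change from decided to propagated. -/
theorem LateStep.eq_or_decided {r : V → V → Prop} {R : Rule V} {s s' : State V}
    (h : LateStep r xS R s s') {P : Trail V} {γ γ' : Bound V} (hs : P ++ [γ] <+: s.trail)
    (hs' : P ++ [γ'] <+: s'.trail) : γ = γ' ∨ γ.just = none ∧ γ'.just ≠ none := by
  cases h with
  | add M C δ hR hstep =>
    exact Or.inl (eq_of_concat_prefix (hs.trans (List.prefix_append _ _)) hs')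
  | conflict M C p => exact Or.inl (eq_of_concat_prefix hs hs')
  | drop M C δ p p' =>
    exact Or.inl (eq_of_concat_prefix hs (hs'.trans (List.prefix_append _ _)))
  | learn M C p hp => exact Or.inl (eq_of_concat_prefix hs hs')
  | backjump M M' C δ δ' p hδ hδ' =>
    simp only [State.trail] at hs hs'
    rcases prefix_of_concat_prefix hs' with h1 | ⟨rfl, rfl⟩
    · rw [List.append_assoc] at hs
      exact Or.inl (eq_of_concat_prefix hs (h1.trans (List.prefix_append _ _)))
    -- The only possible change: Backjump puts a propagated bound exactly where the decided one was.
    · obtain rfl : γ = δ := eq_of_concat_prefix hs (List.prefix_append _ _)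
      exact Or.inr ⟨hδ, hδ'.just_ne⟩

/-- In a conflict state that cannot lose any bounds, only Learn applies. -/
theorem LateStep.eq_learn {r : V → V → Prop} {R : Rule V} {s' : State V} {P : Trail V}
    {C : Problem V} {p : Poly V} (h : LateStep r xS R (.conflict P C p) s')
    (hs' : P <+: s'.trail) : Constraint.le p ∉ C ∧ s' = .conflict P (C ∪ {.le p}) p := by
  generalize hs : State.conflict P C p = s at h
  cases h with
  | add => cases hs
  | conflict => cases hs
  | drop M C δ p p' =>
    injection hs with h1
    subst h1
    have := hs'.length_le
    simp [State.trail] at this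
  | learn M C p hp =>
    cases hs
    exact ⟨hp, rfl⟩
  | backjump M M' C δ δ' p hδ hδ' =>
    injection hs with h1
    subst h1
    have h2 : M ++ [δ] <+: M ++ [δ'] := (List.prefix_append _ _).trans hs'
    rcases prefix_of_concat_prefix h2 with h3 | ⟨-, rfl⟩
    · have := h3.length_le
      simp at this
    · exact absurd hδ hδ'.just_ne

/-- A search state is entered with sequence `P` either by adding the last bound of `P`, so that the
sequence before was shorter, or by Backjump, which replaced a decided bound by the propagated last
bound of `P`. -/
theorem LateStep.trail_ne_of_search {r : V → V → Prop} {R : Rule V} {s : State V} {P : Trail V}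
    {C : Problem V} (h : LateStep r xS R s (.search P C)) : ¬ P <+: s.trail := by
  intro hs
  generalize hs' : State.search P C = s' at h
  cases h with
  | add M C δ hR hstep =>
    injection hs' with h1
    subst h1
    have := hs.length_le
    simp [State.trail] at this
  | conflict => cases hs'
  | drop => cases hs'
  | learn => cases hs'
  | backjump M M' C δ δ' p hδ hδ' =>
    injection hs' with h1
    subst h1
    simp only [State.trail, List.append_assoc, List.prefix_append_right_inj] at hs
    obtain rfl : δ' = δ := by simpa using hs
    exact hδ'.just_ne hδ

namespace Run.Late

variable {h : Run xS C₀ S L lt} {N : ℕ}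

/-- If `P` must not be lost, a conflict state at `P` allows only Learn, which leads to a conflict
state at `P` again; but the second Learn would need the inequality to be new. -/
theorem not_conflict (hN : h.Late N) {T : ℕ} (hT : N ≤ T) {P : Trail V}
    (hP : ∀ t, T ≤ t → P <+: (S t).trail) {t : ℕ} (ht : T ≤ t) (C : Problem V) (p : Poly V) :
    S t ≠ .conflict P C p := by
  intro hs
  have h1 := hN.lateStep (hT.trans ht)
  rw [hs] at h1
  obtain ⟨-, hs'⟩ := h1.eq_learn (hP _ (by omega))
  have h2 := hN.lateStep (n := t + 1) (by omega)
  rw [hs'] at h2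
  exact (h2.eq_learn (hP _ (by omega))).1 (Or.inr rfl)

/-- A state whose sequence is exactly the stable prefix `P` is neither a conflict nor, given that
`P` was already a prefix in the step before, a search state. -/
theorem length_lt (hN : h.Late N) {T : ℕ} (hT : N ≤ T) {P : Trail V}
    (hP : ∀ t, T ≤ t → P <+: (S t).trail) {t : ℕ} (ht : T < t) : P.length < (S t).trail.length := by
  by_contra hlen
  have heq := (hP t ht.le).eq_of_length_le (by omega)
  obtain ⟨t, rfl⟩ : ∃ t', t = t' + 1 := ⟨t - 1, by omega⟩
  have hstep := hN.lateStep (n := t) (by omega)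
  have hconf := hN.not_conflict hT hP ht.le
  have hfin := h.not_isFinal (t + 1)
  have hpre := hP t (by omega)
  cases hs : S (t + 1) with
  | search M C =>
    rw [hs] at hstep heq
    cases heq
    exact hstep.trail_ne_of_search hpre
  | conflict M C p =>
    rw [hs] at heq
    cases heq
    exact hconf C p hs
  | sat ν => rw [hs] at hfin; exact hfin trivial
  | unsat => rw [hs] at hfin; exact hfin trivial

/-- Induction on the position: behind a stable prefix there always is a next bound, and this bound
can change at most once. -/
theorem exists_stable (hN : h.Late N) (i : ℕ) :
    ∃ T, N ≤ T ∧ ∃ P : Trail V, P.length = i ∧ ∀ t, T ≤ t → P <+: (S t).trail := by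
  induction i with
  | zero => exact ⟨N, le_rfl, [], rfl, fun t _ => List.nil_prefix⟩
  | succ i ih =>
    obtain ⟨T, hT, P, rfl, hP⟩ := ih
    have hex : ∀ t, T < t → ∃ γ, P ++ [γ] <+: (S t).trail := by
      intro t ht
      have hlen := hN.length_lt hT hP ht
      obtain ⟨Q, hQ⟩ := hP t ht.le
      cases Q with
      | nil => rw [← hQ] at hlen; simp at hlen
      | cons γ Q => exact ⟨γ, Q, by simpa using hQ⟩
    have : Nonempty (Bound V) := ⟨⟨xS, .ge, 0, none⟩⟩
    choose! γ hγ using hex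
    have hstep : ∀ t, T < t → γ t = γ (t + 1) ∨ (γ t).just = none ∧ (γ (t + 1)).just ≠ none :=
      fun t ht => (hN.lateStep (by omega)).eq_or_decided (hγ t ht) (hγ (t + 1) (by omega))
    -- Once propagated, the bound never changes again; if it is always decided, it never changes at
    -- all.
    have hconst : ∃ T', T < T' ∧ ∀ t, T' ≤ t → γ t = γ T' := by
      by_cases hpr : ∃ t, T < t ∧ (γ t).just ≠ none
      · obtain ⟨T', hT', hj⟩ := hpr
        refine ⟨T', hT', fun t ht => ?_⟩
        induction t, ht using Nat.le_induction with
        | base => rfl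
        | succ t ht ih =>
          rcases hstep t (by omega) with h1 | ⟨h1, -⟩
          · exact h1 ▸ ih
          · exact absurd (ih ▸ h1) hj
      · push Not at hpr
        refine ⟨T + 1, by omega, fun t ht => ?_⟩
        induction t, ht using Nat.le_induction with
        | base => rfl
        | succ t ht ih =>
          rcases hstep t (by omega) with h1 | ⟨-, h1⟩
          · exact h1 ▸ ih
          · exact absurd (hpr (t + 1) (by omega)) h1
    obtain ⟨T', hT', hc⟩ := hconst
    exact ⟨T', by omega, P ++ [γ T'], by simp, fun t ht => hc t ht ▸ hγ t (by omega)⟩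

/-- The limit of the bound sequences. -/
theorem exists_limit (hN : h.Late N) : ∃ (T : ℕ → ℕ) (P : ℕ → Trail V) (γ : ℕ → Bound V),
    (∀ i, N ≤ T i) ∧ (∀ i, (P i).length = i) ∧ (∀ i t, T i ≤ t → P i <+: (S t).trail) ∧
    ∀ i, P (i + 1) = P i ++ [γ i] := by
  choose T hT P hlen hP using hN.exists_stable
  have hγ : ∀ i, ∃ γ, P (i + 1) = P i ++ [γ] := by
    intro i
    obtain ⟨Q, hQ⟩ := List.prefix_of_prefix_length_le (hP i (max (T i) (T (i + 1))) (by omega))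
      (hP (i + 1) _ (by omega)) (by rw [hlen, hlen]; omega)
    have hQlen := congrArg List.length hQ
    rw [List.length_append, hlen, hlen] at hQlen
    obtain ⟨γ, rfl⟩ := List.length_eq_one_iff.1 (by omega : Q.length = 1)
    exact ⟨γ, hQ.symm⟩
  choose γ hγ using hγ
  exact ⟨T, P, γ, hT, hlen, hP, hγ⟩

end Run.Late

/-! ### Bounds propagated by divisibility constraints -/

theorem lt_dvdBound_ge {d a k b : ℤ} (hd : 0 < d) (ha : 0 < a) (h : ¬ d ∣ a * b + k) :
    b < dvdBound d a k b .ge := by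
  have hd' : (0 : ℚ) < d := by exact_mod_cast hd
  have ha' : (0 : ℚ) < a := by exact_mod_cast ha
  rw [dvdBound, Int.lt_ceil, lt_div_iff₀ ha']
  have h1 := Int.le_ceil (((a * b + k : ℤ) : ℚ) / (d : ℚ))
  rw [div_le_iff₀ hd'] at h1
  have h2 : a * b + k ≤ ⌈((a * b + k : ℤ) : ℚ) / (d : ℚ)⌉ * d := by exact_mod_cast h1
  have h3 : a * b + k ≠ ⌈((a * b + k : ℤ) : ℚ) / (d : ℚ)⌉ * d := fun h0 =>
    h (Dvd.intro_left _ h0.symm)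
  have h4 : b * a < d * ⌈((a * b + k : ℤ) : ℚ) / (d : ℚ)⌉ - k := by
    have := lt_of_le_of_ne h2 h3
    linarith
  exact_mod_cast h4

/-- Rounding `a b + k` up to a multiple of `d` cannot pass the multiple `a e + k`, so no solution is
skipped. -/
theorem dvdBound_ge_le {d a k b e : ℤ} (hd : 0 < d) (ha : 0 < a) (hbe : b ≤ e)
    (h : d ∣ a * e + k) : dvdBound d a k b .ge ≤ e := by
  have hd' : (0 : ℚ) < d := by exact_mod_cast hd
  have ha' : (0 : ℚ) < a := by exact_mod_cast ha
  obtain ⟨t, ht⟩ := h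
  have h1 : ⌈((a * b + k : ℤ) : ℚ) / (d : ℚ)⌉ ≤ t := by
    rw [Int.ceil_le, div_le_iff₀ hd']
    have : a * b + k ≤ t * d := by nlinarith
    exact_mod_cast this
  rw [dvdBound, Int.ceil_le, div_le_iff₀ ha']
  have : d * ⌈((a * b + k : ℤ) : ℚ) / (d : ℚ)⌉ - k ≤ e * a := by nlinarith
  exact_mod_cast this

theorem dvdBound_le_lt {d a k b : ℤ} (hd : 0 < d) (ha : 0 < a) (h : ¬ d ∣ a * b + k) :
    dvdBound d a k b .le < b := by
  have hd' : (0 : ℚ) < d := by exact_mod_cast hd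
  have ha' : (0 : ℚ) < a := by exact_mod_cast ha
  rw [dvdBound, Int.floor_lt, div_lt_iff₀ ha']
  have h1 := Int.floor_le (((a * b + k : ℤ) : ℚ) / (d : ℚ))
  rw [le_div_iff₀ hd'] at h1
  have h2 : ⌊((a * b + k : ℤ) : ℚ) / (d : ℚ)⌋ * d ≤ a * b + k := by exact_mod_cast h1
  have h3 : a * b + k ≠ ⌊((a * b + k : ℤ) : ℚ) / (d : ℚ)⌋ * d := fun h0 =>
    h (Dvd.intro_left _ h0.symm)
  have h4 : d * ⌊((a * b + k : ℤ) : ℚ) / (d : ℚ)⌋ - k < b * a := by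
    have := lt_of_le_of_ne h2 h3.symm
    linarith
  exact_mod_cast h4

theorem le_dvdBound_le {d a k b e : ℤ} (hd : 0 < d) (ha : 0 < a) (hbe : e ≤ b)
    (h : d ∣ a * e + k) : e ≤ dvdBound d a k b .le := by
  have hd' : (0 : ℚ) < d := by exact_mod_cast hd
  have ha' : (0 : ℚ) < a := by exact_mod_cast ha
  obtain ⟨t, ht⟩ := h
  have h1 : t ≤ ⌊((a * b + k : ℤ) : ℚ) / (d : ℚ)⌋ := by
    rw [Int.le_floor, le_div_iff₀ hd']
    have : t * d ≤ a * b + k := by nlinarith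
    exact_mod_cast this
  rw [dvdBound, Int.le_floor, le_div_iff₀ ha']
  have : e * a ≤ d * ⌊((a * b + k : ℤ) : ℚ) / (d : ℚ)⌋ - k := by nlinarith
  exact_mod_cast this

/-- Adding a multiple of `d` to a solution gives a solution, so Bézout's solution can be shifted
past `b`. -/
theorem exists_ge_solution {d a k : ℤ} (hd : 0 < d) (h : (Int.gcd a d : ℤ) ∣ k) (b : ℤ) :
    ∃ e, b ≤ e ∧ d ∣ a * e + k := by
  obtain ⟨e, he⟩ := exists_dvd_mul_add h
  refine ⟨e + d * |b - e|, ?_, ?_⟩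
  · have := le_abs_self (b - e)
    nlinarith [abs_nonneg (b - e)]
  · rw [show a * (e + d * |b - e|) + k = a * e + k + d * (a * |b - e|) by ring]
    exact he.add (dvd_mul_right _ _)

theorem exists_le_solution {d a k : ℤ} (hd : 0 < d) (h : (Int.gcd a d : ℤ) ∣ k) (b : ℤ) :
    ∃ e, e ≤ b ∧ d ∣ a * e + k := by
  obtain ⟨e, he⟩ := exists_dvd_mul_add h
  refine ⟨e - d * |b - e|, ?_, ?_⟩
  · have := neg_le_abs (b - e)
    nlinarith [abs_nonneg (b - e)]
  · rw [show a * (e - d * |b - e|) + k = a * e + k - d * (a * |b - e|) by ring]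
    exact he.sub (dvd_mul_right _ _)

/-! ### How bounds are created -/

/-- The bound `γ` strictly improves `M` and does not contradict it. -/
def Improving (M : Trail V) (γ : Bound V) : Prop :=
  (γ.kind = .ge ∧ lower M γ.var < γ.val ∧ (γ.val : WithTop ℤ) ≤ upper M γ.var) ∨
    (γ.kind = .le ∧ lower M γ.var ≤ γ.val ∧ (γ.val : WithTop ℤ) < upper M γ.var)

def TwoSided (M : Trail V) (x : V) : Prop := lower M x ≠ ⊥ ∧ upper M x ≠ ⊤

/-- The ways in which the bound `γ` of an unguarded variable is added to `M`; `C` is the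
problem. -/
inductive Source (U : Set V) (r : V → V → Prop) (C : Problem V) (M : Trail V) (γ : Bound V) :
    Prop where
  | decided (h : TwoSided (M ++ [γ]) γ.var)
  | le (p : Poly V) (hp : Constraint.le p ∈ C)
      (hr : Constraint.rank U r (.le p) = rank U r γ.var) (hb : IsBound M p γ.var γ.val)
  | twoSided (h : TwoSided M γ.var)
  | dvd (J : Constraint V) (d a k b : ℤ) (p : Poly V) (hJ : J ∈ C)
      (hr : J.rank U r = rank U r γ.var) (hf : DvdForm J d a γ.var p)
      (hv : IsVal M p k) (hb : IsCurrent M γ.var b γ.kind) (hval : γ.val = dvdBound d a k b γ.kind)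
      (hd : 0 < d) (hgcd : (Int.gcd a d : ℤ) ∣ k)
      (hu : ∀ J' ∈ C, J'.IsDvd → γ.var ∈ J'.vars → J'.rank U r = rank U r γ.var → J' = J)

theorem PropagatedBy.improving {M : Trail V} {p : Poly V} {γ : Bound V} (h : PropagatedBy M p γ) :
    Improving M γ := by
  obtain ⟨x, b, I, ⟨-, hi⟩, -, ⟨hc, rfl⟩ | ⟨hc, rfl⟩⟩ := h
  · rcases hi with ⟨-, h1⟩ | ⟨h0, -⟩
    · exact Or.inl ⟨rfl, h1⟩
    · omega
  · rcases hi with ⟨h0, -⟩ | ⟨-, h1⟩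
    · omega
    · exact Or.inr ⟨rfl, h1⟩

theorem PropagatedBy.isBound {M : Trail V} {p : Poly V} {γ : Bound V} (h : PropagatedBy M p γ) :
    IsBound M p γ.var γ.val := by
  obtain ⟨x, b, I, ⟨hb, -⟩, -, ⟨hc, rfl⟩ | ⟨hc, rfl⟩⟩ := h <;> exact hb

/-- Every bound that is added improves the bound sequence. -/
theorem improving_of_step {r : V → V → Prop} {R : Rule V} {M : Trail V} {C : Problem V}
    {γ : Bound V} (hpos : ∀ J ∈ C, PosModulus J)
    (h : Step r xS R (.search M C) (.search (M ++ [γ]) C)) (hR : R.AddsBound) :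
    Improving M γ := by
  generalize hs' : State.search (M ++ [γ]) C = s' at h
  cases h with
  | decideGe _ _ x b hu hl =>
    obtain rfl : γ = _ := by simpa using hs'
    exact Or.inl ⟨rfl, hl, hu.ge⟩
  | decideLe _ _ x b hl hu =>
    obtain rfl : γ = _ := by simpa using hs'
    exact Or.inr ⟨rfl, hl.le, hu⟩
  | propagate _ _ p γ' hp hγ =>
    obtain rfl : γ = _ := by simpa using hs'
    exact hγ.improving
  | propagateDiv _ _ J x kind c I hJ hc hcomp =>
    obtain rfl : γ = _ := by simpa using hs'
    obtain ⟨d, a, k, b, p, hf, -, hb, hnd, rfl, -⟩ := hc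
    have hd := hf.pos (hpos J hJ)
    cases kind with
    | ge =>
      refine Or.inl ⟨rfl, ?_, hcomp⟩
      rw [show lower M x = b from hb]
      exact_mod_cast lt_dvdBound_ge hd hf.1 hnd
    | le =>
      refine Or.inr ⟨rfl, hcomp, ?_⟩
      rw [show upper M x = b from hb]
      exact_mod_cast dvdBound_le_lt hd hf.1 hnd
  | forget => exact hR.elim
  | slackIntro => exact hR.elim
  | solveDivLeft => exact hR.elim
  | solveDivRight => exact hR.elim
  | resolveCooper => exact hR.elim
  | _ => cases hs'

theorem Run.twoSided_of_step (h : Run xS C₀ S L lt) {N n : ℕ} (hn : N ≤ n) {M : Trail V}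
    {C : Problem V}
    (hs : S n = .search M C) (hR : (L n).AddsBound) (hp : ¬ (L n).IsSimplePropagate) {x : V}
    (hx : Guarded (S N).problem x) : TwoSided M x := by
  refine h.strategy.reasonable.bounded n M C hs hR hp x ?_
  have := h.guarded_mono hn hx
  rwa [hs] at this

theorem not_simple_of_decided {r : V → V → Prop} {R : Rule V} {M : Trail V} {C : Problem V}
    {γ : Bound V} (hs : Step r xS R (.search M C) (.search (M ++ [γ]) C)) (hR : R.AddsBound)
    (hγ : γ.just = none) : ¬ R.IsSimplePropagate := by
  generalize hs' : State.search (M ++ [γ]) C = s' at hs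
  cases hs with
  | propagate _ _ p γ' hp hγ' =>
    obtain rfl : γ = _ := by simpa using hs'
    exact absurd hγ hγ'.just_ne
  | forget => exact hR.elim
  | slackIntro => exact hR.elim
  | solveDivLeft => exact hR.elim
  | solveDivRight => exact hR.elim
  | resolveCooper => exact hR.elim
  | decideGe => exact id
  | decideLe => exact id
  | propagateDiv => exact id
  | _ => cases hs'

/-- What is known about a bound `γ` that is added to `M` from step `N` on. -/
structure Created (_h : Run xS C₀ S L lt) (N : ℕ) (M : Trail V) (γ : Bound V) : Prop where
  improving : Improving M γ
  mem_vars : γ.var ∈ problemVars (S N).problem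
  decided : γ.just = none → ∀ x, Guarded (S N).problem x → TwoSided M x
  source : γ.var ∈ initUnguarded xS C₀ →
    Source (initUnguarded xS C₀) (lt 0) (S N).problem M γ

namespace Run.Late

variable {h : Run xS C₀ S L lt} {N : ℕ}

theorem problem_subset (hN : h.Late N) {n : ℕ} (hn : N ≤ n) : (S N).problem ⊆ (S n).problem := by
  induction n, hn using Nat.le_induction with
  | base => exact subset_rfl
  | succ n hn ih =>
    rcases hN.problem_succ hn with h1 | ⟨p, -, h1⟩
    · exact h1 ▸ ih
    · exact h1 ▸ ih.trans Set.subset_union_left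

theorem mem_problem (hN : h.Late N) {n : ℕ} (hn : N ≤ n) {J : Constraint V}
    (hJ : J ∈ (S n).problem) (hr : J.rank (initUnguarded xS C₀) (lt 0) ≠ 0) :
    J ∈ (S N).problem := by
  induction n, hn using Nat.le_induction with
  | base => exact hJ
  | succ n hn ih =>
    rcases hN.problem_succ hn with h1 | ⟨p, hp, h1⟩
    · exact ih (h1 ▸ hJ)
    · rcases h1 ▸ hJ with hJ | rfl
      · exact ih hJ
      · exact absurd hp hr

theorem problemVars_subset (hN : h.Late N) {n : ℕ} (hn : N ≤ n) :
    problemVars (S n).problem ⊆ problemVars (S N).problem := by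
  induction n, hn using Nat.le_induction with
  | base => exact subset_rfl
  | succ n hn ih =>
    refine Set.Subset.trans ?_ ih
    have hstep := hN.lateStep hn
    have hok := (h.trailOk n).conflict
    generalize S n = s, S (n + 1) = s' at hstep hok
    cases hstep with
    | learn M C p hp =>
      rintro x ⟨J, hJ | rfl, hx⟩
      · exact ⟨J, hJ, hx⟩
      · exact (hok p rfl x (mem_vars_le.1 hx)).mem_problemVars
    | _ => exact subset_rfl

/-- Constraints of positive rank are the same from step `N` on, so the strategy's conditions at step
`n` become rank conditions on the problem of step `N`. A decision leaves its variable with both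
bounds, because Decide requires the opposite bound to be finite. -/
theorem source_of_step (hN : h.Late N) {n : ℕ} (hn : N ≤ n) {M : Trail V} {C : Problem V}
    {γ : Bound V} (hs : S n = .search M C) (hs' : S (n + 1) = .search (M ++ [γ]) C)
    (hR : (L n).AddsBound) (hU : γ.var ∈ initUnguarded xS C₀) :
    Source (initUnguarded xS C₀) (lt 0) (S N).problem M γ := by
  have hng := h.not_guarded_of_initUnguarded hU n
  have heager := h.strategy.eager n M C hs
  have hmem : ∀ J ∈ C, IsTop (lt n) J γ.var → J ∈ (S N).problem ∧
      J.rank (initUnguarded xS C₀) (lt 0) = rank (initUnguarded xS C₀) (lt 0) γ.var := by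
    intro J hJ ht
    have hJ' : J ∈ (S n).problem := by rw [hs]; exact hJ
    have hr := ((h.isTop_iff hJ' hU).1 ht).2
    refine ⟨hN.mem_problem hn hJ' ?_, hr⟩
    rw [hr]
    exact (rank_pos.2 hU).ne'
  have hmem' : ∀ J ∈ (S N).problem, γ.var ∈ J.vars →
      J.rank (initUnguarded xS C₀) (lt 0) = rank (initUnguarded xS C₀) (lt 0) γ.var →
      J ∈ C ∧ IsTop (lt n) J γ.var := by
    intro J hJ hx hr
    have hJ' := hN.problem_subset hn hJ
    refine ⟨?_, (h.isTop_iff hJ' hU).2 ⟨hx, hr⟩⟩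
    rw [hs] at hJ'
    exact hJ'
  have hpos := h.posModulus n
  have hstep := h.derivation.step n
  rw [hs, hs'] at hstep
  rw [hs] at hng hpos
  clear hs hs'
  generalize hs' : State.search (M ++ [γ]) C = s', L n = R at hstep heager hR
  cases hstep with
  | decideGe _ _ x b hu hl =>
    obtain rfl : γ = _ := by simpa using hs'
    refine .decided ⟨?_, ?_⟩
    · rw [lower_concat_of_ge M rfl]
      exact (lt_max_of_lt_right (WithBot.bot_lt_coe b)).ne'
    · rw [upper_concat_of_not M (by simp)]
      simp [hu]
  | decideLe _ _ x b hl hu =>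
    obtain rfl : γ = _ := by simpa using hs'
    refine .decided ⟨?_, ?_⟩
    · rw [lower_concat_of_not M (by simp)]
      simp [hl]
    · rw [upper_concat_of_le M rfl]
      exact (min_lt_of_right_lt (WithTop.coe_lt_top b)).ne
  | propagate _ _ p γ' hp hγ =>
    obtain rfl : γ = _ := by simpa using hs'
    obtain ⟨h1, h2⟩ := hmem _ hp (heager hng)
    exact .le p h1 h2 hγ.isBound
  | propagateDiv _ _ J x kind c I hJ hc hcomp =>
    obtain rfl : γ = _ := by simpa using hs'
    obtain ⟨htop, h2 | ⟨⟨d', a', k', p', hf', hk', hgcd⟩, hu⟩⟩ := heager hng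
    · exact .twoSided h2
    · obtain ⟨h1, h2⟩ := hmem J hJ htop
      obtain ⟨d, a, k, b, p, hf, hv, hb, -, rfl, -⟩ := hc
      obtain ⟨rfl, rfl, rfl⟩ := hf.unique hf'
      obtain rfl : k = k' := by
        have := hv.2.symm.trans hk'
        exact_mod_cast this
      refine .dvd J d a k b p h1 h2 hf hv hb rfl (hf.pos (hpos J hJ)) hgcd
        fun J' hJ' hd hx hr => ?_
      obtain ⟨h3, h4⟩ := hmem' J' hJ' hx hr
      exact hu J' h3 hd h4
  | forget => exact hR.elim
  | slackIntro => exact hR.elim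
  | solveDivLeft => exact hR.elim
  | solveDivRight => exact hR.elim
  | resolveCooper => exact hR.elim
  | _ => cases hs'

/-- Trace a bound back to the step that put it at its position. As it lies beyond the length reached
at step `N`, this happened later, by an added bound or by Backjump; the latter concerns only guarded
variables, since conflicts are guarded. -/
theorem created (hN : h.Late N) {n : ℕ} (hn : N ≤ n) {M : Trail V} {γ : Bound V}
    (hM : M ++ [γ] <+: (S n).trail) (hlen : (S N).trail.length ≤ M.length) :
    Created h N M γ := by
  induction n, hn using Nat.le_induction generalizing M γ with
  | base =>
    have := hM.length_le
    simp at this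
    omega
  | succ n hn ih =>
    have hvars : γ.var ∈ problemVars (S N).problem :=
      hN.problemVars_subset (n := n + 1) (by omega)
        ((h.trailOk (n + 1)).mem_vars γ (hM.subset (by simp)))
    have hstep := hN.lateStep hn
    generalize hs : S n = s, hs' : S (n + 1) = s' at hstep hM
    rw [hs] at ih
    cases hstep with
    | add M' C δ hR hstep =>
      rcases prefix_of_concat_prefix hM with h1 | ⟨rfl, rfl⟩
      · exact ih h1 hlen
      · have hpos := h.posModulus n
        rw [hs] at hpos
        exact ⟨improving_of_step hpos hstep hR, hvars,
          fun hj x hx => h.twoSided_of_step hn hs hR (not_simple_of_decided hstep hR hj) hx,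
          fun hU => hN.source_of_step hn hs hs' hR hU⟩
    | conflict M' C p => exact ih hM hlen
    | drop M' C δ p p' => exact ih (hM.trans (List.prefix_append _ _)) hlen
    | learn M' C p hp => exact ih hM hlen
    | backjump M' M'' C δ δ' p hδ hδ' =>
      rcases prefix_of_concat_prefix hM with h1 | ⟨rfl, rfl⟩
      · refine ih (h1.trans ?_) hlen
        simp only [State.trail, List.append_assoc]
        exact List.prefix_append _ _
      · have hold := ih (M := M) (γ := δ) (List.prefix_append _ _) hlen
        refine ⟨hδ'.improving, hvars, fun hj => absurd hj hδ'.just_ne, fun hU => ?_⟩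
        have hok := (h.trailOk n).conflict
        have hng := h.not_guarded_of_initUnguarded hU n
        rw [hs] at hok hng
        exact absurd (hok p rfl _ hδ'.coeff_ne) hng

end Run.Late

/-! ### Improving bounds have distinct values -/

theorem le_lower_of_prefix {M M' : Trail V} {γ : Bound V} (h : M ++ [γ] <+: M')
    (hk : γ.kind = .ge) : (γ.val : WithBot ℤ) ≤ lower M' γ.var := by
  refine le_trans ?_ (lower_mono h γ.var)
  rw [lower_concat_of_ge M hk]
  exact le_max_right _ _

theorem upper_le_of_prefix {M M' : Trail V} {γ : Bound V} (h : M ++ [γ] <+: M')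
    (hk : γ.kind = .le) : upper M' γ.var ≤ (γ.val : WithTop ℤ) := by
  refine le_trans (upper_anti h γ.var) ?_
  rw [upper_concat_of_le M hk]
  exact min_le_right _ _

/-- The earlier bound already makes the current bound at least as good, so the same value would not
be a strict improvement. -/
theorem Improving.val_ne {M M' : Trail V} {γ γ' : Bound V} (h' : Improving M' γ')
    (hpre : M ++ [γ] <+: M') (hvar : γ.var = γ'.var) (hkind : γ.kind = γ'.kind) :
    γ.val ≠ γ'.val := by
  intro hval
  rcases h' with ⟨hk, h1, -⟩ | ⟨hk, -, h1⟩
  · have h2 := le_lower_of_prefix hpre (hkind.trans hk)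
    rw [hvar, hval] at h2
    exact absurd h1 (not_lt.2 h2)
  · have h2 := upper_le_of_prefix hpre (hkind.trans hk)
    rw [hvar, hval] at h2
    exact absurd h1 (not_lt.2 h2)

theorem PropagatedBy.kind_eq {M : Trail V} {p : Poly V} {γ : Bound V} (h : PropagatedBy M p γ) :
    γ.kind = .ge ∧ coeff p γ.var < 0 ∨ γ.kind = .le ∧ 0 < coeff p γ.var := by
  obtain ⟨x, b, I, -, -, ⟨hc, rfl⟩ | ⟨hc, rfl⟩⟩ := h
  · exact Or.inl ⟨rfl, hc⟩
  · exact Or.inr ⟨rfl, hc⟩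

theorem IsSimple.eq_of_coeff_ne {p : Poly V} (h : IsSimple (.le p)) {y z : V}
    (hy : coeff p y ≠ 0) (hz : coeff p z ≠ 0) : y = z := by
  obtain ⟨x, b, h⟩ := h
  have key : ∀ y, coeff p y ≠ 0 → y = x := by
    intro y hy
    by_contra hyx
    have := coeff_X_of_ne (Ne.symm hyx)
    rcases h with h | h <;> injection h with h <;> subst h <;> simp [this] at hy
  rw [key y hy, key z hz]

/-! ### Guarded variables get both bounds -/

namespace Run.Late

variable {h : Run xS C₀ S L lt} {N : ℕ}

/-- If decided bounds are made only below `L₀`, then from some step on all steps add a bound. -/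
theorem false_of_no_decision (hN : h.Late N) {T : ℕ → ℕ} {P : ℕ → Trail V} {L₀ : ℕ}
    (hT : ∀ i, N ≤ T i) (hlen : ∀ i, (P i).length = i)
    (hP : ∀ i t, T i ≤ t → P i <+: (S t).trail)
    (hAB : ∀ i, ¬ ∀ x, Guarded (S N).problem x → TwoSided (P i) x)
    (hdec : ∀ t, T L₀ ≤ t → ∀ Q δ, Q ++ [δ] <+: (S t).trail → L₀ ≤ Q.length → δ.just ≠ none) :
    False := by
  -- Backjump would have to replace a decision inside the stable prefix `P L₀`. So a conflict state
  -- is followed by conflict states, and their sequences do not grow.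
  have hconf : ∀ t, T L₀ ≤ t → (S t).conflictPoly ≠ none →
      (S (t + 1)).conflictPoly ≠ none ∧ (S (t + 1)).trail.length ≤ (S t).trail.length := by
    intro t ht hc
    have hstep := hN.lateStep ((hT _).trans ht)
    have h1 := hP L₀ t ht
    have h2 := hP L₀ (t + 1) (by omega)
    have h3 := hdec t ht
    generalize S t = s, S (t + 1) = s' at hstep h1 h2 h3 hc
    cases hstep with
    | add => exact absurd rfl hc
    | conflict => exact absurd rfl hc
    | drop M C δ p p' => simp [State.conflictPoly, State.trail]
    | learn M C p hp => simp [State.conflictPoly, State.trail]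
    | backjump M M' C δ δ' p hδ hδ' =>
      have hpre : M ++ [δ] <+: (State.conflict (M ++ [δ] ++ M') C p).trail := List.prefix_append _ _
      by_cases hM : L₀ ≤ M.length
      · exact absurd hδ (h3 M δ hpre hM)
      · have h4 : M ++ [δ] <+: P L₀ :=
          List.prefix_of_prefix_length_le hpre h1 (by simp [hlen]; omega)
        have h5 : M ++ [δ'] <+: P L₀ :=
          List.prefix_of_prefix_length_le (by exact List.prefix_rfl) h2 (by simp [hlen]; omega)
        exact absurd (eq_of_concat_prefix h4 h5 ▸ hδ) hδ'.just_ne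
  -- A conflict would bound the length forever, but the stable prefixes become arbitrarily long.
  have hsearch : ∀ t, T L₀ ≤ t → (S t).conflictPoly = none := by
    intro t ht
    by_contra hc
    have key : ∀ t', t ≤ t' → (S t').conflictPoly ≠ none ∧
        (S t').trail.length ≤ (S t).trail.length := by
      intro t' ht'
      induction t', ht' using Nat.le_induction with
      | base => exact ⟨hc, le_rfl⟩
      | succ t' ht' ih =>
        have := hconf t' (by omega) ih.1
        exact ⟨this.1, this.2.trans ih.2⟩
    have h1 := (key (max t (T ((S t).trail.length + 1))) (le_max_left _ _)).2
    have h2 := (hP ((S t).trail.length + 1) _ (le_max_right t _)).length_le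
    rw [hlen] at h2
    omega
  have hadd : ∀ t, T L₀ ≤ t → ∃ M C γ, S t = .search M C ∧ S (t + 1) = .search (M ++ [γ]) C ∧
      (L t).AddsBound ∧ Step (lt t) xS (L t) (.search M C) (.search (M ++ [γ]) C) := by
    intro t ht
    have hstep := hN.lateStep ((hT _).trans ht)
    have h1 := hsearch t ht
    have h2 := hsearch (t + 1) (by omega)
    generalize S t = s, S (t + 1) = s' at hstep h1 h2
    cases hstep with
    | add M C γ hR hs => exact ⟨M, C, γ, rfl, rfl, hR, hs⟩
    | conflict => simp [State.conflictPoly] at h2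
    | drop => simp [State.conflictPoly] at h1
    | learn => simp [State.conflictPoly] at h1
    | backjump => simp [State.conflictPoly] at h1
  have hmono : ∀ t t', T L₀ ≤ t → t ≤ t' → (S t).trail <+: (S t').trail ∧
      (S t').problem = (S t).problem := by
    intro t t' ht ht'
    induction t', ht' using Nat.le_induction with
    | base => exact ⟨List.prefix_rfl, rfl⟩
    | succ t' ht' ih =>
      obtain ⟨M, C, γ, h1, h2, -⟩ := hadd t' (by omega)
      rw [h1] at ih
      rw [h2]
      exact ⟨ih.1.trans (List.prefix_append _ _), ih.2⟩
  have hprop : ∀ t, T L₀ ≤ t → ∃ p γ, IsSimple (.le p) ∧ Constraint.le p ∈ (S (T L₀)).problem ∧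
      PropagatedBy (S t).trail p γ ∧ (S t).trail ++ [γ] = (S (t + 1)).trail := by
    intro t ht
    obtain ⟨M, C, γ, h1, h2, hR, hs⟩ := hadd t ht
    -- Nothing is removed any more, so `M` is itself one of the `P i`; any other rule would require
    -- both bounds of every guarded variable in it.
    have hsimple : (L t).IsSimplePropagate := by
      by_contra hns
      refine hAB M.length fun x hx => ?_
      have h3 := (hmono t (max t (T M.length)) ht (le_max_left _ _)).1
      rw [h1] at h3
      have h4 := hP M.length _ (le_max_right t _)
      have h5 : P M.length = M :=
        (List.prefix_of_prefix_length_le h4 h3 (hlen _).le).eq_of_length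
          (hlen _)
      rw [h5]
      exact h.twoSided_of_step ((hT _).trans ht) h1 hR hns hx
    have hC : C = (S (T L₀)).problem := by
      rw [← (hmono (T L₀) t le_rfl ht).2, h1]; rfl
    rw [h1, h2, ← hC]
    generalize hs' : State.search (M ++ [γ]) C = s', L t = R at hs hsimple
    cases hs with
    | propagate _ _ p γ' hp hγ =>
      obtain rfl : γ = _ := by simpa using hs'
      exact ⟨p, γ, hsimple, hp, hγ, rfl⟩
    | _ => exact hsimple.elim
  have : Nonempty (Bound V) := ⟨⟨xS, .ge, 0, none⟩⟩
  choose! p γ hsim hmem hγ htr using hprop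
  -- Some simple constraint propagates twice. Its bound does not depend on the bound sequence, so
  -- the second propagation is no improvement.
  obtain ⟨t, ht, t', ht', hne, heq⟩ := Set.Infinite.exists_ne_map_eq_of_mapsTo
    (Set.Ici_infinite (T L₀)) (f := fun t => Constraint.le (p t)) (fun t ht => hmem t ht)
    (h.problem_finite (T L₀))
  wlog hlt : t < t' generalizing t t'
  · exact this t' ht' t ht hne.symm heq.symm (by omega)
  injection heq with heq
  have hx : (γ t).var = (γ t').var :=
    (hsim t ht).eq_of_coeff_ne (hγ t ht).coeff_ne (heq ▸ (hγ t' ht').coeff_ne)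
  refine (hγ t' ht').improving.val_ne (M := (S t).trail) (γ := γ t) ?_ hx ?_ ?_
  · rw [htr t ht]
    exact (hmono (t + 1) t' (by simp at ht; omega) hlt).1
  · have h1 := (hγ t ht).kind_eq
    have h2 := (hγ t' ht').kind_eq
    rw [← heq, ← hx] at h2
    rcases h1 with ⟨h1, h3⟩ | ⟨h1, h3⟩ <;> rcases h2 with ⟨h2, h4⟩ | ⟨h2, h4⟩ <;>
      first | omega | rw [h1, h2]
  · have h1 := (hγ t ht).isBound
    have h2 := (hγ t' ht').isBound
    rw [← heq, ← hx] at h2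
    refine h1.unique (h2.congr fun y hy hyx => ?_)
    exact absurd ((hsim t ht).eq_of_coeff_ne hy (hγ t ht).coeff_ne) hyx

/-- If there are late decisions beyond the initial length, take one at the least position; it was
made when all guarded variables had both bounds. The prefix `Q` before it contains no later-made
decision, so no Backjump can cut into it and `Q` belongs to the limit. Without such decisions
`false_of_no_decision` applies. -/
theorem exists_twoSided (hN : h.Late N) {T : ℕ → ℕ} {P : ℕ → Trail V}
    (hT : ∀ i, N ≤ T i) (hlen : ∀ i, (P i).length = i)
    (hP : ∀ i t, T i ≤ t → P i <+: (S t).trail) :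
    ∃ i, ∀ x, Guarded (S N).problem x → TwoSided (P i) x := by
  by_contra! hAB'
  have hAB : ∀ i, ¬ ∀ x, Guarded (S N).problem x → TwoSided (P i) x := by
    intro i h0
    obtain ⟨x, hx, hx'⟩ := hAB' i
    exact hx' (h0 x hx)
  refine hN.false_of_no_decision (L₀ := (S N).trail.length) hT hlen hP hAB ?_
  by_contra! hex
  obtain ⟨t, ht, hex⟩ := hex
  classical
  have hex' : ∃ m, ∃ Q δ, Q ++ [δ] <+: (S t).trail ∧ (S N).trail.length ≤ Q.length ∧
      δ.just = none ∧ Q.length = m := by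
    obtain ⟨Q, δ, h1, h2, h3⟩ := hex
    exact ⟨_, Q, δ, h1, h2, h3, rfl⟩
  obtain ⟨Q, δ, hQ, hQL, hδ, hQm⟩ := Nat.find_spec hex'
  have hmin : ∀ M δ', M ++ [δ'] <+: Q → (S N).trail.length ≤ M.length → δ'.just ≠ none := by
    intro M δ' hM hML hδ'
    have hl := hM.length_le
    simp at hl
    exact Nat.find_min hex' (m := M.length) (by omega)
      ⟨M, δ', hM.trans ((List.prefix_append _ _).trans hQ), hML, hδ', rfl⟩
  -- Conflict analysis may pass below `Q`, but it finds no decision inside `Q` to return to a search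
  -- state from.
  have hinv : ∀ t', t ≤ t' → Q <+: (S t').trail ∨
      (S t').conflictPoly ≠ none ∧ (S t').trail <+: Q := by
    intro t' ht'
    induction t', ht' using Nat.le_induction with
    | base => exact Or.inl ((List.prefix_append _ _).trans hQ)
    | succ t' ht' ih =>
      have hstep := hN.lateStep (n := t') ((hT _).trans (ht.trans ht'))
      have h1 := hP (S N).trail.length t' (by omega)
      have h2 := hP (S N).trail.length (t' + 1) (by omega)
      generalize hL : (S N).trail.length = L₀ at *
      generalize S t' = s, S (t' + 1) = s' at hstep h1 h2 ih
      cases hstep with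
      | add M C γ hR hs =>
        rcases ih with h3 | ⟨h3, -⟩
        · exact Or.inl (h3.trans (List.prefix_append _ _))
        · exact absurd rfl h3
      | conflict M C p =>
        rcases ih with h3 | ⟨h3, -⟩
        · exact Or.inl h3
        · exact absurd rfl h3
      | drop M C γ p p' =>
        simp only [State.trail] at ih ⊢
        rcases ih with h3 | ⟨-, h3⟩
        · rcases List.prefix_concat_iff.1 h3 with h4 | h4
          · exact Or.inr ⟨by simp [State.conflictPoly], h4 ▸ List.prefix_append _ _⟩
          · exact Or.inl h4
        · exact Or.inr ⟨by simp [State.conflictPoly], (List.prefix_append _ _).trans h3⟩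
      | learn M C p hp =>
        exact ih.imp_right fun h3 => ⟨by simp [State.conflictPoly], h3.2⟩
      | backjump M M' C γ γ' p hγ hγ' =>
        simp only [State.trail] at ih h1 h2 ⊢
        have hpre : M ++ [γ] <+: M ++ [γ] ++ M' := List.prefix_append _ _
        have hM : L₀ ≤ M.length := by
          by_contra hM
          have h4 : M ++ [γ] <+: P L₀ :=
            List.prefix_of_prefix_length_le hpre h1 (by simp [hlen]; omega)
          have h5 : M ++ [γ'] <+: P L₀ :=
            List.prefix_of_prefix_length_le List.prefix_rfl h2 (by simp [hlen]; omega)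
          exact absurd (eq_of_concat_prefix h4 h5 ▸ hγ) hγ'.just_ne
        have hno : ¬ M ++ [γ] <+: Q := fun h3 => hmin M γ h3 hM hγ
        rcases ih with h3 | ⟨-, h3⟩
        · left
          by_cases hl : Q.length ≤ M.length
          · refine (List.prefix_of_prefix_length_le h3 ?_ hl).trans (List.prefix_append _ _)
            exact (List.prefix_append _ _).trans hpre
          · exact absurd (List.prefix_of_prefix_length_le hpre h3 (by simp; omega)) hno
        · exact absurd (hpre.trans h3) hno
  have hPQ : P Q.length = Q := by
    have h1 := hP Q.length _ (le_max_right t _)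
    rcases hinv _ (le_max_left t (T Q.length)) with h2 | ⟨-, h2⟩
    · exact (List.prefix_of_prefix_length_le h1 h2 (by simp [hlen])).eq_of_length (by simp [hlen])
    · exact (h1.trans h2).eq_of_length (by simp [hlen])
  refine hAB Q.length fun x hx => ?_
  rw [hPQ]
  exact (hN.created ((hT _).trans ht) hQ hQL).decided hδ x hx

end Run.Late

/-! ### Every variable gets finitely many bounds -/

/-- The sequence `γ L₀, γ (L₀ + 1), …` of improving bounds, with initial parts `P i`. -/
structure Limit (P : ℕ → Trail V) (γ : ℕ → Bound V) (L₀ : ℕ) : Prop where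
  succ : ∀ i, P (i + 1) = P i ++ [γ i]
  improving : ∀ i, L₀ ≤ i → Improving (P i) (γ i)

namespace Limit

variable {P : ℕ → Trail V} {γ : ℕ → Bound V} {L₀ : ℕ}

theorem mono (h : Limit P γ L₀) {i j : ℕ} (hij : i ≤ j) : P i <+: P j := by
  induction j, hij using Nat.le_induction with
  | base => exact List.prefix_rfl
  | succ j hij ih => rw [h.succ]; exact ih.trans (List.prefix_append _ _)

theorem bounds_eq (h : Limit P γ L₀) {i j : ℕ} (hij : i ≤ j) {y : V}
    (hy : ∀ k, i ≤ k → (γ k).var ≠ y) :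
    lower (P j) y = lower (P i) y ∧ upper (P j) y = upper (P i) y := by
  induction j, hij using Nat.le_induction with
  | base => exact ⟨rfl, rfl⟩
  | succ j hij ih =>
    rw [h.succ, lower_concat_of_not _ fun h0 => hy j hij h0.1,
      upper_concat_of_not _ fun h0 => hy j hij h0.1]
    exact ih

/-- Bounds of one kind for `x` have distinct values, so each kind occurs at most as often as `A` has
elements. -/
theorem finite_of_val_mem (h : Limit P γ L₀) (x : V) {A : Set ℤ} (hA : A.Finite) :
    {i | L₀ ≤ i ∧ (γ i).var = x ∧ (γ i).val ∈ A}.Finite := by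
  have key : ∀ kind, {i | L₀ ≤ i ∧ (γ i).var = x ∧ (γ i).val ∈ A ∧ (γ i).kind = kind}.Finite := by
    intro kind
    refine Set.Finite.of_injOn (f := fun i => (γ i).val) (fun i hi => hi.2.2.1) ?_ hA
    intro i hi j hj hij
    by_contra hne
    wlog hlt : i < j generalizing i j
    · exact this hj hi hij.symm (Ne.symm hne) (by omega)
    refine (h.improving j hj.1).val_ne (M := P i) (γ := γ i) ?_ (hi.2.1.trans hj.2.1.symm)
      (hi.2.2.2.trans hj.2.2.2.symm) hij
    rw [← h.succ]
    exact h.mono hlt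
  refine ((key .ge).union (key .le)).subset fun i hi => ?_
  cases hk : (γ i).kind with
  | ge => exact Or.inl ⟨hi.1, hi.2.1, hi.2.2, hk⟩
  | le => exact Or.inr ⟨hi.1, hi.2.1, hi.2.2, hk⟩

theorem finite_of_eventually_val_mem (h : Limit P γ L₀) (x : V) {A : Set ℤ} (hA : A.Finite)
    (i₀ : ℕ) (hi₀ : ∀ i, i₀ ≤ i → (γ i).var = x → (γ i).val ∈ A) :
    {i | (γ i).var = x}.Finite := by
  refine ((Set.finite_lt_nat (max i₀ L₀)).union (h.finite_of_val_mem x hA)).subset fun i hi => ?_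
  by_cases hlt : i < max i₀ L₀
  · exact Or.inl hlt
  · exact Or.inr ⟨by omega, hi, hi₀ i (by omega) hi⟩

/-- Every further bound for `x` is compatible with both existing bounds, so its value lies in a
fixed finite interval. -/
theorem finite_of_twoSided (h : Limit P γ L₀) {x : V} {i₀ : ℕ} (hx : TwoSided (P i₀) x) :
    {i | (γ i).var = x}.Finite := by
  obtain ⟨l, hl⟩ := WithBot.ne_bot_iff_exists.1 hx.1
  obtain ⟨u, hu⟩ := WithTop.ne_top_iff_exists.1 hx.2
  refine h.finite_of_eventually_val_mem x (Set.finite_Icc l u) (max i₀ L₀) fun i hi hix => ?_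
  have h1 := lower_mono (h.mono (by omega : i₀ ≤ i)) x
  have h2 := upper_anti (h.mono (by omega : i₀ ≤ i)) x
  rw [← hl] at h1
  rw [← hu] at h2
  have h3 : lower (P i) x ≤ (γ i).val ∧ ((γ i).val : WithTop ℤ) ≤ upper (P i) x := by
    rcases h.improving i (by omega) with ⟨-, h3, h4⟩ | ⟨-, h3, h4⟩ <;> rw [hix] at h3 h4
    · exact ⟨h3.le, h4⟩
    · exact ⟨h3, h4.le⟩
  exact ⟨by exact_mod_cast h1.trans h3.1, by exact_mod_cast h3.2.trans h2⟩

/-- Bounds that stem from a single satisfiable divisibility constraint do not overshoot its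
solutions. -/
theorem finite_of_dvd (h : Limit P γ L₀) {x : V} (hx : ∀ i, ¬ TwoSided (P i) x) {d a k : ℤ}
    (hd : 0 < d) (ha : 0 < a) (hgcd : (Int.gcd a d : ℤ) ∣ k) (i₀ : ℕ)
    (hi₀ : ∀ i, i₀ ≤ i → (γ i).var = x →
      ∃ b, IsCurrent (P i) x b (γ i).kind ∧ (γ i).val = dvdBound d a k b (γ i).kind) :
    {i | (γ i).var = x}.Finite := by
  by_cases hex : ∃ i₁, max i₀ L₀ ≤ i₁ ∧ (γ i₁).var = x
  swap
  · push Not at hex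
    exact (Set.finite_lt_nat (max i₀ L₀)).subset fun i hi => by
      by_contra hlt
      exact hex i (by simpa using hlt) hi
  obtain ⟨i₁, hi₁, hx₁⟩ := hex
  obtain ⟨b, hb, -⟩ := hi₀ i₁ (by omega) hx₁
  cases hk : (γ i₁).kind with
  | ge =>
    rw [hk] at hb
    have hb' : lower (P i₁) x = b := hb
    -- This solution is the barrier: by `dvdBound_ge_le` the growing lower bounds never exceed it.
    obtain ⟨e, hbe, he⟩ := exists_ge_solution hd hgcd b
    have hlow : ∀ i, i₁ ≤ i → (b : WithBot ℤ) ≤ lower (P i) x := fun i hi =>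
      hb' ▸ lower_mono (h.mono hi) x
    -- A bound of the other kind needs a current bound of that kind; then `x` would have both
    -- bounds.
    have hkind : ∀ i, i₁ ≤ i → (γ i).var = x → (γ i).kind = .ge := by
      intro i hi hix
      by_contra hk'
      have hk'' : (γ i).kind = .le := by
        cases hk2 : (γ i).kind with
        | ge => exact absurd hk2 hk'
        | le => rfl
      obtain ⟨b', hb'', -⟩ := hi₀ i (by omega) hix
      rw [hk''] at hb''
      refine hx i ⟨fun h0 => ?_, fun h0 => ?_⟩
      · have := hlow i hi
        rw [h0] at this
        simp at this
      · have := h0.symm.trans (show upper (P i) x = b' from hb'')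
        simp at this
    have hval : ∀ i, i₁ ≤ i → (γ i).var = x → lower (P i) x ≤ e → (γ i).val ≤ e := by
      intro i hi hix hle
      obtain ⟨b', hb'', hv⟩ := hi₀ i (by omega) hix
      rw [hkind i hi hix] at hb'' hv
      rw [show lower (P i) x = b' from hb''] at hle
      rw [hv]
      exact dvdBound_ge_le hd ha (by exact_mod_cast hle) he
    have hle : ∀ i, i₁ ≤ i → lower (P i) x ≤ e := by
      intro i hi
      induction i, hi using Nat.le_induction with
      | base => rw [hb']; exact_mod_cast hbe
      | succ i hi ih =>
        rw [h.succ]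
        by_cases hix : (γ i).var = x
        · have := hval i hi hix ih
          subst hix
          rw [lower_concat_of_ge _ (hkind i hi rfl)]
          exact max_le ih (by exact_mod_cast this)
        · rwa [lower_concat_of_not _ fun h0 => hix h0.1]
    refine h.finite_of_eventually_val_mem x (Set.finite_Icc b e) i₁ fun i hi hix => ?_
    refine ⟨?_, hval i hi hix (hle i hi)⟩
    rcases h.improving i (by omega) with ⟨-, h3, -⟩ | ⟨h3, -⟩
    · rw [hix] at h3
      exact_mod_cast ((hlow i hi).trans_lt h3).le
    · rw [hkind i hi hix] at h3
      cases h3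
  | le =>
    rw [hk] at hb
    have hb' : upper (P i₁) x = b := hb
    obtain ⟨e, hbe, he⟩ := exists_le_solution hd hgcd b
    have hup : ∀ i, i₁ ≤ i → upper (P i) x ≤ (b : WithTop ℤ) := fun i hi =>
      hb' ▸ upper_anti (h.mono hi) x
    have hkind : ∀ i, i₁ ≤ i → (γ i).var = x → (γ i).kind = .le := by
      intro i hi hix
      by_contra hk'
      have hk'' : (γ i).kind = .ge := by
        cases hk2 : (γ i).kind with
        | ge => rfl
        | le => exact absurd hk2 hk'
      obtain ⟨b', hb'', -⟩ := hi₀ i (by omega) hix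
      rw [hk''] at hb''
      refine hx i ⟨fun h0 => ?_, fun h0 => ?_⟩
      · have := h0.symm.trans (show lower (P i) x = b' from hb'')
        simp at this
      · have := hup i hi
        rw [h0] at this
        simp at this
    have hval : ∀ i, i₁ ≤ i → (γ i).var = x → (e : WithTop ℤ) ≤ upper (P i) x →
        e ≤ (γ i).val := by
      intro i hi hix hle
      obtain ⟨b', hb'', hv⟩ := hi₀ i (by omega) hix
      rw [hkind i hi hix] at hb'' hv
      rw [show upper (P i) x = b' from hb''] at hle
      rw [hv]
      exact le_dvdBound_le hd ha (by exact_mod_cast hle) he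
    have hle : ∀ i, i₁ ≤ i → (e : WithTop ℤ) ≤ upper (P i) x := by
      intro i hi
      induction i, hi using Nat.le_induction with
      | base => rw [hb']; exact_mod_cast hbe
      | succ i hi ih =>
        rw [h.succ]
        by_cases hix : (γ i).var = x
        · have := hval i hi hix ih
          subst hix
          rw [upper_concat_of_le _ (hkind i hi rfl)]
          exact le_min ih (by exact_mod_cast this)
        · rwa [upper_concat_of_not _ fun h0 => hix h0.1]
    refine h.finite_of_eventually_val_mem x (Set.finite_Icc e b) i₁ fun i hi hix => ?_
    refine ⟨hval i hi hix (hle i hi), ?_⟩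
    rcases h.improving i (by omega) with ⟨h3, -⟩ | ⟨-, -, h3⟩
    · rw [hkind i hi hix] at h3
      cases h3
    · rw [hix] at h3
      exact_mod_cast (h3.trans_le (hup i hi)).le

end Limit

theorem finite_setOf_isBound {C : Problem V} (hC : C.Finite) (M : Trail V) (x : V) :
    {b | ∃ p, Constraint.le p ∈ C ∧ IsBound M p x b}.Finite := by
  have hJ : ∀ J ∈ C, {b | ∃ p, J = .le p ∧ IsBound M p x b}.Finite := fun J _ => by
    refine Set.Subsingleton.finite ?_
    rintro b ⟨p, rfl, hb⟩ b' ⟨p', hp', hb'⟩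
    injection hp' with hp'
    subst hp'
    exact hb.unique hb'
  refine (hC.biUnion hJ).subset ?_
  rintro b ⟨p, hp, hb⟩
  exact Set.mem_iUnion₂.2 ⟨.le p, hp, p, rfl, hb⟩

/-! ### The limit is finite: induction on the rank of variables -/

namespace Run

/-- The other variables of a constraint whose rank is that of the unguarded variable `x` are
smaller. -/
theorem rank_lt_of_ne (h : Run xS C₀ S L lt) {J : Constraint V} {x y : V}
    (hx : x ∈ initUnguarded xS C₀)
    (hr : J.rank (initUnguarded xS C₀) (lt 0) = rank (initUnguarded xS C₀) (lt 0) x)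
    (hy : y ∈ J.vars) (hyx : y ≠ x) :
    rank (initUnguarded xS C₀) (lt 0) y < rank (initUnguarded xS C₀) (lt 0) x := by
  refine lt_of_le_of_ne (hr ▸ rank_le_of_mem hy) fun heq => hyx (h.rank_injOn ?_ hx heq)
  rw [← rank_pos (r := lt 0), heq]
  exact rank_pos.2 hx

/-- Assume that `x` never has both bounds. This excludes decisions. After `i₁` the smaller variables
are settled, so each inequality with top variable `x` propagates one constant value, and improving
bounds use up these values by `i₂`. Beyond that only divisibility remains, and the strategy permits
it for a one-sided variable only if the constraint is the sole one with top variable `x` and is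
solvable. -/
theorem finite_of_rank (h : Run xS C₀ S L lt) {N : ℕ} {P : ℕ → Trail V} {γ : ℕ → Bound V} {L₀ : ℕ}
    (hlim : Limit P γ L₀) (hc : ∀ i, L₀ ≤ i → Created h N (P i) (γ i)) {x : V}
    (hx : x ∈ initUnguarded xS C₀)
    (ih : ∀ y ∈ problemVars (S N).problem, rank (initUnguarded xS C₀) (lt 0) y <
      rank (initUnguarded xS C₀) (lt 0) x → {i | (γ i).var = y}.Finite) :
    {i | (γ i).var = x}.Finite := by
  by_cases htwo : ∃ i, TwoSided (P i) x
  · obtain ⟨i, hi⟩ := htwo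
    exact hlim.finite_of_twoSided hi
  push Not at htwo
  obtain ⟨i₁, hi₁⟩ : ∃ i₁, ∀ y ∈ problemVars (S N).problem,
      rank (initUnguarded xS C₀) (lt 0) y < rank (initUnguarded xS C₀) (lt 0) x →
      ∀ i, i₁ ≤ i → (γ i).var ≠ y := by
    have hfin : (⋃ y ∈ {y ∈ problemVars (S N).problem | rank (initUnguarded xS C₀) (lt 0) y <
        rank (initUnguarded xS C₀) (lt 0) x}, {i | (γ i).var = y}).Finite :=
      ((problemVars_finite (h.problem_finite N)).subset fun y hy => hy.1).biUnion
        fun y hy => ih y hy.1 hy.2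
    obtain ⟨B, hB⟩ := hfin.bddAbove
    refine ⟨B + 1, fun y hy hr i hi hiy => ?_⟩
    have := mem_upperBounds.1 hB i (Set.mem_biUnion (⟨hy, hr⟩ : y ∈ {y ∈ _ | _}) hiy)
    omega
  have hsmall : ∀ J ∈ (S N).problem,
      J.rank (initUnguarded xS C₀) (lt 0) = rank (initUnguarded xS C₀) (lt 0) x →
      ∀ i j, i₁ ≤ i → i ≤ j → ∀ y ∈ J.vars, y ≠ x →
      lower (P j) y = lower (P i) y ∧ upper (P j) y = upper (P i) y := by
    intro J hJ hr i j hi hij y hy hyx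
    exact hlim.bounds_eq hij fun k hk =>
      hi₁ y ⟨J, hJ, hy⟩ (h.rank_lt_of_ne hx hr hy hyx) k (hi.trans hk)
  -- All values that inequalities propagate for `x` after `i₁` can be computed from `P i₁`.
  obtain ⟨i₂, hi₂⟩ := (hlim.finite_of_val_mem x
    (finite_setOf_isBound (h.problem_finite N) (P i₁) x)).bddAbove
  have hsource : ∀ i, max (max i₁ L₀) (i₂ + 1) ≤ i → (γ i).var = x →
      ∃ (J : Constraint V) (d a k b : ℤ) (p : Poly V), J ∈ (S N).problem ∧
      J.rank (initUnguarded xS C₀) (lt 0) = rank (initUnguarded xS C₀) (lt 0) x ∧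
      DvdForm J d a x p ∧ IsVal (P i) p k ∧ IsCurrent (P i) x b (γ i).kind ∧
      (γ i).val = dvdBound d a k b (γ i).kind ∧ 0 < d ∧ (Int.gcd a d : ℤ) ∣ k ∧
      ∀ J' ∈ (S N).problem, J'.IsDvd → x ∈ J'.vars →
        J'.rank (initUnguarded xS C₀) (lt 0) = rank (initUnguarded xS C₀) (lt 0) x → J' = J := by
    intro i hi hix
    have hs := (hc i (by omega)).source (by rw [hix]; exact hx)
    rw [← hix] at hx htwo ⊢
    cases hs with
    | decided h1 =>
      rw [← hlim.succ] at h1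
      exact absurd h1 (htwo _)
    | le p hp hr hb =>
      have hb' : IsBound (P i₁) p x (γ i).val := by
        rw [hix] at hb
        refine hb.congr fun y hy hyx => ?_
        exact hsmall _ hp (by rw [hr, hix]) i₁ i le_rfl (by omega) y (mem_vars_le.2 hy) hyx
      have h1 := mem_upperBounds.1 hi₂ i ⟨by omega, hix, p, hp, hb'⟩
      omega
    | twoSided h1 => exact absurd h1 (htwo _)
    | dvd J d a k b p hJ hr hf hv hb hval hd hgcd hu =>
      exact ⟨J, d, a, k, b, p, hJ, hr, hf, hv, hb, hval, hd, hgcd, hu⟩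
  by_cases hex : ∃ i₃, max (max i₁ L₀) (i₂ + 1) ≤ i₃ ∧ (γ i₃).var = x
  swap
  · push Not at hex
    exact (Set.finite_lt_nat (max (max i₁ L₀) (i₂ + 1))).subset fun i hi => by
      by_contra hlt
      exact hex i (by simpa using hlt) hi
  obtain ⟨i₃, hi₃, hx₃⟩ := hex
  obtain ⟨J, d, a, k, -, p, hJ, hr, hf, hv, -, -, hd, hgcd, hu⟩ := hsource i₃ hi₃ hx₃
  refine hlim.finite_of_dvd htwo hd hf.1 hgcd i₃ fun i hi hix => ?_
  obtain ⟨J', d', a', k', b, p', hJ', hr', hf', hv', hb', hval', -⟩ := hsource i (by omega) hix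
  obtain rfl := hu J' hJ' hf'.isDvd ((hf'.mem_vars_iff x).2 (Or.inl rfl)) hr'
  obtain ⟨rfl, rfl, rfl⟩ := hf.unique hf'
  -- The other variables are settled, so the value of `p` no longer changes and all bounds come from
  -- the same `d`, `a` and `k`.
  have hk : k = k' := by
    have h1 : lowerPoly (P i) p = lowerPoly (P i₃) p := by
      refine lowerPoly_congr fun y hy => hsmall J' hJ hr i₃ i (by omega) hi y
        ((hf.mem_vars_iff y).2 (Or.inr hy)) ?_
      rintro rfl
      exact hy hf.2.1
    rw [hv.2, hv'.2] at h1
    exact_mod_cast h1.symm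
  subst hk
  exact ⟨b, hb', hval'⟩

/-- The limit has infinitely many bounds, but finitely many variables occur and each receives
finitely many: guarded ones by `exists_twoSided`, unguarded ones by strong induction on the rank. -/
theorem false (h : Run xS C₀ S L lt) : False := by
  obtain ⟨N, hN⟩ := h.exists_late
  obtain ⟨T, P, γ, hT, hlen, hP, hsucc⟩ := hN.exists_limit
  obtain ⟨i₀, hi₀⟩ := hN.exists_twoSided hT hlen hP
  have hc : ∀ i, (S N).trail.length ≤ i → Created h N (P i) (γ i) := fun i hi =>
    hN.created (hT (i + 1)) (by rw [← hsucc]; exact hP _ _ le_rfl) (by rw [hlen]; exact hi)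
  have hlim : Limit P γ (S N).trail.length := ⟨hsucc, fun i hi => (hc i hi).improving⟩
  have key : ∀ r, ∀ x ∈ problemVars (S N).problem, rank (initUnguarded xS C₀) (lt 0) x = r →
      {i | (γ i).var = x}.Finite := by
    intro r
    induction r using Nat.strong_induction_on with
    | _ r ih =>
      rintro x hx rfl
      rcases h.mem_initUnguarded_or N hx with hxU | hg
      · exact h.finite_of_rank hlim hc hxU fun y hy hlt => ih _ hlt y hy rfl
      · exact hlim.finite_of_twoSided (hi₀ x hg)
  have hfin : (⋃ x ∈ problemVars (S N).problem, {i | (γ i).var = x}).Finite :=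
    (problemVars_finite (h.problem_finite N)).biUnion fun x hx => key _ x hx rfl
  refine (Set.Ici_infinite (S N).trail.length) (hfin.subset fun i hi => ?_)
  exact Set.mem_biUnion (hc i hi).mem_vars rfl

end Run

end CutSat

theorem mainTheorem2 {V : Type*} (C₀ : Set (CutSat.Constraint V)) (hfin : C₀.Finite)
    (hpos : ∀ (d : ℤ) (p : CutSat.Poly V), CutSat.Constraint.dvd d p ∈ C₀ → 0 < d)
    (xS : V) (hxS : xS ∉ CutSat.problemVars C₀) :
    ¬ ∃ (S : ℕ → CutSat.State V) (L : ℕ → CutSat.Rule V) (lt : ℕ → V → V → Prop),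
      CutSat.InfiniteDerivation xS C₀ S L lt ∧ CutSat.StrictlyTwoLayered xS S L lt := by
  rintro ⟨S, L, lt, hd, hs⟩
  refine CutSat.Run.false (xS := xS) (C₀ := C₀) ⟨hd, hs, hfin, fun J hJ => ?_⟩
  cases J with
  | le p => trivial
  | dvd d p => exact hpos d p hJ
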